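/- **Setting.** Let $\mathcal O\mapsto\mathfrak A(\mathcal O)$ be a local net of von Neumann algebras (indexed by bounded open regions of Minkowski space of dimension $s+1\ge 3$) on a Hilbert space $\mathcal H$, with a strongly continuous unitary representation $U(x,\Lambda)$ of the proper orthochronous Poincaré group and an invariant unit vector $\Omega$, satisfying isotony, locality, covariance, positivity of energy (the joint spectrum of the translation generators lies in the closed forward light cone) and uniqueness of the translation-invariant vector $\Omega$ up to scalars. Write $U(t)=e^{itH}$ for the time translations, $R=(1+H)^{-1}$, $P(E)$ for the spectral projector of $H$ for $[0,E]$, and $\mathfrak A(r)$ for the algebra of the double cone of radius $r$ centred at the origin. Let $\Sigma$ be the space of ultraweakly continuous functionals on $\mathfrak B(\mathcal H)$; for $\sigma\in\Sigma$, $\ell>0$ put $\|\sigma\|_\ell=\|\sigma(R^{-\ell}\,\cdot\,R^{-\ell})\|$; let $\mathcal C^\infty(\Sigma)=\{\sigma\in\Sigma:\|\sigma\|_\ell<\infty\ \forall\ell>0\}$ with the Fréchet topology of these norms, $\mathcal C^\infty(\Sigma)^*$ its dual with the weak* topology, and $\|\cdot\|_{-\ell}$ the norm dual to $\|\cdot\|_\ell$.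 Put $\Sigma(E)=\{\sigma(P(E)\cdot P(E)):\sigma\in\Sigma\}$ and $\phi^*(\sigma)=\overline{\phi(\sigma^*)}$, where $\sigma^*(A)=\overline{\sigma(A^*)}$. *Phase space condition (assumed):* for every $\gamma\ge0$ there is a continuous linear finite-rank map $\psi:\mathcal C^\infty(\Sigma)\to\Sigma$ such that for all sufficiently large $\ell$, $r^{-\gamma}\sup\{|\sigma(A)-\psi(\sigma)(A)|:\|\sigma\|_\ell\le1,\ A\in\mathfrak A(r),\ \|A\|\le1\}\to0$ as $r\to0$. Let $\Phi_\gamma\subset\mathcal C^\infty(\Sigma)^*$ be the image of the dual map $\psi^*:\mathfrak B(\mathcal H)\to\mathcal C^\infty(\Sigma)^*$ for such a $\psi$ of minimal rank (the image does not depend on the choice), and $\Phi_{\rm FH}=\bigcup_{\gamma\ge0}\Phi_\gamma$ the space of pointlike fields. For $f\in\mathcal D(\mathbb R)$ let $\phi(f)=\int dt\,f(t)\,U(t)\phi U(t)^*$. Let $\mathcal K$ be the space of analytic functions $F$ on the open lower half plane such that $\sup_{-1\le{\rm Im} z<0}|F(z)||{\rm Im} z|^{\ell}<\infty$ for some $\ell>0$,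 and $\mathcal K_+\subset\mathcal K$ the set of those whose boundary value $F(x-i0)$ is a distribution of positive type: $\int ds\,ds'\,F(s'-i0)\,\bar g(s+s'/2)\,g(s-s'/2)\ge0$ for all $g\in\mathcal S(\mathbb R)$. The set of *classically positive* products is $$\Phi_{\rm pos}=\Big\{\sum_{j}K_j\otimes\phi_j^*\otimes\phi_j\ \text{(finite sums)}:\ K_j\in\mathcal K_+,\ \phi_j\in\Phi_{\rm FH}\Big\}\subset\mathcal K\otimes\mathcal C^\infty(\Sigma)^*\otimes\mathcal C^\infty(\Sigma)^* .$$ For $d>0$, $m\in\mathbb N$ put $\|f\|_{d,m}=\max_{0\le n\le m}d^n\|f^{(n)}\|_1$ on $\mathcal D(-d,d)$. A $\mathcal C^\infty(\Sigma)^*$-valued distribution is a linear map $T:\mathcal D(\mathbb R)\to\mathcal C^\infty(\Sigma)^*$ for which there are $\ell>0$, $m$ and, for each $d>0$, a constant $c_d$ with $\|T(f)\|_{-\ell}\le c_d\|f\|_{d,m}$ for $f\in\mathcal D(-d,d)$. To a product $\Pi=\sum_jK_j\otimes\phi_j\otimes\phi_j'$ one associates the $\mathcal C^\infty(\Sigma)^*$-valued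 distribution $T_\Pi$ determined by $$\sigma(T_\Pi(f))=\sum_j\int ds'\,f(s')\,K_j(s'-i0)\,\sigma\big(\phi_j(s'/2-i0)\,\phi_j'(-s'/2+i0)\big),\qquad \sigma\in\bigcup_{E>0}\Sigma(E),$$ where $\sigma(\phi_j(s'/2-i0)\phi'_j(-s'/2+i0))$ is the boundary value at $z=s'-i0$ of the analytic function $\sigma(e^{izH/2}\phi_je^{-izH}\phi_j'e^{izH/2})$, ${\rm Im}\,z<0$. For a map $T:\mathcal D(\mathbb R)\to\mathcal C^\infty(\Sigma)^*$ put $$T\langle g_1,g_2\rangle=\int ds\,U(s)\,T\big(g_1(s+\tfrac{\cdot}{2})\,g_2(s-\tfrac{\cdot}{2})\big)\,U(s)^*\quad\text{(weak integral)}.$$ Let $\alpha\ge0$. A continuous projector $p$ in $\mathcal C^\infty(\Sigma)^*$ that is hermitean ($p(\phi^*)=p(\phi)^*$) and has finite-dimensional image contained in $\Phi_{\rm FH}$ is called *$\alpha$-approximating* for $\Pi$ if there are $\ell>0$ and $m\in\mathbb N$ such that, with $T=T_\Pi-p\,T_\Pi$, $$\sup\Big\{\frac{\|T\langle g_1,g_2\rangle\|_{-\ell}}{\|g_1\|_{d,m}\|g_2\|_{d,m}}:\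 0\ne g_1,g_2\in\mathcal D(-d,d)\Big\}=o(d^\alpha)\quad\text{as }d\to0 .$$ **Theorem.** Let $\alpha\ge0$ and $\Pi\in\Phi_{\rm pos}\setminus\{0\}$. Suppose that the vacuum vector $\Omega$ is separating for the smeared fields: $\phi(f)\Omega=0$ implies $\phi(f)=0$, for all $\phi\in\Phi_{\rm FH}$ and $f\in\mathcal D(\mathbb R)$. If $p$ is an $\alpha$-approximating projector for $\Pi$, then $p\ne0$. -/

import Mathlib

open scoped Matrix TensorProduct InnerProductSpace ComplexConjugate SchwartzMap Topology Distributions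

namespace PointlikeQFT

noncomputable section

/-! ### Minkowski space and the proper orthochronous Lorentz group -/

/-- Minkowski space with `s` spatial dimensions; coordinate `0` is time. -/
abbrev Spacetime (s : ℕ) : Type := Fin (s + 1) → ℝ

/-- The Minkowski metric `diag(1, -1, …, -1)`. -/
def minkowskiMetric (s : ℕ) : Matrix (Fin (s + 1)) (Fin (s + 1)) ℝ :=
  Matrix.diagonal (Fin.cons 1 (fun _ => -1))

/-- The Lorentz square `x ⬝ x = (x⁰)² - ∑ᵢ (xⁱ)²`. -/
def lorentzSq {s : ℕ} (x : Spacetime s) : ℝ := x 0 ^ 2 - ∑ i : Fin s, x i.succ ^ 2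

/-- The set of matrices `Λ` with `Λᵀ η Λ = η`, `det Λ = 1`, `Λ⁰₀ > 0`. -/
def IsProperOrthochronous {s : ℕ} (Λ : Matrix (Fin (s + 1)) (Fin (s + 1)) ℝ) : Prop :=
  Λᵀ * minkowskiMetric s * Λ = minkowskiMetric s ∧ Λ.det = 1 ∧ 0 < Λ 0 0

theorem minkowskiMetric_mul_self (s : ℕ) : minkowskiMetric s * minkowskiMetric s = 1 := by
  unfold minkowskiMetric
  rw [Matrix.diagonal_mul_diagonal, ← Matrix.diagonal_one]
  congr 1
  funext i
  refine Fin.cases ?_ (fun j => ?_) i <;> simp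

theorem IsProperOrthochronous.col_sq {s : ℕ} {Λ : Matrix (Fin (s + 1)) (Fin (s + 1)) ℝ}
    (h : Λᵀ * minkowskiMetric s * Λ = minkowskiMetric s) :
    Λ 0 0 ^ 2 = 1 + ∑ i : Fin s, Λ i.succ 0 ^ 2 := by
  have h0 := congrFun (congrFun h 0) 0
  rw [Matrix.mul_apply] at h0
  simp only [minkowskiMetric, Matrix.mul_diagonal, Matrix.transpose_apply,
    Fin.sum_univ_succ, Fin.cons_zero, Fin.cons_succ, Matrix.diagonal_apply_eq] at h0
  have h1 : ∑ i : Fin s, Λ i.succ 0 * -1 * Λ i.succ 0 = - ∑ i : Fin s, Λ i.succ 0 ^ 2 := by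
    rw [← Finset.sum_neg_distrib]
    exact Finset.sum_congr rfl fun i _ => by ring
  rw [h1] at h0
  linarith

theorem IsProperOrthochronous.transpose_rel {s : ℕ}
    {Λ : Matrix (Fin (s + 1)) (Fin (s + 1)) ℝ}
    (h : Λᵀ * minkowskiMetric s * Λ = minkowskiMetric s) :
    Λᵀᵀ * minkowskiMetric s * Λᵀ = minkowskiMetric s := by
  have h1 : (minkowskiMetric s * Λᵀ * minkowskiMetric s) * Λ = 1 := by
    rw [Matrix.mul_assoc, Matrix.mul_assoc, ← Matrix.mul_assoc Λᵀ, h, minkowskiMetric_mul_self]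
  have h2 := mul_eq_one_comm.mp h1
  rw [Matrix.transpose_transpose]
  calc Λ * minkowskiMetric s * Λᵀ
      = Λ * (minkowskiMetric s * Λᵀ * minkowskiMetric s) * minkowskiMetric s := by
        simp only [Matrix.mul_assoc, minkowskiMetric_mul_self, Matrix.mul_one]
    _ = minkowskiMetric s := by rw [h2, Matrix.one_mul]

/-- The proper orthochronous Lorentz group, as a monoid under matrix multiplication. -/
def Lorentz (s : ℕ) : Submonoid (Matrix (Fin (s + 1)) (Fin (s + 1)) ℝ) where
  carrier := {Λ | IsProperOrthochronous Λ}
  one_mem' := ⟨by simp, by simp, by simp⟩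
  mul_mem' := by
    rintro A B ⟨hA, hdA, hA0⟩ ⟨hB, hdB, hB0⟩
    refine ⟨?_, by simp [hdA, hdB], ?_⟩
    · calc (A * B)ᵀ * minkowskiMetric s * (A * B)
          = Bᵀ * (Aᵀ * minkowskiMetric s * A) * B := by
            simp only [Matrix.transpose_mul, Matrix.mul_assoc]
        _ = minkowskiMetric s := by rw [hA, hB]
    · have ha := IsProperOrthochronous.col_sq (IsProperOrthochronous.transpose_rel hA)
      have hb := IsProperOrthochronous.col_sq hB
      simp only [Matrix.transpose_apply] at ha
      have hcs := Finset.sum_mul_sq_le_sq_mul_sq Finset.univ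
        (fun i : Fin s => A 0 i.succ) (fun i : Fin s => B i.succ 0)
      rw [Matrix.mul_apply, Fin.sum_univ_succ]
      have hSa : 0 ≤ ∑ i : Fin s, A 0 i.succ ^ 2 := Finset.sum_nonneg fun i _ => sq_nonneg _
      have hSb : 0 ≤ ∑ i : Fin s, B i.succ 0 ^ 2 := Finset.sum_nonneg fun i _ => sq_nonneg _
      have hlt : (∑ i : Fin s, A 0 i.succ * B i.succ 0) ^ 2 < (A 0 0 * B 0 0) ^ 2 := by
        rw [mul_pow, ha, hb]
        nlinarith
      have := abs_lt_of_sq_lt_sq hlt (mul_pos hA0 hB0).le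
      have := (abs_lt.mp this).1
      linarith

/-- A region: a bounded open subset of Minkowski space. -/
def IsRegion {s : ℕ} (O : Set (Spacetime s)) : Prop := IsOpen O ∧ Bornology.IsBounded O

/-- Spacelike separation of two subsets of Minkowski space. -/
def SpacelikeSeparated {s : ℕ} (O₁ O₂ : Set (Spacetime s)) : Prop :=
  ∀ x ∈ O₁, ∀ y ∈ O₂, lorentzSq (x - y) < 0

/-- The standard double cone of radius `r` centred at the origin. -/
def doubleCone (s : ℕ) (r : ℝ) : Set (Spacetime s) :=
  {x | |x 0| + Real.sqrt (∑ i : Fin s, x i.succ ^ 2) < r}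

/-- The closed forward light cone. -/
def forwardCone (s : ℕ) : Set (Spacetime s) := {p | 0 ≤ p 0 ∧ 0 ≤ lorentzSq p}

/-! ### Local nets of von Neumann algebras in the vacuum sector -/

/-- A local net of von Neumann algebras `O ↦ 𝔄(O)` over Minkowski space in the vacuum sector
(only the values on regions matter), with a strongly continuous unitary representation `U` of the
proper orthochronous Poincaré group and vacuum vector `Ω`. -/
structure LocalNet (s : ℕ) (H : Type*) [NormedAddCommGroup H] [InnerProductSpace ℂ H]
    [CompleteSpace H] where
  /-- the local algebras -/
  alg : Set (Spacetime s) → VonNeumannAlgebra H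
  /-- the representation `U(x, Λ)` -/
  U : Spacetime s → Lorentz s → unitary (H →L[ℂ] H)
  /-- the vacuum vector -/
  Ω : H
  U_mul : ∀ (x y : Spacetime s) (Λ Λ' : Lorentz s),
    U x Λ * U y Λ' = U (x + Λ.1 *ᵥ y) (Λ * Λ')
  U_continuous : ∀ ψ : H,
    Continuous fun g : Spacetime s × Lorentz s => (U g.1 g.2 : H →L[ℂ] H) ψ
  norm_vacuum : ‖Ω‖ = 1
  U_vacuum : ∀ (x : Spacetime s) (Λ : Lorentz s), (U x Λ : H →L[ℂ] H) Ω = Ω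
  isotony : ∀ O₁ O₂ : Set (Spacetime s), IsRegion O₁ → IsRegion O₂ → O₁ ⊆ O₂ →
    ∀ A ∈ alg O₁, A ∈ alg O₂
  locality : ∀ O₁ O₂ : Set (Spacetime s), IsRegion O₁ → IsRegion O₂ → SpacelikeSeparated O₁ O₂ →
    ∀ A₁ ∈ alg O₁, ∀ A₂ ∈ alg O₂, A₁ * A₂ = A₂ * A₁
  covariance : ∀ (x : Spacetime s) (Λ : Lorentz s) (O : Set (Spacetime s)), IsRegion O →
    (fun A : H →L[ℂ] H => (U x Λ : H →L[ℂ] H) * A * star (U x Λ : H →L[ℂ] H)) '' (alg O)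
      = (alg ((fun y => Λ.1 *ᵥ y + x) '' O) : Set (H →L[ℂ] H))
  /-- Positivity of energy: the joint spectrum of the generators `P` of `U(x, 1) = exp (i P·x)`
  lies in the closed forward light cone, i.e. the joint spectral measure of `P` in every vector
  vanishes off that cone. -/
  positiveEnergy : ∀ ψ : H, ∃ μ : MeasureTheory.Measure (Spacetime s),
    MeasureTheory.IsFiniteMeasure μ ∧ μ (forwardCone s)ᶜ = 0 ∧
    ∀ x : Spacetime s,
      ⟪ψ, (U x 1 : H →L[ℂ] H) ψ⟫_ℂ
        = ∫ p, Complex.exp (Complex.I * ((∑ μ, p μ * x μ : ℝ) : ℂ)) ∂μ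
  vacuum_unique : ∀ ψ : H, (∀ x : Spacetime s, (U x 1 : H →L[ℂ] H) ψ = ψ) → ∃ c : ℂ, ψ = c • Ω

/-! ### Normal functionals -/

section Normal

variable {H : Type*} [NormedAddCommGroup H] [InnerProductSpace ℂ H]

/-- Ultraweakly continuous functionals on `𝔅(ℋ)`: those of the form
`σ(A) = ∑ₙ ⟨ξₙ, A ηₙ⟩` with `∑ ‖ξₙ‖², ∑ ‖ηₙ‖² < ∞`. -/
def IsNormalFunctional (σ : StrongDual ℂ (H →L[ℂ] H)) : Prop :=
  ∃ ξ η : ℕ → H, (Summable fun n => ‖ξ n‖ ^ 2) ∧ (Summable fun n => ‖η n‖ ^ 2) ∧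
    ∀ A : H →L[ℂ] H, HasSum (fun n => ⟪ξ n, A (η n)⟫_ℂ) (σ A)

theorem summable_interleave {E : Type*} [NormedAddCommGroup E] {x y : ℕ → E}
    (hx : Summable fun n => ‖x n‖ ^ 2) (hy : Summable fun n => ‖y n‖ ^ 2) :
    Summable fun n => ‖(if n % 2 = 0 then x (n / 2) else y (n / 2))‖ ^ 2 := by
  refine (HasSum.even_add_odd (m := ∑' n, ‖x n‖ ^ 2) (m' := ∑' n, ‖y n‖ ^ 2) ?_ ?_).summable
  · convert hx.hasSum using 2 with k
    simp
  · convert hy.hasSum using 2 with k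
    have h1 : (2 * k + 1) % 2 = 1 := by omega
    have h2 : (2 * k + 1) / 2 = k := by omega
    simp [h1, h2]

variable (H) in
/-- The space `Σ` of ultraweakly continuous functionals, with the norm of `𝔅(ℋ)*`. -/
def NormalFunctional : Submodule ℂ (StrongDual ℂ (H →L[ℂ] H)) where
  carrier := {σ | IsNormalFunctional σ}
  zero_mem' := ⟨0, 0, by simp, by simp, fun A => by simp [hasSum_zero]⟩
  add_mem' := by
    rintro σ τ ⟨ξ, η, hξ, hη, h⟩ ⟨ξ', η', hξ', hη', h'⟩
    refine ⟨_, _, summable_interleave hξ hξ', summable_interleave hη hη', fun A => ?_⟩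
    refine HasSum.even_add_odd ?_ ?_
    · have hk : (fun k => ⟪ξ k, A (η k)⟫_ℂ) = fun k =>
          ⟪(if 2 * k % 2 = 0 then ξ (2 * k / 2) else ξ' (2 * k / 2)),
            A (if 2 * k % 2 = 0 then η (2 * k / 2) else η' (2 * k / 2))⟫_ℂ := by
        funext k
        simp
      exact hk ▸ h A
    · have hk : (fun k => ⟪ξ' k, A (η' k)⟫_ℂ) = fun k =>
          ⟪(if (2 * k + 1) % 2 = 0 then ξ ((2 * k + 1) / 2) else ξ' ((2 * k + 1) / 2)),
            A (if (2 * k + 1) % 2 = 0 then η ((2 * k + 1) / 2)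
              else η' ((2 * k + 1) / 2))⟫_ℂ := by
        funext k
        have h1 : (2 * k + 1) % 2 = 1 := by omega
        have h2 : (2 * k + 1) / 2 = k := by omega
        simp [h1, h2]
      exact hk ▸ h' A
  smul_mem' := by
    rintro c σ ⟨ξ, η, hξ, hη, h⟩
    refine ⟨ξ, fun n => c • η n, hξ, ?_, fun A => ?_⟩
    · simpa [norm_smul, mul_pow] using hη.mul_left (‖c‖ ^ 2)
    · simpa [inner_smul_right] using (h A).mul_left c

end Normal

section Functionals

variable {H : Type*} [NormedAddCommGroup H] [InnerProductSpace ℂ H] [CompleteSpace H]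

/-- `σ ↦ σ(V · V*)`. -/
def conjFunctional (V : H →L[ℂ] H) (σ : StrongDual ℂ (H →L[ℂ] H)) : StrongDual ℂ (H →L[ℂ] H) :=
  σ.comp (ContinuousLinearMap.mulLeftRight ℂ (H →L[ℂ] H) V (star V))

theorem conjFunctional_apply (V : H →L[ℂ] H) (σ : StrongDual ℂ (H →L[ℂ] H)) (A : H →L[ℂ] H) :
    conjFunctional V σ A = σ (V * A * star V) := by
  simp [conjFunctional]

/-- The hermitean conjugate `σ*(A) = conj (σ(A*))`. -/
def starFunctional (σ : StrongDual ℂ (H →L[ℂ] H)) : StrongDual ℂ (H →L[ℂ] H) where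
  toFun A := conj (σ (star A))
  map_add' A B := by simp
  map_smul' c A := by simp
  cont := by fun_prop

theorem starFunctional_apply (σ : StrongDual ℂ (H →L[ℂ] H)) (A : H →L[ℂ] H) :
    starFunctional σ A = conj (σ (star A)) := rfl

theorem conjFunctional_normal (V : H →L[ℂ] H) {σ : StrongDual ℂ (H →L[ℂ] H)}
    (hσ : IsNormalFunctional σ) : IsNormalFunctional (conjFunctional V σ) := by
  obtain ⟨ξ, η, hξ, hη, h⟩ := hσ
  have hs : ∀ x : ℕ → H, (Summable fun n => ‖x n‖ ^ 2) →
      Summable fun n => ‖(star V) (x n)‖ ^ 2 := by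
    intro x hx
    refine Summable.of_nonneg_of_le (fun n => by positivity) (fun n => ?_)
      (hx.mul_left (‖star V‖ ^ 2))
    rw [← mul_pow]
    exact pow_le_pow_left₀ (norm_nonneg _) ((star V).le_opNorm _) 2
  refine ⟨fun n => (star V) (ξ n), fun n => (star V) (η n), hs ξ hξ, hs η hη, fun A => ?_⟩
  rw [conjFunctional_apply]
  convert h (V * A * star V) using 2 with n
  simp [ContinuousLinearMap.star_eq_adjoint, ContinuousLinearMap.adjoint_inner_left]

theorem starFunctional_normal {σ : StrongDual ℂ (H →L[ℂ] H)}
    (hσ : IsNormalFunctional σ) : IsNormalFunctional (starFunctional σ) := by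
  obtain ⟨ξ, η, hξ, hη, h⟩ := hσ
  refine ⟨η, ξ, hη, hξ, fun A => ?_⟩
  rw [starFunctional_apply]
  have h2 : HasSum (fun n => conj ⟪ξ n, (star A) (η n)⟫_ℂ) (conj (σ (star A))) :=
    (h (star A)).map (starRingEnd ℂ) Complex.continuous_conj
  convert h2 using 2 with n
  simp [ContinuousLinearMap.star_eq_adjoint, ContinuousLinearMap.adjoint_inner_right]

end Functionals

/-! ### Test functions and boundary values of analytic functions -/

/-- `𝒟(ℝ)`. -/
abbrev Test : Type := 𝓓((⊤ : TopologicalSpace.Opens ℝ), ℂ)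

/-- Membership in `𝒟(-d, d)`. -/
def SupportedIn (d : ℝ) (f : Test) : Prop := tsupport (f : ℝ → ℂ) ⊆ Set.Ioo (-d) d

/-- The norm `‖f‖_{d,m} = max_{0 ≤ n ≤ m} dⁿ ‖f⁽ⁿ⁾‖₁`. -/
def sobNorm (d : ℝ) (m : ℕ) (f : Test) : ℝ :=
  (Finset.range (m + 1)).sup' Finset.nonempty_range_add_one
    fun n => d ^ n * ∫ x, ‖iteratedDeriv n (f : ℝ → ℂ) x‖

/-- The test function `s' ↦ (g₁ ⋄ g₂)(s, s') = g₁(s + s'/2) g₂(s - s'/2)`. -/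
def diamond (g₁ g₂ : Test) (s : ℝ) : Test where
  toFun s' := g₁ (s + s' / 2) * g₂ (s - s' / 2)
  contDiff' := by
    have h1 := g₁.contDiff
    have h2 := g₂.contDiff
    exact (h1.comp (by fun_prop : ContDiff ℝ _ fun s' : ℝ => s + s' / 2)).mul
      (h2.comp (by fun_prop : ContDiff ℝ _ fun s' : ℝ => s - s' / 2))
  hasCompactSupport' := by
    have hc : Topology.IsClosedEmbedding fun s' : ℝ => s + s' / 2 := by
      have := ((Homeomorph.mulRight₀ (2⁻¹ : ℝ) (by norm_num)).trans
        (Homeomorph.addLeft s)).isClosedEmbedding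
      have he : (fun s' : ℝ => s + s' / 2) = ⇑((Homeomorph.mulRight₀ (2⁻¹ : ℝ) (by norm_num)).trans
          (Homeomorph.addLeft s)) := by
        funext s'
        simp [div_eq_mul_inv]
      rw [he]
      exact this
    exact (g₁.hasCompactSupport.comp_isClosedEmbedding hc).mul_right
  tsupport_subset' := by simp

/-- `F` is analytic on the lower half plane and satisfies
`sup_{-1 ≤ Im z < 0} |F(z)| |Im z|^ℓ < ∞` for some `ℓ > 0`.  Functions on the lower half plane
are represented by their extension by zero. -/
def RegularAtBoundary (F : ℂ → ℂ) : Prop :=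
  DifferentiableOn ℂ F {z | z.im < 0} ∧ (∀ z : ℂ, 0 ≤ z.im → F z = 0) ∧
    ∃ ℓ : ℝ, 0 < ℓ ∧ ∃ C : ℝ, ∀ z : ℂ, -1 ≤ z.im → z.im < 0 → ‖F z‖ * |z.im| ^ ℓ ≤ C

/-- The space `𝒦` of analytic functions on the lower half plane that are regular at the
boundary. -/
def Kernel : Submodule ℂ (ℂ → ℂ) where
  carrier := {F | RegularAtBoundary F}
  zero_mem' := ⟨differentiableOn_const (0 : ℂ), by simp, 1, one_pos, 0, by simp⟩
  add_mem' := by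
    rintro F G ⟨hF, hF0, ℓ, hℓ, C, hC⟩ ⟨hG, hG0, m, hm, D, hD⟩
    refine ⟨hF.add hG, fun z hz => by simp [hF0 z hz, hG0 z hz], ℓ + m, by positivity, C + D,
      fun z hz1 hz2 => ?_⟩
    have h0 : 0 < |z.im| := abs_pos.mpr hz2.ne
    have h1 : |z.im| ≤ 1 := by rw [abs_of_neg hz2]; linarith
    have hl : |z.im| ^ ℓ ≤ 1 := Real.rpow_le_one h0.le h1 hℓ.le
    have hm' : |z.im| ^ m ≤ 1 := Real.rpow_le_one h0.le h1 hm.le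
    have hl0 : 0 < |z.im| ^ ℓ := Real.rpow_pos_of_pos h0 _
    have hm0 : 0 < |z.im| ^ m := Real.rpow_pos_of_pos h0 _
    rw [Real.rpow_add h0, Pi.add_apply]
    calc ‖F z + G z‖ * (|z.im| ^ ℓ * |z.im| ^ m)
        ≤ (‖F z‖ + ‖G z‖) * (|z.im| ^ ℓ * |z.im| ^ m) := by
          gcongr
          exact norm_add_le _ _
      _ = (‖F z‖ * |z.im| ^ ℓ) * |z.im| ^ m + (‖G z‖ * |z.im| ^ m) * |z.im| ^ ℓ := by ring
      _ ≤ (‖F z‖ * |z.im| ^ ℓ) * 1 + (‖G z‖ * |z.im| ^ m) * 1 := by gcongr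
      _ ≤ C + D := by
          have := hC z hz1 hz2
          have := hD z hz1 hz2
          linarith
  smul_mem' := by
    rintro c F ⟨hF, hF0, ℓ, hℓ, C, hC⟩
    refine ⟨hF.const_smul c, fun z hz => by simp [hF0 z hz], ℓ, hℓ, ‖c‖ * C, fun z h1 h2 => ?_⟩
    rw [Pi.smul_apply, norm_smul, mul_assoc]
    exact mul_le_mul_of_nonneg_left (hC z h1 h2) (norm_nonneg _)

/-- `c = ∫ f(x) F(x - i0) dx`, the boundary value distribution of `F` evaluated at `f`. -/
def HasBoundaryValue (F : ℂ → ℂ) (f : ℝ → ℂ) (c : ℂ) : Prop :=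
  Filter.Tendsto (fun y : ℝ => ∫ x : ℝ, f x * F (x - y * Complex.I)) (𝓝[>] 0) (𝓝 c)

/-- Membership in `𝒦₊`: the boundary value `K(x - i0)` is a distribution of positive type, i.e.
`∫ ds ds' K(s' - i0) conj (g(s + s'/2)) g(s - s'/2) ≥ 0` for all Schwartz functions `g`. -/
def IsPositiveType (K : Kernel) : Prop :=
  ∀ g : 𝓢(ℝ, ℂ), ∃ c : ℝ, 0 ≤ c ∧
    HasBoundaryValue K.1 (fun s' => ∫ s : ℝ, conj (g (s + s' / 2)) * g (s - s' / 2)) c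

namespace LocalNet

variable {s : ℕ} {H : Type*} [NormedAddCommGroup H] [InnerProductSpace ℂ H] [CompleteSpace H]
variable (N : LocalNet s H)

/-! ### The Hamiltonian and its functional calculus -/

/-- Time translations `U(t) = exp (i t H)`. -/
def timeU (t : ℝ) : H →L[ℂ] H := (N.U (Pi.single 0 t) 1 : H →L[ℂ] H)

/-- `μ` is the spectral measure in the vector `ψ` of the Hamiltonian, i.e. of the generator of
time translations: `⟨ψ, U(t) ψ⟩ = ∫ exp (i t λ) dμ(λ)`. -/
def IsEnergyMeasure (ψ : H) (μ : MeasureTheory.Measure ℝ) : Prop :=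
  MeasureTheory.IsFiniteMeasure μ ∧
    ∀ t : ℝ, ⟪ψ, N.timeU t ψ⟫_ℂ = ∫ e : ℝ, Complex.exp (Complex.I * ((t * e : ℝ) : ℂ)) ∂μ

/-- `B` is the function `b(H)` of the Hamiltonian: `⟨ψ, B ψ⟩ = ∫ b dμ_ψ` with `μ_ψ` the spectral
measure of the Hamiltonian in `ψ`. -/
def IsEnergyFunction (b : ℝ → ℂ) (B : H →L[ℂ] H) : Prop :=
  ∀ (ψ : H) (μ : MeasureTheory.Measure ℝ), N.IsEnergyMeasure ψ μ → ⟪ψ, B ψ⟫_ℂ = ∫ e, b e ∂μ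

open Classical in
/-- The bounded operator `b(H)`, for a function `b` that is Borel on `ℝ` and bounded on the
spectrum of the Hamiltonian, which is contained in `[0, ∞)`. -/
def energyFunction (b : ℝ → ℂ) : H →L[ℂ] H :=
  if h : ∃ B, N.IsEnergyFunction b B then h.choose else 0

/-- `R^ℓ = (1 + H)^{-ℓ}`. -/
def R (ℓ : ℝ) : H →L[ℂ] H := N.energyFunction fun e => (((1 + e) ^ (-ℓ) : ℝ) : ℂ)

/-- The spectral projector `P(E)` of the Hamiltonian for the interval `[0, E]`. -/
def P (E : ℝ) : H →L[ℂ] H := N.energyFunction ((Set.Icc 0 E).indicator 1)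

theorem exists_energyMeasure (ψ : H) : ∃ μ, N.IsEnergyMeasure ψ μ := by
  obtain ⟨μ, hfin, -, h⟩ := N.positiveEnergy ψ
  have hm : Measurable fun p : Spacetime s => p 0 := measurable_pi_apply 0
  refine ⟨μ.map fun p => p 0, inferInstance, fun t => ?_⟩
  rw [timeU, h, MeasureTheory.integral_map hm.aemeasurable
    (Measurable.aestronglyMeasurable (by fun_prop))]
  congr 1
  funext p
  congr 3
  rw [Finset.sum_eq_single 0] <;> simp +contextual [mul_comm]

theorem IsEnergyFunction.unique {b : ℝ → ℂ} {B B' : H →L[ℂ] H} (h : N.IsEnergyFunction b B)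
    (h' : N.IsEnergyFunction b B') : B = B' := by
  have : ((B : H →ₗ[ℂ] H)) = (B' : H →ₗ[ℂ] H) := by
    refine (ext_inner_map _ _).mp fun ψ => ?_
    obtain ⟨μ, hμ⟩ := N.exists_energyMeasure ψ
    have h1 := (h ψ μ hμ).trans (h' ψ μ hμ).symm
    rw [← inner_conj_symm, ← inner_conj_symm (B'.toLinearMap ψ)]
    exact congrArg conj h1
  ext x
  exact LinearMap.congr_fun this x

theorem energyFunction_cases (b : ℝ → ℂ) :
    N.IsEnergyFunction b (N.energyFunction b) ∨ N.energyFunction b = 0 := by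
  unfold energyFunction
  split_ifs with h
  · exact Or.inl h.choose_spec
  · exact Or.inr rfl

theorem clm_mul_app (A B : H →L[ℂ] H) (x : H) : (A * B) x = A (B x) := rfl

theorem timeU_mul (t t' : ℝ) : N.timeU t * N.timeU t' = N.timeU (t + t') := by
  have h := N.U_mul (Pi.single 0 t) (Pi.single 0 t') 1 1
  simp only [mul_one, Submonoid.coe_one, Matrix.one_mulVec] at h
  rw [← Pi.single_add] at h
  exact congrArg Subtype.val h

theorem timeU_star_mul (t : ℝ) : star (N.timeU t) * N.timeU t = 1 :=
  Unitary.star_mul_self_of_mem (N.U _ _).2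

theorem timeU_mul_star (t : ℝ) : N.timeU t * star (N.timeU t) = 1 :=
  Unitary.mul_star_self_of_mem (N.U _ _).2

theorem inner_timeU (t : ℝ) (x y : H) : ⟪N.timeU t x, N.timeU t y⟫_ℂ = ⟪x, y⟫_ℂ := by
  rw [← ContinuousLinearMap.adjoint_inner_right, ← ContinuousLinearMap.star_eq_adjoint,
    ← clm_mul_app, timeU_star_mul]
  rfl

theorem isEnergyMeasure_timeU (t : ℝ) {ψ : H} {μ : MeasureTheory.Measure ℝ}
    (h : N.IsEnergyMeasure ψ μ) : N.IsEnergyMeasure (N.timeU t ψ) μ := by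
  refine ⟨h.1, fun t' => ?_⟩
  rw [← h.2, ← clm_mul_app, timeU_mul, add_comm, ← timeU_mul,
    clm_mul_app, inner_timeU]

theorem isEnergyMeasure_of_timeU (t : ℝ) {ψ : H} {μ : MeasureTheory.Measure ℝ}
    (h : N.IsEnergyMeasure (N.timeU t ψ) μ) : N.IsEnergyMeasure ψ μ := by
  refine ⟨h.1, fun t' => ?_⟩
  rw [← h.2, ← clm_mul_app (N.timeU t'), timeU_mul, add_comm, ← timeU_mul,
    clm_mul_app, inner_timeU]

theorem timeU_commute_energyFunction (t : ℝ) (b : ℝ → ℂ) :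
    N.timeU t * N.energyFunction b = N.energyFunction b * N.timeU t := by
  rcases N.energyFunction_cases b with h | h
  · have h2 : N.IsEnergyFunction b (star (N.timeU t) * N.energyFunction b * N.timeU t) := by
      intro ψ μ hμ
      rw [← h _ μ (N.isEnergyMeasure_timeU t hμ)]
      simp [ContinuousLinearMap.star_eq_adjoint, ContinuousLinearMap.adjoint_inner_right]
    have h3 := IsEnergyFunction.unique N h h2
    calc N.timeU t * N.energyFunction b
        = N.timeU t * (star (N.timeU t) * N.energyFunction b * N.timeU t) := by rw [← h3]
      _ = (N.timeU t * star (N.timeU t)) * (N.energyFunction b * N.timeU t) := by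
          simp only [mul_assoc]
      _ = N.energyFunction b * N.timeU t := by rw [timeU_mul_star, one_mul]
  · rw [h, mul_zero, zero_mul]

theorem star_R (ℓ : ℝ) : star (N.R ℓ) = N.R ℓ := by
  rcases N.energyFunction_cases (fun e => (((1 + e) ^ (-ℓ) : ℝ) : ℂ)) with h | h
  · refine (IsEnergyFunction.unique N h fun ψ μ hμ => ?_).symm
    have h1 : ⟪ψ, (N.R ℓ) ψ⟫_ℂ = ∫ e : ℝ, (((1 + e) ^ (-ℓ) : ℝ) : ℂ) ∂μ := h ψ μ hμ
    rw [integral_complex_ofReal] at h1 ⊢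
    rw [ContinuousLinearMap.star_eq_adjoint, ContinuousLinearMap.adjoint_inner_right,
      ← inner_conj_symm]
    rw [h1]
    exact Complex.conj_ofReal _
  · change N.R ℓ = 0 at h
    rw [h, star_zero]

/-! ### Smooth functionals `𝒞^∞(Σ)` -/

/-- `C` is a bound for `‖σ‖_ℓ = ‖σ((1+H)^ℓ · (1+H)^ℓ)‖`.  The bounded operators on which
`σ((1+H)^ℓ · (1+H)^ℓ)` is defined are the `R^ℓ A R^ℓ`, with value `σ(A)`. -/
def EnergyBound (ℓ : ℝ) (σ : StrongDual ℂ (H →L[ℂ] H)) (C : ℝ) : Prop :=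
  0 ≤ C ∧ ∀ A : H →L[ℂ] H, ‖σ A‖ ≤ C * ‖N.R ℓ * A * N.R ℓ‖

/-- `𝒞^∞(Σ)` as a subspace of `Σ`: all `σ` with `‖σ‖_ℓ < ∞` for every `ℓ > 0`. -/
def smoothSubmodule : Submodule ℂ (StrongDual ℂ (H →L[ℂ] H)) where
  carrier := {σ | IsNormalFunctional σ ∧ ∀ ℓ : ℝ, 0 < ℓ → ∃ C, N.EnergyBound ℓ σ C}
  zero_mem' := ⟨(NormalFunctional H).zero_mem, fun ℓ _ => ⟨0, le_rfl, by simp⟩⟩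
  add_mem' := by
    rintro σ τ ⟨hσ, h⟩ ⟨hτ, h'⟩
    refine ⟨(NormalFunctional H).add_mem hσ hτ, fun ℓ hℓ => ?_⟩
    obtain ⟨C, hC0, hC⟩ := h ℓ hℓ
    obtain ⟨D, hD0, hD⟩ := h' ℓ hℓ
    refine ⟨C + D, by positivity, fun A => ?_⟩
    rw [add_mul]
    exact (norm_add_le _ _).trans (add_le_add (hC A) (hD A))
  smul_mem' := by
    rintro c σ ⟨hσ, h⟩
    refine ⟨(NormalFunctional H).smul_mem c hσ, fun ℓ hℓ => ?_⟩
    obtain ⟨C, hC0, hC⟩ := h ℓ hℓ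
    refine ⟨‖c‖ * C, by positivity, fun A => ?_⟩
    rw [smul_apply, norm_smul, mul_assoc]
    exact mul_le_mul_of_nonneg_left (hC A) (norm_nonneg _)

/-- The space `𝒞^∞(Σ)`; a separate type, because its topology is not the norm topology. -/
def Smooth : Type _ := ↥N.smoothSubmodule

instance : AddCommGroup N.Smooth := inferInstanceAs (AddCommGroup ↥N.smoothSubmodule)

instance : Module ℂ N.Smooth := inferInstanceAs (Module ℂ ↥N.smoothSubmodule)

/-- The inclusion `Ξ : 𝒞^∞(Σ) → Σ`. -/
def incl : N.Smooth →ₗ[ℂ] NormalFunctional H where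
  toFun σ := ⟨σ.1, σ.2.1⟩
  map_add' _ _ := rfl
  map_smul' _ _ := rfl

instance : CoeFun N.Smooth fun _ => (H →L[ℂ] H) → ℂ := ⟨fun σ A => σ.1 A⟩

/-- The norm `‖σ‖_ℓ` on `𝒞^∞(Σ)`. -/
def energyNorm (ℓ : ℝ) (σ : N.Smooth) : ℝ := sInf {C | N.EnergyBound ℓ σ.1 C}

theorem energyNorm_le {ℓ : ℝ} {σ : N.Smooth} {C : ℝ} (h : N.EnergyBound ℓ σ.1 C) :
    N.energyNorm ℓ σ ≤ C :=
  csInf_le ⟨0, fun _ hD => hD.1⟩ h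

theorem energyBound_energyNorm {ℓ : ℝ} (hℓ : 0 < ℓ) (σ : N.Smooth) :
    N.EnergyBound ℓ σ.1 (N.energyNorm ℓ σ) := by
  have hne : {C | N.EnergyBound ℓ σ.1 C}.Nonempty := σ.2.2 ℓ hℓ
  refine ⟨le_csInf hne fun _ hC => hC.1, fun A => ?_⟩
  rcases (norm_nonneg (N.R ℓ * A * N.R ℓ)).eq_or_lt with h0 | h0
  · obtain ⟨C, hC⟩ := hne
    have := hC.2 A
    rw [← h0, mul_zero] at this ⊢
    exact this
  · rw [← div_le_iff₀ h0]
    exact le_csInf hne fun C hC => (div_le_iff₀ h0).mpr (hC.2 A)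

/-- The seminorms defining the topology of `𝒞^∞(Σ)`. -/
def energySeminorm (ℓ : {ℓ : ℝ // 0 < ℓ}) : Seminorm ℂ N.Smooth :=
  Seminorm.ofSMulLE (N.energyNorm ℓ.1)
    (le_antisymm (N.energyNorm_le ⟨le_rfl, fun A => by
      change ‖(0 : StrongDual ℂ (H →L[ℂ] H)) A‖ ≤ _
      simp⟩) (N.energyBound_energyNorm ℓ.2 0).1)
    (fun σ τ => by
      obtain ⟨h0, h⟩ := N.energyBound_energyNorm ℓ.2 σ
      obtain ⟨h0', h'⟩ := N.energyBound_energyNorm ℓ.2 τ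
      refine N.energyNorm_le ⟨add_nonneg h0 h0', fun A => ?_⟩
      rw [add_mul]
      exact (norm_add_le (σ.1 A) (τ.1 A)).trans (add_le_add (h A) (h' A)))
    (fun c σ => by
      obtain ⟨h0, h⟩ := N.energyBound_energyNorm ℓ.2 σ
      refine N.energyNorm_le ⟨mul_nonneg (norm_nonneg _) h0, fun A => ?_⟩
      change ‖c • σ.1 A‖ ≤ _
      rw [norm_smul, mul_assoc]
      exact mul_le_mul_of_nonneg_left (h A) (norm_nonneg _))

/-- The family of all norms `‖·‖_ℓ`, `ℓ > 0`. -/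
def seminormFamily : SeminormFamily ℂ N.Smooth {ℓ : ℝ // 0 < ℓ} := fun ℓ => N.energySeminorm ℓ

instance : Nonempty {ℓ : ℝ // 0 < ℓ} := ⟨⟨1, one_pos⟩⟩

/-- The Fréchet topology of `𝒞^∞(Σ)`. -/
instance : TopologicalSpace N.Smooth := N.seminormFamily.moduleFilterBasis.topology

theorem withSeminorms : WithSeminorms N.seminormFamily := ⟨rfl⟩

/-- `𝒞^∞(Σ)*` with its weak-* topology. -/
abbrev SmoothDual : Type _ := WeakDual ℂ N.Smooth

/-- The action `σ ↦ σ(U(t) · U(t)*)` of time translations on `𝒞^∞(Σ)`. -/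
def translate (t : ℝ) (σ : N.Smooth) : N.Smooth :=
  ⟨conjFunctional (N.timeU t) σ.1, conjFunctional_normal _ σ.2.1, fun ℓ hℓ => by
    obtain ⟨C, hC0, hC⟩ := σ.2.2 ℓ hℓ
    refine ⟨C, hC0, fun A => ?_⟩
    rw [conjFunctional_apply]
    refine (hC _).trans_eq ?_
    have h1 : N.R ℓ * N.timeU t = N.timeU t * N.R ℓ := (N.timeU_commute_energyFunction t _).symm
    have h2 : star (N.timeU t) * N.R ℓ = N.R ℓ * star (N.timeU t) := by
      have := congrArg star h1
      simpa [N.star_R] using this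
    have h3 : N.R ℓ * (N.timeU t * A * star (N.timeU t)) * N.R ℓ
        = N.timeU t * (N.R ℓ * A * N.R ℓ) * star (N.timeU t) := by
      calc N.R ℓ * (N.timeU t * A * star (N.timeU t)) * N.R ℓ
          = (N.R ℓ * N.timeU t) * A * (star (N.timeU t) * N.R ℓ) := by simp only [mul_assoc]
        _ = _ := by rw [h1, h2]; simp only [mul_assoc]
    have hU : N.timeU t ∈ unitary (H →L[ℂ] H) := (N.U _ _).2
    rw [h3, CStarRing.norm_mul_mem_unitary _ (Unitary.star_mem hU),
      CStarRing.norm_mem_unitary_mul _ hU]⟩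

/-- Hermitean conjugation `σ*(A) = conj (σ(A*))` on `𝒞^∞(Σ)`. -/
def starSmooth (σ : N.Smooth) : N.Smooth :=
  ⟨starFunctional σ.1, starFunctional_normal σ.2.1, fun ℓ hℓ => by
    obtain ⟨C, hC0, hC⟩ := σ.2.2 ℓ hℓ
    refine ⟨C, hC0, fun A => ?_⟩
    rw [starFunctional_apply, RCLike.norm_conj]
    refine (hC _).trans_eq ?_
    rw [← norm_star (N.R ℓ * A * N.R ℓ)]
    simp [N.star_R, mul_assoc]⟩

theorem energyNorm_starSmooth_le (ℓ : {ℓ : ℝ // 0 < ℓ}) (σ : N.Smooth) :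
    N.energyNorm ℓ.1 (N.starSmooth σ) ≤ N.energyNorm ℓ.1 σ := by
  obtain ⟨h0, h⟩ := N.energyBound_energyNorm ℓ.2 σ
  refine N.energyNorm_le ⟨h0, fun A => ?_⟩
  change ‖starFunctional σ.1 A‖ ≤ _
  rw [starFunctional_apply, RCLike.norm_conj]
  refine (h _).trans_eq ?_
  rw [← norm_star (N.R ℓ.1 * A * N.R ℓ.1)]
  simp [N.star_R, mul_assoc]

/-- Hermitean conjugation as a conjugate-linear map. -/
def starSmoothₗ : N.Smooth →ₛₗ[starRingEnd ℂ] N.Smooth where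
  toFun := N.starSmooth
  map_add' σ τ := Subtype.ext <| ContinuousLinearMap.ext fun A =>
    map_add (starRingEnd ℂ) (σ.1 (star A)) (τ.1 (star A))
  map_smul' c σ := Subtype.ext <| ContinuousLinearMap.ext fun A =>
    map_mul (starRingEnd ℂ) c (σ.1 (star A))

theorem continuous_starSmooth : Continuous N.starSmooth := by
  refine WithSeminorms.continuous_of_isBounded N.withSeminorms N.withSeminorms N.starSmoothₗ ?_
  intro ℓ
  refine ⟨{ℓ}, 1, fun σ => ?_⟩
  have h := N.energyNorm_starSmooth_le ℓ σ
  rw [Finset.sup_singleton, one_smul]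
  exact h

/-- Hermitean conjugation on the dual: `φ*(σ) = conj (φ(σ*))`. -/
def starDual (φ : N.SmoothDual) : N.SmoothDual :=
  StrongDual.toWeakDual
    { toFun := fun σ => conj (φ (N.starSmooth σ))
      map_add' := fun σ τ => by
        change conj (φ (N.starSmoothₗ (σ + τ))) = _
        rw [map_add, map_add, map_add]
        rfl
      map_smul' := fun c σ => by
        change conj (φ (N.starSmoothₗ (c • σ))) = _
        rw [map_smulₛₗ, map_smul, smul_eq_mul, map_mul, Complex.conj_conj]
        rfl
      cont := Complex.continuous_conj.comp ((map_continuous φ).comp N.continuous_starSmooth) }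

/-- `Σ(E) = {σ(P(E) · P(E)) | σ ∈ Σ}`. -/
def IsEnergyBounded (E : ℝ) (σ : StrongDual ℂ (H →L[ℂ] H)) : Prop :=
  ∃ τ : StrongDual ℂ (H →L[ℂ] H), IsNormalFunctional τ ∧
    ∀ A : H →L[ℂ] H, σ A = τ (N.P E * A * N.P E)

/-! ### The phase space condition and pointlike fields -/

/-- `r^{-γ} ‖(Ξ - ψ) ⌈ 𝔄(r)‖_ℓ → 0` as `r → 0` for all sufficiently large `ℓ`, where the norm is
that of maps from `𝒞^∞(Σ)` with `‖·‖_ℓ` to functionals on `𝔄(r) = 𝔄(𝒪_r)`; and `ψ` has finite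
rank. -/
def Approximates (γ : ℝ) (ψ : N.Smooth →L[ℂ] NormalFunctional H) : Prop :=
  Module.Finite ℂ (LinearMap.range (ψ : N.Smooth →ₗ[ℂ] NormalFunctional H)) ∧
  ∃ ℓ₀ : ℝ, 0 < ℓ₀ ∧ ∀ ℓ : ℝ, ℓ₀ ≤ ℓ → ∃ ε : ℝ → ℝ,
    Filter.Tendsto (fun r => r ^ (-γ) * ε r) (𝓝[>] 0) (𝓝 0) ∧
    ∀ r : ℝ, 0 < r → ∀ (σ : N.Smooth), ∀ A ∈ N.alg (doubleCone s r),
      ‖(N.incl σ - ψ σ).1 A‖ ≤ ε r * N.energyNorm ℓ σ * ‖A‖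

/-- The microscopic phase space condition. -/
def MicroscopicPhaseSpaceCondition : Prop :=
  ∀ γ : ℝ, 0 ≤ γ → ∃ ψ : N.Smooth →L[ℂ] NormalFunctional H, N.Approximates γ ψ

/-- The space `Φ_γ ⊆ 𝒞^∞(Σ)*`: the image of the dual map `ψ* : 𝔅(ℋ) = Σ* → 𝒞^∞(Σ)*` for an
approximating map `ψ` of minimal rank (the image does not depend on which). -/
def FieldsOfOrder (γ : ℝ) : Set N.SmoothDual :=
  {φ | ∃ ψ : N.Smooth →L[ℂ] NormalFunctional H, N.Approximates γ ψ ∧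
    (∀ ψ' : N.Smooth →L[ℂ] NormalFunctional H, N.Approximates γ ψ' →
      Module.finrank ℂ (LinearMap.range (ψ : N.Smooth →ₗ[ℂ] NormalFunctional H)) ≤
        Module.finrank ℂ (LinearMap.range (ψ' : N.Smooth →ₗ[ℂ] NormalFunctional H))) ∧
    ∃ A : H →L[ℂ] H, ∀ σ : N.Smooth, φ σ = (ψ σ).1 A}

/-- The field content `Φ_FH = ⋃_γ Φ_γ`. -/
def Fields : Set N.SmoothDual := ⋃ γ ∈ Set.Ici (0 : ℝ), N.FieldsOfOrder γ

/-- The smeared field `φ(f) = ∫ dt f(t) U(t) φ U(t)*`, a weak integral, evaluated in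
functionals `σ ∈ 𝒞^∞(Σ)`. -/
def smear (φ : N.SmoothDual) (f : Test) (σ : N.Smooth) : ℂ := ∫ t : ℝ, f t * φ (N.translate t σ)

/-- The vacuum is separating for the smeared fields: `φ(f) Ω = 0` implies `φ(f) = 0`.  Here
`φ(f) Ω = 0` means that the matrix elements `⟨χ, φ(f) Ω⟩` vanish for all `χ` for which
`⟨χ, · Ω⟩` is in `𝒞^∞(Σ)`, that is, for all `χ ∈ 𝒞^∞(ℋ) = ⋂_ℓ R^ℓ ℋ`. -/
def VacuumSeparating : Prop :=
  ∀ φ ∈ N.Fields, ∀ f : Test,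
    (∀ (χ : H) (σ : N.Smooth), (∀ A : H →L[ℂ] H, σ A = ⟪χ, A N.Ω⟫_ℂ) → N.smear φ f σ = 0) →
      ∀ σ : N.Smooth, N.smear φ f σ = 0

/-! ### Products and their distributions -/

/-- The space `𝒦 ⊗ 𝒞^∞(Σ)* ⊗ 𝒞^∞(Σ)*` (algebraic tensor products). -/
abbrev Products : Type _ := Kernel ⊗[ℂ] (N.SmoothDual ⊗[ℂ] N.SmoothDual)

/-- The set of classically positive products `∑ⱼ Kⱼ ⊗ φⱼ* ⊗ φⱼ` with `Kⱼ ∈ 𝒦₊`,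
`φⱼ ∈ Φ_FH`. -/
def PositiveProducts : Set N.Products :=
  {Q | ∃ (n : ℕ) (K : Fin n → Kernel) (φ : Fin n → N.SmoothDual),
    (∀ j, IsPositiveType (K j)) ∧ (∀ j, φ j ∈ N.Fields) ∧
    Q = ∑ j, K j ⊗ₜ[ℂ] (N.starDual (φ j) ⊗ₜ[ℂ] φ j)}

/-- `B` is the bounded operator `e^{-εH} φ e^{-εH}`, determined by its matrix elements
`⟨χ, B ξ⟩ = φ(⟨e^{-εH} χ, · e^{-εH} ξ⟩)`. -/
def IsDamped (ε : ℝ) (φ : N.SmoothDual) (B : H →L[ℂ] H) : Prop :=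
  ∀ (χ ξ : H) (σ : N.Smooth),
    (∀ A : H →L[ℂ] H, σ A =
      ⟪N.energyFunction (fun e => Complex.exp (-((ε * e : ℝ) : ℂ))) χ,
        A (N.energyFunction (fun e => Complex.exp (-((ε * e : ℝ) : ℂ))) ξ)⟫_ℂ) →
    ⟪χ, B ξ⟫_ℂ = φ σ

open Classical in
/-- The bounded operator `e^{-εH} φ e^{-εH}`, for `φ ∈ 𝒞^∞(Σ)*` and `ε > 0`. -/
def damped (ε : ℝ) (φ : N.SmoothDual) : H →L[ℂ] H :=
  if h : ∃ B, N.IsDamped ε φ B then h.choose else 0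

/-- For `σ ∈ Σ(E)` and `Im z < 0`, the function
`σ(φ(z/2) φ'(-z/2)) = σ(e^{izH/2} φ e^{-izH} φ' e^{izH/2})`.  In order to write it with bounded
operators only, `P(E)` is inserted on both sides (this does not change `σ`) and factors
`e^{εH} e^{-εH}`, with `ε = -Im z / 4`, are inserted on both sides of each of `φ`, `φ'`. -/
def twoPoint (E : ℝ) (σ : StrongDual ℂ (H →L[ℂ] H)) (φ φ' : N.SmoothDual) (z : ℂ) : ℂ :=
  let ε : ℝ := -z.im / 4
  let W := N.energyFunction
    ((Set.Icc 0 E).indicator fun e => Complex.exp ((Complex.I * z / 2 + ε) * e))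
  let M := N.energyFunction fun e => Complex.exp ((-(Complex.I * z) + 2 * ε) * e)
  σ (W * N.damped ε φ * M * N.damped ε φ' * W)

/-- `C` is a bound for the norm `‖Φ‖_{-ℓ}` dual to `‖·‖_ℓ`. -/
def DualBound (ℓ : ℝ) (Φ : N.Smooth → ℂ) (C : ℝ) : Prop :=
  ∀ σ : N.Smooth, ‖Φ σ‖ ≤ C * N.energyNorm ℓ σ

/-- `T` is a `𝒞^∞(Σ)*`-valued distribution. -/
def IsDualValuedDistribution (T : Test →ₗ[ℂ] N.SmoothDual) : Prop :=
  ∃ ℓ : ℝ, 0 < ℓ ∧ ∃ m : ℕ, ∀ d : ℝ, 0 < d → ∃ c : ℝ,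
    ∀ f : Test, SupportedIn d f → N.DualBound ℓ (T f) (c * sobNorm d m f)

/-- `T` is the `𝒞^∞(Σ)*`-valued distribution associated with the product `Q = ∑ⱼ Kⱼ ⊗ φⱼ ⊗ φⱼ'`:
for every energy-bounded `σ`,
`σ(T(f)) = ∑ⱼ ∫ ds' f(s') Kⱼ(s' - i0) σ(φⱼ(s'/2 - i0) φⱼ'(-s'/2 + i0))`. -/
def IsProductDistribution (Q : N.Products) (T : Test →ₗ[ℂ] N.SmoothDual) : Prop :=
  N.IsDualValuedDistribution T ∧
  ∀ (n : ℕ) (K : Fin n → Kernel) (φ φ' : Fin n → N.SmoothDual),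
    Q = ∑ j, K j ⊗ₜ[ℂ] (φ j ⊗ₜ[ℂ] φ' j) →
    ∀ (E : ℝ) (σ : N.Smooth), 0 < E → N.IsEnergyBounded E σ.1 → ∀ f : Test,
      HasBoundaryValue (fun z => ∑ j, (K j).1 z * N.twoPoint E σ.1 (φ j) (φ' j) z) f (T f σ)

/-- `∫ ds U(s) (T ∗ (g₁, g₂))(s) U(s)*` with `(T ∗ (g₁, g₂))(s) = ∫ ds' (g₁ ⋄ g₂)(s, s') T(s')`:
a weak integral, evaluated in functionals `σ ∈ 𝒞^∞(Σ)`. -/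
def convolutionIntegral (T : Test → N.SmoothDual) (g₁ g₂ : Test) (σ : N.Smooth) : ℂ :=
  ∫ t : ℝ, T (diamond g₁ g₂ t) (N.translate t σ)

/-- A continuous hermitean projector in `𝒞^∞(Σ)*` with finite-dimensional image in `Φ_FH`. -/
structure IsFieldProjector (p : N.SmoothDual →L[ℂ] N.SmoothDual) : Prop where
  idempotent : ∀ φ, p (p φ) = p φ
  hermitean : ∀ φ, p (N.starDual φ) = N.starDual (p φ)
  finite : Module.Finite ℂ (LinearMap.range (p : N.SmoothDual →ₗ[ℂ] N.SmoothDual))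
  range_subset : ∀ φ, p φ ∈ N.Fields

/-- `p` is `α`-approximating for the product `Q`: with `T` the distribution of `Q`, the bilinear
map `(g₁, g₂) ↦ convolutionIntegral (T - p T) g₁ g₂` on `𝒟(-d, d)`, measured in `‖·‖_{-ℓ}`
relative to `‖g₁‖_{d,m} ‖g₂‖_{d,m}`, has norm `o(d^α)` as `d → 0`. -/
def IsApproximating (α : ℝ) (Q : N.Products) (p : N.SmoothDual →L[ℂ] N.SmoothDual) : Prop :=
  N.IsFieldProjector p ∧
  ∃ T : Test →ₗ[ℂ] N.SmoothDual, N.IsProductDistribution Q T ∧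
  ∃ ℓ : ℝ, 0 < ℓ ∧ ∃ m : ℕ, ∃ ε : ℝ → ℝ,
    ε =o[𝓝[>] 0] (fun d : ℝ => d ^ α) ∧
    ∀ d : ℝ, 0 < d → ∀ g₁ g₂ : Test, SupportedIn d g₁ → SupportedIn d g₂ →
      N.DualBound ℓ (N.convolutionIntegral (fun f => T f - p (T f)) g₁ g₂)
        (ε d * sobNorm d m g₁ * sobNorm d m g₂)

end LocalNet

end

end PointlikeQFT

/-! Suppose the zero projector were approximating. Then the distribution of the product itself is
small on test functions of small support. Evaluate it in the vacuum functional `vacuum`. This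
functional is invariant under time translations, so they drop out of the convolution integral, and
the distribution becomes the boundary value of one analytic function on the lower half plane, h(z) =
∑ⱼ Kⱼ(z) ⟨φⱼΩ, e^{-izH} φⱼΩ⟩.

The kernel (a, b) ↦ h(ā - b) is positive definite on a strip above the real axis. For Kⱼ this
follows from positive type, by testing with sums of Gaussians with complex centres and letting their
width shrink (`IsPositiveType.posSemidef`). The two-point function is the Gram matrix of the vectors
e^{iaH}φⱼΩ (`vacuumTwoPoint_eq_inner`). The Schur product theorem combines the two. Hence h(ā - b) =
⟨v_a, v_b⟩ in some Hilbert space.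

Smallness of the distribution now says that the boundary vectors w_g = ∫ g(t) v_{t+i0} dt
(understood as a limit from inside the strip) have ‖w_g‖² → 0 when g is a bump of integral one and
width d → 0; the norms ‖g‖_{d,m} do not change under this scaling. On the other hand ⟨v_{iη}, w_g⟩ →
h(-iη), so Cauchy-Schwarz forces h(-iη) = 0 (`PolynomialGrowth.eq_zero_of_boundaryValue`).

On the imaginary axis each summand of h is a diagonal entry of a positive definite kernel, so
Kⱼ(-iη) ‖e^{-ηH/2}φⱼΩ‖² = 0 for each j. If Kⱼ ≠ 0, the identity theorem yields arbitrarily small η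
with Kⱼ(-iη) ≠ 0, whence e^{-δH}φⱼΩ = 0 for all δ > 0, and φⱼ = 0 because the vacuum is separating.
Every summand of the product vanishes, a contradiction.

Two technical supports take up most of the length. The functional calculus of H is built from the
measures given by positivity of energy (`spectralSum_eq_of_wave`). The exchange of the boundary
limit with the integral over t rests on a bound uniform near the boundary
(`PolynomialGrowth.exists_norm_integral_le`). -/

namespace PointlikeQFT

noncomputable section

open MeasureTheory

/-! ### Uniqueness of Fourier transforms -/

/-- The positive and negative parts of `G` are densities of two finite measures. The hypothesis says
that their characteristic functions agree, so the measures agree, and so do their densities almost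
everywhere. -/
theorem ae_eq_zero_of_integral_exp_mul_ofReal_eq_zero {ν : Measure ℝ}
    {G : ℝ → ℝ} (hG : Integrable G ν)
    (h : ∀ t : ℝ, ∫ e, Complex.exp (Complex.I * ((t * e : ℝ) : ℂ)) * (G e : ℂ) ∂ν = 0) :
    G =ᵐ[ν] 0 := by
  have hfin : ∀ F : ℝ → ℝ, Integrable F ν →
      IsFiniteMeasure (ν.withDensity fun e => ENNReal.ofReal (F e)) := fun F hF =>
    isFiniteMeasure_withDensity_ofReal hF.2
  have hint : ∀ F : ℝ → ℝ, Integrable F ν → ∀ t : ℝ,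
      charFun (ν.withDensity fun e => ENNReal.ofReal (F e)) t
        = ∫ e, ((max (F e) 0 : ℝ) : ℂ) * Complex.exp (Complex.I * ((t * e : ℝ) : ℂ)) ∂ν := by
    intro F hF t
    rw [charFun_apply_real,
      integral_withDensity_eq_integral_toReal_smul₀ hF.aemeasurable.ennreal_ofReal
        (Filter.Eventually.of_forall fun _ => ENNReal.ofReal_lt_top)]
    refine integral_congr_ae (Filter.Eventually.of_forall fun e => ?_)
    simp only [ENNReal.toReal_ofReal', Complex.real_smul]
    congr 2
    push_cast
    ring
  have := hfin G hG
  have := hfin (-G) hG.neg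
  have hexp : ∀ (F : ℝ → ℝ), Integrable F ν → ∀ t : ℝ, Integrable (fun e =>
      ((max (F e) 0 : ℝ) : ℂ) * Complex.exp (Complex.I * ((t * e : ℝ) : ℂ))) ν := by
    intro F hF t
    refine (hF.pos_part.ofReal (𝕜 := ℂ)).mul_bdd (c := 1)
      (Measurable.aestronglyMeasurable (by fun_prop)) (Filter.Eventually.of_forall fun e => ?_)
    rw [mul_comm, Complex.norm_exp_ofReal_mul_I]
  have heq : (ν.withDensity fun e => ENNReal.ofReal (G e))
      = ν.withDensity fun e => ENNReal.ofReal ((-G) e) := by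
    refine Measure.ext_of_charFun (funext fun t => ?_)
    rw [hint G hG, hint (-G) hG.neg, ← sub_eq_zero,
      ← integral_sub (hexp G hG t) (hexp (-G) hG.neg t), ← h t]
    refine integral_congr_ae (Filter.Eventually.of_forall fun e => ?_)
    simp only [Pi.neg_apply]
    rw [← sub_mul, mul_comm, ← Complex.ofReal_sub, max_zero_sub_max_neg_zero_eq_self]
  have hae := (withDensity_eq_iff hG.aemeasurable.ennreal_ofReal
    hG.neg.aemeasurable.ennreal_ofReal hG.lintegral_lt_top.ne).mp heq
  filter_upwards [hae] with e he
  simp only [Pi.neg_apply, Pi.zero_apply] at he ⊢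
  rcases le_total (G e) 0 with h0 | h0
  · rw [ENNReal.ofReal_of_nonpos h0] at he
    have := ENNReal.ofReal_eq_zero.mp he.symm
    linarith
  · rw [ENNReal.ofReal_of_nonpos (neg_nonpos.mpr h0)] at he
    have := ENNReal.ofReal_eq_zero.mp he
    linarith

/-- Conjugating the hypothesis at `-t` shows that `conj F` also has vanishing transform. Real and
imaginary parts therefore reduce to the real case. -/
theorem ae_eq_zero_of_integral_exp_mul_eq_zero {ν : Measure ℝ}
    {F : ℝ → ℂ} (hF : Integrable F ν)
    (h : ∀ t : ℝ, ∫ e, Complex.exp (Complex.I * ((t * e : ℝ) : ℂ)) * F e ∂ν = 0) :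
    F =ᵐ[ν] 0 := by
  have hint : ∀ (G : ℝ → ℂ), Integrable G ν → ∀ t : ℝ,
      Integrable (fun e => Complex.exp (Complex.I * ((t * e : ℝ) : ℂ)) * G e) ν := by
    intro G hG t
    refine hG.bdd_mul (c := 1)
      (Measurable.aestronglyMeasurable (by fun_prop)) (Filter.Eventually.of_forall fun e => ?_)
    rw [mul_comm, Complex.norm_exp_ofReal_mul_I]
  have hconj : Integrable (fun e => conj (F e)) ν :=
    (Complex.conjLIE.toContinuousLinearEquiv.toContinuousLinearMap).integrable_comp hF
  have h' : ∀ t : ℝ, ∫ e, Complex.exp (Complex.I * ((t * e : ℝ) : ℂ)) * conj (F e) ∂ν = 0 := by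
    intro t
    have := congrArg conj (h (-t))
    rw [← integral_conj, map_zero] at this
    rw [← this]
    refine integral_congr_ae (Filter.Eventually.of_forall fun e => ?_)
    simp only [map_mul, ← Complex.exp_conj, Complex.conj_I, Complex.conj_ofReal]
    congr 2
    push_cast
    ring
  have hre := ae_eq_zero_of_integral_exp_mul_ofReal_eq_zero hF.re (fun t => by
    have := integral_add (hint F hF t) (hint _ hconj t)
    rw [h, h', add_zero] at this
    have h2 : (2 : ℂ) * ∫ e, Complex.exp (Complex.I * ((t * e : ℝ) : ℂ)) *
        ((RCLike.re (F e) : ℝ) : ℂ) ∂ν = 0 := by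
      rw [← this, ← integral_const_mul]
      refine integral_congr_ae (Filter.Eventually.of_forall fun e => ?_)
      simp only [← mul_add, Complex.add_conj, RCLike.re_to_complex]
      push_cast
      ring
    simpa using h2)
  have him := ae_eq_zero_of_integral_exp_mul_ofReal_eq_zero hF.im (fun t => by
    have := integral_sub (hint F hF t) (hint _ hconj t)
    rw [h, h', sub_zero] at this
    have h2 : (2 * Complex.I : ℂ) * ∫ e, Complex.exp (Complex.I * ((t * e : ℝ) : ℂ)) *
        ((RCLike.im (F e) : ℝ) : ℂ) ∂ν = 0 := by
      rw [← this, ← integral_const_mul]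
      refine integral_congr_ae (Filter.Eventually.of_forall fun e => ?_)
      simp only [← mul_sub, Complex.sub_conj, RCLike.im_to_complex]
      push_cast
      ring
    simpa using h2)
  filter_upwards [hre, him] with e h1 h2
  exact Complex.ext h1 h2

namespace LocalNet

variable {s : ℕ} {H : Type*} [NormedAddCommGroup H] [InnerProductSpace ℂ H] [CompleteSpace H]
variable (N : LocalNet s H)

/-! ### Spectral measures of the Hamiltonian -/

/-- The character `e ↦ exp (i t e)`. -/
def wave (t : ℝ) (e : ℝ) : ℂ := Complex.exp (Complex.I * ((t * e : ℝ) : ℂ))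

theorem measurable_wave (t : ℝ) : Measurable (wave t) := by
  unfold wave
  fun_prop

theorem norm_wave (t e : ℝ) : ‖wave t e‖ = 1 := by
  rw [wave, mul_comm, Complex.norm_exp_ofReal_mul_I]

theorem wave_mul (t t' e : ℝ) : wave t e * wave t' e = wave (t + t') e := by
  rw [wave, wave, wave, ← Complex.exp_add]
  congr 1
  push_cast
  ring

/-- The spectral measure of the Hamiltonian in the vector `ψ`. -/
def energyMeasure (ψ : H) : Measure ℝ := (N.exists_energyMeasure ψ).choose

theorem isEnergyMeasure_energyMeasure (ψ : H) : N.IsEnergyMeasure ψ (N.energyMeasure ψ) :=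
  (N.exists_energyMeasure ψ).choose_spec

instance (ψ : H) : IsFiniteMeasure (N.energyMeasure ψ) := (N.isEnergyMeasure_energyMeasure ψ).1

variable {N} in
theorem IsEnergyMeasure.eq {ψ : H} {μ ν : Measure ℝ} (hμ : N.IsEnergyMeasure ψ μ)
    (hν : N.IsEnergyMeasure ψ ν) : μ = ν := by
  have := hμ.1
  have := hν.1
  refine Measure.ext_of_charFun (funext fun t => ?_)
  have h := (hμ.2 t).symm.trans (hν.2 t)
  rw [charFun_apply_real, charFun_apply_real]
  convert h using 4 <;> · push_cast; ring

/-- The energy measure is the marginal of the joint spectral measure in the time component, which is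
nonnegative on the forward cone. -/
theorem energyMeasure_ae_nonneg (ψ : H) : ∀ᵐ e ∂N.energyMeasure ψ, 0 ≤ e := by
  obtain ⟨μ, hfin, hμ, h⟩ := N.positiveEnergy ψ
  have hm : Measurable fun p : Spacetime s => p 0 := measurable_pi_apply 0
  have h1 : N.IsEnergyMeasure ψ (μ.map fun p => p 0) := by
    refine ⟨inferInstance, fun t => ?_⟩
    rw [timeU, h, integral_map hm.aemeasurable (Measurable.aestronglyMeasurable (by fun_prop))]
    congr 1
    funext p
    congr 3
    rw [Finset.sum_eq_single 0] <;> simp +contextual [mul_comm]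
  rw [(N.isEnergyMeasure_energyMeasure ψ).eq h1,
    ae_map_iff hm.aemeasurable (p := fun e : ℝ => 0 ≤ e)
      (measurableSet_le measurable_const measurable_id)]
  have h2 : ∀ᵐ p ∂μ, p ∈ forwardCone s := by
    rw [ae_iff]
    exact hμ
  filter_upwards [h2] with p hp using hp.1

theorem inner_timeU_eq_integral (ψ : H) (t : ℝ) :
    ⟪ψ, N.timeU t ψ⟫_ℂ = ∫ e, wave t e ∂N.energyMeasure ψ :=
  (N.isEnergyMeasure_energyMeasure ψ).2 t

theorem timeU_zero : N.timeU 0 = 1 := by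
  have h := N.timeU_mul 0 0
  rw [add_zero] at h
  calc N.timeU 0 = star (N.timeU 0) * (N.timeU 0 * N.timeU 0) := by
        rw [← mul_assoc, timeU_star_mul, one_mul]
    _ = 1 := by rw [h, timeU_star_mul]

theorem energyMeasure_univ (ψ : H) : (N.energyMeasure ψ).real Set.univ = ‖ψ‖ ^ 2 := by
  have h := N.inner_timeU_eq_integral ψ 0
  rw [timeU_zero] at h
  simp only [wave, zero_mul, Complex.ofReal_zero, mul_zero, Complex.exp_zero, integral_const,
    one_apply_eq_self, inner_self_eq_norm_sq_to_K] at h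
  rw [Complex.real_smul, mul_one] at h
  exact Complex.ofReal_injective (by rw [← h]; push_cast; rfl)

/-- `b` is measurable, and bounded on `[0, ∞)`. -/
def BoundedOnSpectrum (b : ℝ → ℂ) : Prop := Measurable b ∧ ∃ C : ℝ, ∀ e, 0 ≤ e → ‖b e‖ ≤ C

theorem BoundedOnSpectrum.integrable {b : ℝ → ℂ} (hb : BoundedOnSpectrum b) (ψ : H) :
    Integrable b (N.energyMeasure ψ) := by
  obtain ⟨hm, C, hC⟩ := hb
  refine Integrable.of_bound hm.aestronglyMeasurable C ?_
  filter_upwards [N.energyMeasure_ae_nonneg ψ] with e he using hC e he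

theorem BoundedOnSpectrum.mul {b c : ℝ → ℂ} (hb : BoundedOnSpectrum b)
    (hc : BoundedOnSpectrum c) : BoundedOnSpectrum fun e => b e * c e := by
  obtain ⟨hm, C, hC⟩ := hb
  obtain ⟨hm', C', hC'⟩ := hc
  refine ⟨hm.mul hm', C * C', fun e he => ?_⟩
  rw [norm_mul]
  exact mul_le_mul (hC e he) (hC' e he) (norm_nonneg _) ((norm_nonneg _).trans (hC e he))

theorem BoundedOnSpectrum.sub {b c : ℝ → ℂ} (hb : BoundedOnSpectrum b)
    (hc : BoundedOnSpectrum c) : BoundedOnSpectrum fun e => b e - c e := by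
  obtain ⟨hm, C, hC⟩ := hb
  obtain ⟨hm', C', hC'⟩ := hc
  exact ⟨hm.sub hm', C + C', fun e he =>
    (norm_sub_le _ _).trans (add_le_add (hC e he) (hC' e he))⟩

theorem BoundedOnSpectrum.conj {b : ℝ → ℂ} (hb : BoundedOnSpectrum b) :
    BoundedOnSpectrum fun e => conj (b e) := by
  obtain ⟨hm, C, hC⟩ := hb
  exact ⟨Complex.continuous_conj.measurable.comp hm, C, fun e he => by
    rw [RCLike.norm_conj]
    exact hC e he⟩

theorem boundedOnSpectrum_const (c : ℂ) : BoundedOnSpectrum fun _ => c :=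
  ⟨measurable_const, ‖c‖, fun _ _ => le_rfl⟩

theorem boundedOnSpectrum_wave (t : ℝ) : BoundedOnSpectrum (wave t) :=
  ⟨measurable_wave t, 1, fun e _ => (norm_wave t e).le⟩

theorem norm_integral_energyMeasure_le {b : ℝ → ℂ} {C : ℝ} (hC : ∀ e, 0 ≤ e → ‖b e‖ ≤ C)
    (ψ : H) : ‖∫ e, b e ∂N.energyMeasure ψ‖ ≤ C * ‖ψ‖ ^ 2 := by
  rw [← N.energyMeasure_univ]
  refine norm_integral_le_of_norm_le_const ?_
  filter_upwards [N.energyMeasure_ae_nonneg ψ] with e he using hC e he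

/-! ### Linear combinations of spectral integrals -/

/-- `∑ cᵢ ∫ b dμ_{ψᵢ}`. -/
def spectralSum (b : ℝ → ℂ) : (H →₀ ℂ) →ₗ[ℂ] ℂ :=
  Finsupp.linearCombination ℂ fun ψ => ∫ e, b e ∂N.energyMeasure ψ

theorem spectralSum_apply (b : ℝ → ℂ) (v : H →₀ ℂ) :
    N.spectralSum b v = ∑ ψ ∈ v.support, v ψ * ∫ e, b e ∂N.energyMeasure ψ := by
  simp [spectralSum, Finsupp.linearCombination_apply, Finsupp.sum]

/-- This takes the place of the spectral theorem: a linear relation among spectral integrals that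
holds for all characters holds for all bounded Borel functions. All the measures involved have
densities with respect to their sum `ν`, so the relation says that one integrable function `F` has
vanishing Fourier transform, hence is zero `ν`-almost everywhere. -/
theorem spectralSum_eq_of_wave {c : ℝ → ℂ} (hc : BoundedOnSpectrum c) {v v' : H →₀ ℂ}
    (h : ∀ t, N.spectralSum (wave t) v' = N.spectralSum (fun e => wave t e * c e) v)
    {b : ℝ → ℂ} (hb : BoundedOnSpectrum b) :
    N.spectralSum b v' = N.spectralSum (fun e => b e * c e) v := by
  classical
  set S := v.support ∪ v'.support with hS
  set ν : Measure ℝ := ∑ ψ ∈ S, N.energyMeasure ψ with hν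
  have hac : ∀ ψ ∈ S, N.energyMeasure ψ ≪ ν := fun ψ hψ =>
    Measure.absolutelyContinuous_of_le (Finset.single_le_sum
      (f := fun ψ => N.energyMeasure ψ) (fun _ _ => Measure.zero_le _) hψ)
  let ρ : H → ℝ → ℝ := fun ψ e => ((N.energyMeasure ψ).rnDeriv ν e).toReal
  let F : ℝ → ℂ := fun e => ∑ ψ ∈ S, ρ ψ e • (v' ψ - v ψ * c e)
  have hterm : ∀ {a : ℝ → ℂ}, BoundedOnSpectrum a → ∀ ψ ∈ S,
      Integrable (fun e => ρ ψ e • (a e * (v' ψ - v ψ * c e))) ν := by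
    intro a ha ψ hψ
    refine (integrable_rnDeriv_smul_iff (hac ψ hψ)).mpr ?_
    exact (ha.mul ((boundedOnSpectrum_const _).sub
      ((boundedOnSpectrum_const _).mul hc))).integrable N ψ
  have hF : ∀ {a : ℝ → ℂ}, BoundedOnSpectrum a →
      ∫ e, a e * F e ∂ν = N.spectralSum a v' - N.spectralSum (fun e => a e * c e) v := by
    intro a ha
    have h1 : (fun e => a e * F e)
        = fun e => ∑ ψ ∈ S, ρ ψ e • (a e * (v' ψ - v ψ * c e)) := by
      funext e
      simp only [F, Finset.mul_sum, mul_smul_comm]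
    rw [h1, integral_finsetSum _ (hterm ha), spectralSum_apply, spectralSum_apply,
      Finset.sum_subset (Finset.subset_union_right : v'.support ⊆ S) (by simp +contextual),
      Finset.sum_subset (Finset.subset_union_left : v.support ⊆ S) (by simp +contextual),
      ← Finset.sum_sub_distrib]
    refine Finset.sum_congr rfl fun ψ hψ => ?_
    rw [integral_rnDeriv_smul (hac ψ hψ), ← integral_const_mul, ← integral_const_mul,
      ← integral_sub ((ha.integrable N ψ).const_mul _) (((ha.mul hc).integrable N ψ).const_mul _)]
    congr 1
    funext e
    ring
  have hFint : Integrable F ν := by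
    have := integrable_finsetSum S (hterm (boundedOnSpectrum_const 1))
    simpa only [one_mul] using this
  have hzero := ae_eq_zero_of_integral_exp_mul_eq_zero hFint fun t => by
    have := hF (boundedOnSpectrum_wave t)
    rw [h t, sub_self] at this
    exact this
  have h2 := hF hb
  rw [integral_eq_zero_of_ae (by filter_upwards [hzero] with e he; simp [he])] at h2
  exact (sub_eq_zero.mp h2.symm)

theorem spectralSum_eq_zero_of_wave {v : H →₀ ℂ} (h : ∀ t, N.spectralSum (wave t) v = 0)
    {b : ℝ → ℂ} (hb : BoundedOnSpectrum b) : N.spectralSum b v = 0 := by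
  have := N.spectralSum_eq_of_wave (boundedOnSpectrum_const 0) (v := 0) (v' := v)
    (fun t => by rw [h t, map_zero]) hb
  rw [this, map_zero]

/-- The combination of diagonal terms `⟨ψ, · ψ⟩` that gives the off-diagonal term `⟨x, · y⟩`. -/
def polarization (x y : H) : H →₀ ℂ :=
  (4⁻¹ : ℂ) • (Finsupp.single (x + y) 1 - Finsupp.single (x - y) 1
    - Complex.I • Finsupp.single (x + Complex.I • y) 1
    + Complex.I • Finsupp.single (x - Complex.I • y) 1)

theorem spectralSum_polarization (b : ℝ → ℂ) (x y : H) :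
    N.spectralSum b (polarization x y) = 4⁻¹ * ((∫ e, b e ∂N.energyMeasure (x + y))
      - (∫ e, b e ∂N.energyMeasure (x - y))
      - Complex.I * (∫ e, b e ∂N.energyMeasure (x + Complex.I • y))
      + Complex.I * (∫ e, b e ∂N.energyMeasure (x - Complex.I • y))) := by
  simp only [polarization, spectralSum, map_smul, map_add, map_sub,
    Finsupp.linearCombination_single, smul_eq_mul, one_mul]

/-- Polarization identity: the diagonal matrix elements of `B` determine all others. -/
theorem spectralSum_polarization_eq_inner {b : ℝ → ℂ} {B : H →L[ℂ] H}
    (h : ∀ ψ, ⟪ψ, B ψ⟫_ℂ = ∫ e, b e ∂N.energyMeasure ψ) (x y : H) :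
    N.spectralSum b (polarization x y) = ⟪x, B y⟫_ℂ := by
  rw [spectralSum_polarization, ← h, ← h, ← h, ← h]
  simp only [map_add, map_sub, map_smul, inner_add_left, inner_add_right, inner_sub_left,
    inner_sub_right, inner_smul_left, inner_smul_right, Complex.conj_I]
  linear_combination (-(4⁻¹ : ℂ) * (2 * ⟪x, B y⟫_ℂ - 2 * ⟪y, B x⟫_ℂ)) * Complex.I_sq

theorem spectralSum_wave_polarization (t : ℝ) (x y : H) :
    N.spectralSum (wave t) (polarization x y) = ⟪x, N.timeU t y⟫_ℂ :=
  N.spectralSum_polarization_eq_inner (fun ψ => N.inner_timeU_eq_integral ψ t) x y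

/-! ### The functional calculus -/

/-- The parallelogram laws for (x, y) and (x, iy) make the four squared norms add up to 4(‖x‖² +
‖y‖²), which absorbs the factor 1/4 of the polarization. -/
theorem norm_spectralSum_polarization_le {b : ℝ → ℂ} {C : ℝ} (hC : ∀ e, 0 ≤ e → ‖b e‖ ≤ C)
    (x y : H) : ‖N.spectralSum b (polarization x y)‖ ≤ C * (‖x‖ ^ 2 + ‖y‖ ^ 2) := by
  have h := fun ψ : H => N.norm_integral_energyMeasure_le hC ψ
  have hp1 := parallelogram_law_with_norm ℂ x y
  have hp2 := parallelogram_law_with_norm ℂ x (Complex.I • y)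
  rw [norm_smul, Complex.norm_I, one_mul] at hp2
  rw [spectralSum_polarization, norm_mul]
  have h4 : ‖(4⁻¹ : ℂ)‖ = 4⁻¹ := by norm_num
  rw [h4]
  have h5 : ∀ p q r u : ℂ, ‖p - q - Complex.I * r + Complex.I * u‖ ≤ ‖p‖ + ‖q‖ + ‖r‖ + ‖u‖ := by
    intro p q r u
    have h1 := norm_add_le (p - q - Complex.I * r) (Complex.I * u)
    have h2 := norm_sub_le (p - q) (Complex.I * r)
    have h3 := norm_sub_le p q
    simp only [norm_mul, Complex.norm_I, one_mul] at h1 h2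
    linarith
  have h6 := h5 (∫ e, b e ∂N.energyMeasure (x + y)) (∫ e, b e ∂N.energyMeasure (x - y))
    (∫ e, b e ∂N.energyMeasure (x + Complex.I • y)) (∫ e, b e ∂N.energyMeasure (x - Complex.I • y))
  have h7 := h (x + y)
  have h8 := h (x - y)
  have h9 := h (x + Complex.I • y)
  have h10 := h (x - Complex.I • y)
  have h11 : C * (‖x + y‖ ^ 2 + ‖x - y‖ ^ 2) = C * (2 * (‖x‖ ^ 2 + ‖y‖ ^ 2)) := by
    rw [hp1]
  have h12 : C * (‖x + Complex.I • y‖ ^ 2 + ‖x - Complex.I • y‖ ^ 2)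
      = C * (2 * (‖x‖ ^ 2 + ‖y‖ ^ 2)) := by
    rw [hp2]
  linarith

/-- The sesquilinear form `⟨x, b(H) y⟩`. -/
def spectralForm (b : ℝ → ℂ) (hb : BoundedOnSpectrum b) : H →ₗ⋆[ℂ] H →ₗ[ℂ] ℂ :=
  -- Sesquilinearity is a family of linear relations among spectral integrals. For characters they
  -- hold because the form is then ⟨x, U(t) y⟩, and they pass from characters to `b`.
  have key : ∀ v w : H →₀ ℂ, (∀ t, N.spectralSum (wave t) v = N.spectralSum (wave t) w) →
      N.spectralSum b v = N.spectralSum b w := fun v w h => by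
    rw [← sub_eq_zero, ← map_sub]
    exact N.spectralSum_eq_zero_of_wave (fun t => by rw [map_sub, h t, sub_self]) hb
  LinearMap.mk₂'ₛₗ (starRingEnd ℂ) (RingHom.id ℂ)
    (fun x y => N.spectralSum b (polarization x y))
    (fun x x' y => by
      rw [← map_add]
      exact key _ _ fun t => by simp [spectralSum_wave_polarization])
    (fun c x y => by
      rw [← map_smul]
      exact key _ _ fun t => by simp [spectralSum_wave_polarization, mul_comm])
    (fun x y y' => by
      rw [← map_add]
      exact key _ _ fun t => by simp [spectralSum_wave_polarization])
    (fun c x y => by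
      rw [← map_smul]
      exact key _ _ fun t => by simp [spectralSum_wave_polarization])

theorem spectralForm_apply (b : ℝ → ℂ) (hb : BoundedOnSpectrum b) (x y : H) :
    N.spectralForm b hb x y = N.spectralSum b (polarization x y) := rfl

end LocalNet

/-- A sesquilinear form bounded by `C (‖x‖² + ‖y‖²)` is bounded by `2 C ‖x‖ ‖y‖`. -/
theorem norm_sesquilinear_le_of_sq {H : Type*} [NormedAddCommGroup H] [InnerProductSpace ℂ H]
    (q : H →ₗ⋆[ℂ] H →ₗ[ℂ] ℂ) {C : ℝ} (h : ∀ x y, ‖q x y‖ ≤ C * (‖x‖ ^ 2 + ‖y‖ ^ 2)) (x y : H) :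
    ‖q x y‖ ≤ 2 * C * ‖x‖ * ‖y‖ := by
  rcases eq_or_ne x 0 with rfl | hx
  · simp
  rcases eq_or_ne y 0 with rfl | hy
  · simp
  have hx' : 0 < ‖x‖ := norm_pos_iff.mpr hx
  have hy' : 0 < ‖y‖ := norm_pos_iff.mpr hy
  have h1 := h (((‖x‖⁻¹ : ℝ) : ℂ) • x) (((‖y‖⁻¹ : ℝ) : ℂ) • y)
  simp only [map_smulₛₗ, LinearMap.smul_apply, norm_smul,
    Complex.norm_real, norm_inv, norm_norm, Complex.conj_ofReal, RingHom.id_apply] at h1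
  rw [inv_mul_cancel₀ hx'.ne', inv_mul_cancel₀ hy'.ne'] at h1
  have h2 : ‖q x y‖ = ‖x‖ * ‖y‖ * (‖x‖⁻¹ * (‖y‖⁻¹ * ‖q x y‖)) := by field_simp
  rw [h2]
  have h3 : ‖x‖⁻¹ * (‖y‖⁻¹ * ‖q x y‖) ≤ 2 * C := by linarith
  calc _ ≤ ‖x‖ * ‖y‖ * (2 * C) := by gcongr
    _ = _ := by ring

/-- The bounded operator of a bounded sesquilinear form. -/
theorem exists_operator_of_sesquilinear {H : Type*} [NormedAddCommGroup H]
    [InnerProductSpace ℂ H] [CompleteSpace H] (q : H →ₗ⋆[ℂ] H →ₗ[ℂ] ℂ) {C : ℝ}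
    (h : ∀ x y, ‖q x y‖ ≤ C * ‖x‖ * ‖y‖) : ∃ B : H →L[ℂ] H, ∀ x y, ⟪x, B y⟫_ℂ = q x y := by
  refine ⟨ContinuousLinearMap.adjoint
    (InnerProductSpace.continuousLinearMapOfBilin (q.mkContinuous₂ C h)), fun x y => ?_⟩
  rw [ContinuousLinearMap.adjoint_inner_right, InnerProductSpace.continuousLinearMapOfBilin_apply]
  rfl

/-! ### The operators b(H) and their algebra -/

namespace LocalNet

variable {s : ℕ} {H : Type*} [NormedAddCommGroup H] [InnerProductSpace ℂ H] [CompleteSpace H]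
variable (N : LocalNet s H)

theorem isEnergyFunction_iff {b : ℝ → ℂ} {B : H →L[ℂ] H} :
    N.IsEnergyFunction b B ↔ ∀ ψ, ⟪ψ, B ψ⟫_ℂ = ∫ e, b e ∂N.energyMeasure ψ := by
  refine ⟨fun h ψ => h ψ _ (N.isEnergyMeasure_energyMeasure ψ), fun h ψ μ hμ => ?_⟩
  rw [h, (N.isEnergyMeasure_energyMeasure ψ).eq hμ]

/-- For bounded Borel `b` the default value 0 of `energyFunction` is never taken: the operator
exists because the form `spectralForm` is bounded. -/
theorem isEnergyFunction_energyFunction {b : ℝ → ℂ} (hb : BoundedOnSpectrum b) :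
    N.IsEnergyFunction b (N.energyFunction b) := by
  have hex : ∃ B, N.IsEnergyFunction b B := by
    obtain ⟨C, hC⟩ := hb.2
    obtain ⟨B, hB⟩ := exists_operator_of_sesquilinear (N.spectralForm b hb)
      (norm_sesquilinear_le_of_sq _ fun x y => N.norm_spectralSum_polarization_le hC x y)
    refine ⟨B, N.isEnergyFunction_iff.mpr fun ψ => ?_⟩
    rw [hB, spectralForm_apply, ← sub_eq_zero]
    -- On the diagonal the polarized combination must reduce to the single measure of ψ; again it
    -- suffices to check this for characters.
    have := N.spectralSum_eq_zero_of_wave (v := polarization ψ ψ - Finsupp.single ψ 1)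
      (fun t => by
        rw [map_sub, spectralSum_wave_polarization, inner_timeU_eq_integral]
        simp [spectralSum]) hb
    rw [map_sub] at this
    rw [← this]
    simp [spectralSum]
  rw [energyFunction, dif_pos hex]
  exact hex.choose_spec

theorem energyFunction_eq {b : ℝ → ℂ} {B : H →L[ℂ] H} (hb : BoundedOnSpectrum b)
    (h : ∀ ψ, ⟪ψ, B ψ⟫_ℂ = ∫ e, b e ∂N.energyMeasure ψ) : N.energyFunction b = B :=
  IsEnergyFunction.unique N (N.isEnergyFunction_energyFunction hb) (N.isEnergyFunction_iff.mpr h)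

theorem inner_energyFunction_self {b : ℝ → ℂ} (hb : BoundedOnSpectrum b) (ψ : H) :
    ⟪ψ, N.energyFunction b ψ⟫_ℂ = ∫ e, b e ∂N.energyMeasure ψ :=
  N.isEnergyFunction_iff.mp (N.isEnergyFunction_energyFunction hb) ψ

theorem inner_energyFunction {b : ℝ → ℂ} (hb : BoundedOnSpectrum b) (x y : H) :
    ⟪x, N.energyFunction b y⟫_ℂ = N.spectralSum b (polarization x y) :=
  (N.spectralSum_polarization_eq_inner (N.inner_energyFunction_self hb) x y).symm

theorem energyFunction_wave (t : ℝ) : N.energyFunction (wave t) = N.timeU t :=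
  N.energyFunction_eq (boundedOnSpectrum_wave t) fun ψ => N.inner_timeU_eq_integral ψ t

theorem energyFunction_one : N.energyFunction (fun _ => 1) = 1 := by
  rw [← N.timeU_zero, ← energyFunction_wave]
  congr 1
  funext e
  simp [wave]

theorem energyFunction_congr {b c : ℝ → ℂ} (hb : BoundedOnSpectrum b) (hc : BoundedOnSpectrum c)
    (h : ∀ e, 0 ≤ e → b e = c e) : N.energyFunction b = N.energyFunction c := by
  refine N.energyFunction_eq hb fun ψ => ?_
  rw [N.inner_energyFunction_self hc]
  refine integral_congr_ae ?_
  filter_upwards [N.energyMeasure_ae_nonneg ψ] with e he using (h e he).symm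

theorem energyFunction_sub {b c : ℝ → ℂ} (hb : BoundedOnSpectrum b) (hc : BoundedOnSpectrum c) :
    N.energyFunction (fun e => b e - c e) = N.energyFunction b - N.energyFunction c := by
  refine N.energyFunction_eq (hb.sub hc) fun ψ => ?_
  rw [sub_apply, inner_sub_right, N.inner_energyFunction_self hb, N.inner_energyFunction_self hc,
    integral_sub (hb.integrable N ψ) (hc.integrable N ψ)]

theorem star_energyFunction {b : ℝ → ℂ} (hb : BoundedOnSpectrum b) :
    star (N.energyFunction b) = N.energyFunction fun e => conj (b e) := by
  refine (N.energyFunction_eq hb.conj fun ψ => ?_).symm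
  rw [ContinuousLinearMap.star_eq_adjoint, ContinuousLinearMap.adjoint_inner_right,
    ← inner_conj_symm, N.inner_energyFunction_self hb, integral_conj]

/-- Multiplicativity is known when both functions are characters, by the group law of U. Passing
from characters to bounded functions in one factor gives `hwave`, and repeating this in the other
factor gives the claim. -/
theorem energyFunction_mul {b c : ℝ → ℂ} (hb : BoundedOnSpectrum b) (hc : BoundedOnSpectrum c) :
    N.energyFunction b * N.energyFunction c = N.energyFunction fun e => b e * c e := by
  have hwave : ∀ {a : ℝ → ℂ}, BoundedOnSpectrum a → ∀ (t : ℝ) (x y : H),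
      ⟪x, N.timeU t (N.energyFunction a y)⟫_ℂ
        = N.spectralSum (fun e => wave t e * a e) (polarization x y) := by
    intro a ha t x y
    rw [← clm_mul_app, timeU_commute_energyFunction, clm_mul_app, N.inner_energyFunction ha]
    have := N.spectralSum_eq_of_wave (boundedOnSpectrum_wave t) (v' := polarization x (N.timeU t y))
      (v := polarization x y) (fun t' => by
        simp only [wave_mul]
        rw [spectralSum_wave_polarization, spectralSum_wave_polarization, ← clm_mul_app, timeU_mul])
      ha
    rw [this]
    simp only [mul_comm]
  refine (ContinuousLinearMap.ext fun y => ext_inner_left ℂ fun x => ?_)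
  rw [clm_mul_app, N.inner_energyFunction hb, N.inner_energyFunction (hb.mul hc)]
  exact N.spectralSum_eq_of_wave hc (fun t => by
    rw [spectralSum_wave_polarization, hwave hc]) hb

theorem energyFunction_mul_apply {b c : ℝ → ℂ} (hb : BoundedOnSpectrum b)
    (hc : BoundedOnSpectrum c) (x : H) :
    N.energyFunction b (N.energyFunction c x) = N.energyFunction (fun e => b e * c e) x := by
  rw [← N.energyFunction_mul hb hc]
  rfl

theorem inner_energyFunction_energyFunction {b c : ℝ → ℂ} (hb : BoundedOnSpectrum b)
    (hc : BoundedOnSpectrum c) (x y : H) :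
    ⟪N.energyFunction b x, N.energyFunction c y⟫_ℂ
      = ⟪x, N.energyFunction (fun e => conj (b e) * c e) y⟫_ℂ := by
  rw [← ContinuousLinearMap.adjoint_inner_right, ← ContinuousLinearMap.star_eq_adjoint,
    N.star_energyFunction hb, N.energyFunction_mul_apply hb.conj hc]

theorem norm_energyFunction_le {b : ℝ → ℂ} (hb : BoundedOnSpectrum b) {C : ℝ}
    (hC : ∀ e, 0 ≤ e → ‖b e‖ ≤ C) : ‖N.energyFunction b‖ ≤ C := by
  have hC0 : 0 ≤ C := (norm_nonneg _).trans (hC 0 le_rfl)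
  refine ContinuousLinearMap.opNorm_le_bound _ hC0 fun x => ?_
  refine le_of_sq_le_sq ?_ (by positivity)
  -- The squared norm of b(H)x is the integral of |b|² against the spectral measure of x.
  have h1 : ((‖N.energyFunction b x‖ ^ 2 : ℝ) : ℂ)
      = ∫ e, conj (b e) * b e ∂N.energyMeasure x := by
    rw [← N.inner_energyFunction_self (hb.conj.mul hb),
      ← N.inner_energyFunction_energyFunction hb hb, inner_self_eq_norm_sq_to_K]
    push_cast
    rfl
  have h2 := N.norm_integral_energyMeasure_le (b := fun e => conj (b e) * b e) (C := C ^ 2)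
    (fun e he => by
      rw [norm_mul, RCLike.norm_conj, ← sq]
      exact pow_le_pow_left₀ (norm_nonneg _) (hC e he) 2) x
  rw [← h1, Complex.norm_real, Real.norm_of_nonneg (by positivity)] at h2
  rw [mul_pow]
  exact h2

theorem energyMeasure_vacuum : N.energyMeasure N.Ω = Measure.dirac 0 := by
  refine (N.isEnergyMeasure_energyMeasure N.Ω).eq ⟨inferInstance, fun t => ?_⟩
  rw [timeU, N.U_vacuum, inner_self_eq_norm_sq_to_K, N.norm_vacuum]
  simp

/-- The spectral measure of Ω is the point mass at 0, so the squared norm of (b(H) - b(0))Ω is the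
value at 0 of |b - b(0)|². -/
theorem energyFunction_vacuum {b : ℝ → ℂ} (hb : BoundedOnSpectrum b) :
    N.energyFunction b N.Ω = b 0 • N.Ω := by
  have hd := hb.sub (boundedOnSpectrum_const (b 0))
  have h1 : N.energyFunction (fun e => b e - b 0) N.Ω = 0 := by
    rw [← inner_self_eq_zero (𝕜 := ℂ), N.inner_energyFunction_energyFunction hd hd,
      N.inner_energyFunction_self (hd.conj.mul hd), energyMeasure_vacuum, integral_dirac]
    simp
  have h2 : N.energyFunction (fun _ => b 0) = b 0 • (1 : H →L[ℂ] H) := by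
    refine N.energyFunction_eq (boundedOnSpectrum_const _) fun ψ => ?_
    rw [integral_const, N.energyMeasure_univ, smul_apply, inner_smul_right,
      one_apply_eq_self, inner_self_eq_norm_sq_to_K]
    simp [mul_comm]
  rw [N.energyFunction_sub hb (boundedOnSpectrum_const _), h2, sub_apply, sub_eq_zero] at h1
  exact h1

/-! ### Exponentials and resolvent powers of the Hamiltonian -/

/-- `e ↦ exp (c e)`. -/
def expFn (c : ℂ) (e : ℝ) : ℂ := Complex.exp (c * e)

theorem norm_expFn (c : ℂ) (e : ℝ) : ‖expFn c e‖ = Real.exp (c.re * e) := by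
  simp [expFn, Complex.norm_exp]

theorem norm_expFn_le {c : ℂ} (hc : c.re ≤ 0) {e : ℝ} (he : 0 ≤ e) : ‖expFn c e‖ ≤ 1 := by
  rw [norm_expFn]
  exact Real.exp_le_one_iff.mpr (mul_nonpos_of_nonpos_of_nonneg hc he)

theorem measurable_expFn (c : ℂ) : Measurable (expFn c) := by
  unfold expFn
  fun_prop

theorem boundedOnSpectrum_expFn {c : ℂ} (hc : c.re ≤ 0) : BoundedOnSpectrum (expFn c) :=
  ⟨measurable_expFn c, 1, fun _ he => norm_expFn_le hc he⟩

theorem expFn_mul (c d : ℂ) : (fun e => expFn c e * expFn d e) = expFn (c + d) := by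
  funext e
  rw [expFn, expFn, expFn, ← Complex.exp_add, add_mul]

theorem conj_expFn (c : ℂ) : (fun e => conj (expFn c e)) = expFn (conj c) := by
  funext e
  simp [expFn, ← Complex.exp_conj]

theorem expFn_zero_right (c : ℂ) : expFn c 0 = 1 := by simp [expFn]

/-- `exp (c H)`, for `Re c ≤ 0`. -/
def expH (c : ℂ) : H →L[ℂ] H := N.energyFunction (expFn c)

theorem expH_mul {c d : ℂ} (hc : c.re ≤ 0) (hd : d.re ≤ 0) :
    N.expH c * N.expH d = N.expH (c + d) := by
  rw [expH, expH, N.energyFunction_mul (boundedOnSpectrum_expFn hc) (boundedOnSpectrum_expFn hd),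
    expFn_mul, expH]

theorem expH_apply_apply {c d : ℂ} (hc : c.re ≤ 0) (hd : d.re ≤ 0) (x : H) :
    N.expH c (N.expH d x) = N.expH (c + d) x := by
  rw [← N.expH_mul hc hd]
  rfl

theorem star_expH {c : ℂ} (hc : c.re ≤ 0) : star (N.expH c) = N.expH (conj c) := by
  rw [expH, N.star_energyFunction (boundedOnSpectrum_expFn hc), conj_expFn, expH]

theorem inner_expH_left {c : ℂ} (hc : c.re ≤ 0) (x y : H) :
    ⟪N.expH c x, y⟫_ℂ = ⟪x, N.expH (conj c) y⟫_ℂ := by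
  rw [← ContinuousLinearMap.adjoint_inner_right, ← ContinuousLinearMap.star_eq_adjoint,
    N.star_expH hc]

theorem inner_expH_expH {c d : ℂ} (hc : c.re ≤ 0) (hd : d.re ≤ 0) (x y : H) :
    ⟪N.expH c x, N.expH d y⟫_ℂ = ⟪x, N.expH (conj c + d) y⟫_ℂ := by
  rw [N.inner_expH_left hc, N.expH_apply_apply (by simpa using hc) hd]

theorem expH_vacuum {c : ℂ} (hc : c.re ≤ 0) : N.expH c N.Ω = N.Ω := by
  rw [expH, N.energyFunction_vacuum (boundedOnSpectrum_expFn hc), expFn_zero_right, one_smul]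

theorem norm_expH_le {c : ℂ} (hc : c.re ≤ 0) : ‖N.expH c‖ ≤ 1 :=
  N.norm_energyFunction_le (boundedOnSpectrum_expFn hc) fun _ he => norm_expFn_le hc he

theorem re_neg_ofReal_nonpos {ε : ℝ} (hε : 0 ≤ ε) : (-(ε : ℂ)).re ≤ 0 := by simpa using hε

theorem boundedOnSpectrum_resolvent {ℓ : ℝ} (hℓ : 0 ≤ ℓ) :
    BoundedOnSpectrum fun e => (((1 + e) ^ (-ℓ) : ℝ) : ℂ) := by
  refine ⟨by fun_prop, 1, fun e he => ?_⟩
  rw [Complex.norm_real, Real.norm_of_nonneg (by positivity)]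
  exact Real.rpow_le_one_of_one_le_of_nonpos (by linarith) (by linarith)

theorem R_mul {ℓ ℓ' : ℝ} (hℓ : 0 ≤ ℓ) (hℓ' : 0 ≤ ℓ') : N.R ℓ * N.R ℓ' = N.R (ℓ + ℓ') := by
  have hb := boundedOnSpectrum_resolvent hℓ
  have hb' := boundedOnSpectrum_resolvent hℓ'
  rw [R, R, N.energyFunction_mul hb hb']
  refine N.energyFunction_congr (hb.mul hb') (boundedOnSpectrum_resolvent (by positivity))
    fun e he => ?_
  rw [← Complex.ofReal_mul, ← Real.rpow_add (by linarith), neg_add]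

theorem norm_R_le {ℓ : ℝ} (hℓ : 0 ≤ ℓ) : ‖N.R ℓ‖ ≤ 1 := by
  refine N.norm_energyFunction_le (boundedOnSpectrum_resolvent hℓ) fun e he => ?_
  rw [Complex.norm_real, Real.norm_of_nonneg (by positivity)]
  exact Real.rpow_le_one_of_one_le_of_nonpos (by linarith) (by linarith)

theorem energyNorm_nonneg {ℓ : ℝ} (hℓ : 0 < ℓ) (σ : N.Smooth) : 0 ≤ N.energyNorm ℓ σ :=
  (N.energyBound_energyNorm hℓ σ).1

/-- The extra resolvent power R^{ℓ'-ℓ} on either side is a contraction. -/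
theorem energyNorm_mono {ℓ ℓ' : ℝ} (hℓ : 0 < ℓ) (h : ℓ ≤ ℓ') (σ : N.Smooth) :
    N.energyNorm ℓ σ ≤ N.energyNorm ℓ' σ := by
  obtain ⟨h0, hb⟩ := N.energyBound_energyNorm (hℓ.trans_le h) σ
  refine N.energyNorm_le ⟨h0, fun A => (hb A).trans (mul_le_mul_of_nonneg_left ?_ h0)⟩
  have h1 : 0 ≤ ℓ' - ℓ := sub_nonneg.mpr h
  have e1 : N.R ℓ' = N.R (ℓ' - ℓ) * N.R ℓ := by rw [N.R_mul h1 hℓ.le, sub_add_cancel]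
  have e2 : N.R ℓ' = N.R ℓ * N.R (ℓ' - ℓ) := by rw [N.R_mul hℓ.le h1, add_sub_cancel]
  calc ‖N.R ℓ' * A * N.R ℓ'‖ = ‖N.R (ℓ' - ℓ) * (N.R ℓ * A * N.R ℓ) * N.R (ℓ' - ℓ)‖ := by
        nth_rewrite 1 [e1]
        nth_rewrite 1 [e2]
        simp only [mul_assoc]
    _ ≤ 1 * ‖N.R ℓ * A * N.R ℓ‖ * 1 := by
        refine (norm_mul_le _ _).trans ?_
        gcongr
        · refine (norm_mul_le _ _).trans ?_
          gcongr
          exact N.norm_R_le h1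
        · exact N.norm_R_le h1
    _ = _ := by ring

/-- Elements of `𝒞^∞(Σ)*` are of finite order. -/
theorem exists_dual_bound (φ : N.SmoothDual) :
    ∃ n : ℕ, 0 < n ∧ ∃ C : ℝ, 0 ≤ C ∧ ∀ σ : N.Smooth, ‖φ σ‖ ≤ C * N.energyNorm n σ := by
  have hcont : Continuous ((normSeminorm ℂ ℂ).comp
      ((WeakDual.toStrongDual φ : StrongDual ℂ N.Smooth) : N.Smooth →ₗ[ℂ] ℂ)) :=
    continuous_norm.comp (map_continuous φ)
  obtain ⟨S, C, -, h⟩ := Seminorm.bound_of_continuous N.withSeminorms _ hcont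
  obtain ⟨n, hn⟩ : ∃ n : ℕ, ∀ ℓ ∈ S, ℓ.1 ≤ n := by
    obtain ⟨M, hM⟩ := (S.finite_toSet.image fun ℓ => (ℓ.1 : ℝ)).bddAbove
    obtain ⟨n, hn⟩ := exists_nat_ge M
    exact ⟨n, fun ℓ hℓ => (hM ⟨ℓ, hℓ, rfl⟩).trans hn⟩
  -- The successor ensures a strictly positive order, even if the finite set `S` is empty and n = 0.
  refine ⟨n + 1, n.succ_pos, C, C.2, fun σ => ?_⟩
  have h1 : ‖φ σ‖ ≤ C * (S.sup N.seminormFamily) σ := h σ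
  refine h1.trans (mul_le_mul_of_nonneg_left ?_ C.2)
  have hpos : (0 : ℝ) < ((n + 1 : ℕ) : ℝ) := by positivity
  refine Seminorm.finset_sup_apply_le (N.energyNorm_nonneg hpos σ) fun ℓ hℓ => ?_
  exact N.energyNorm_mono ℓ.2 ((hn ℓ hℓ).trans (by push_cast; linarith)) σ

/-! ### Vector functionals -/

/-- The functional `A ↦ ⟨x, A y⟩`. -/
def vectorFunctional (x y : H) : StrongDual ℂ (H →L[ℂ] H) :=
  (innerSL ℂ x).comp (ContinuousLinearMap.apply ℂ H y)

theorem vectorFunctional_apply (x y : H) (A : H →L[ℂ] H) :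
    vectorFunctional x y A = ⟪x, A y⟫_ℂ := rfl

theorem isNormalFunctional_vectorFunctional (x y : H) :
    IsNormalFunctional (vectorFunctional x y) := by
  have hs : ∀ x : H, Summable fun n => ‖(Pi.single 0 x : ℕ → H) n‖ ^ 2 := fun x =>
    summable_of_ne_finset_zero (s := {0}) fun n hn => by
      rw [Finset.mem_singleton] at hn
      simp [hn]
  refine ⟨Pi.single 0 x, Pi.single 0 y, hs x, hs y, fun A => ?_⟩
  have := hasSum_single (f := fun n => ⟪(Pi.single 0 x : ℕ → H) n, A ((Pi.single 0 y : ℕ → H) n)⟫_ℂ)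
    0 fun n hn => by simp [hn]
  simpa [vectorFunctional_apply] using this

/-- `e ↦ (1 + e)^ℓ exp (-ε e)`. -/
def dampedPower (ε ℓ : ℝ) (e : ℝ) : ℂ := ((((1 + e) ^ ℓ * Real.exp (-(ε * e)) : ℝ)) : ℂ)

/-- The constant comes from xⁿ/n! ≤ eˣ at x = ε(1 + e). Its power-law dependence on ε is what later
gives polynomial growth at the boundary. -/
theorem norm_dampedPower_le {ε : ℝ} (hε : 0 < ε) (n : ℕ) {ℓ : ℝ} (hn : ℓ ≤ n) {e : ℝ}
    (he : 0 ≤ e) : ‖dampedPower ε ℓ e‖ ≤ n.factorial * Real.exp ε / ε ^ n := by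
  rw [dampedPower, Complex.norm_real, Real.norm_of_nonneg (by positivity)]
  have h1 : (1 + e) ^ ℓ ≤ (1 + e) ^ n := by
    rw [← Real.rpow_natCast]
    exact Real.rpow_le_rpow_of_exponent_le (by linarith) hn
  have h2 := Real.pow_div_factorial_le_exp (ε * (1 + e)) (by positivity) n
  rw [div_le_iff₀ (by positivity), mul_pow] at h2
  have h3 : Real.exp (ε * (1 + e)) * Real.exp (-(ε * e)) = Real.exp ε := by
    rw [← Real.exp_add]
    ring_nf
  rw [le_div_iff₀ (by positivity)]
  calc (1 + e) ^ ℓ * Real.exp (-(ε * e)) * ε ^ n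
      ≤ (1 + e) ^ n * Real.exp (-(ε * e)) * ε ^ n := by gcongr
    _ = (ε ^ n * (1 + e) ^ n) * Real.exp (-(ε * e)) := by ring
    _ ≤ (Real.exp (ε * (1 + e)) * n.factorial) * Real.exp (-(ε * e)) := by gcongr
    _ = n.factorial * (Real.exp (ε * (1 + e)) * Real.exp (-(ε * e))) := by ring
    _ = _ := by rw [h3]

theorem boundedOnSpectrum_dampedPower {ε : ℝ} (hε : 0 < ε) (ℓ : ℝ) :
    BoundedOnSpectrum (dampedPower ε ℓ) := by
  obtain ⟨n, hn⟩ := exists_nat_ge ℓ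
  exact ⟨by unfold dampedPower; fun_prop, _, fun e he => norm_dampedPower_le hε n hn he⟩

theorem R_mul_dampedPower {ε ℓ : ℝ} (hε : 0 < ε) (hℓ : 0 ≤ ℓ) :
    N.R ℓ * N.energyFunction (dampedPower ε ℓ) = N.expH (-(ε : ℂ)) := by
  have hb := boundedOnSpectrum_resolvent hℓ
  have hb' := boundedOnSpectrum_dampedPower hε ℓ
  rw [R, N.energyFunction_mul hb hb', expH]
  refine N.energyFunction_congr (hb.mul hb')
    (boundedOnSpectrum_expFn (re_neg_ofReal_nonpos hε.le)) fun e he => ?_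
  rw [dampedPower, ← Complex.ofReal_mul, ← mul_assoc, ← Real.rpow_add (by linarith),
    neg_add_cancel, Real.rpow_zero, one_mul, expFn]
  push_cast
  rw [neg_mul]

/-- Since e^{-εH} = R^ℓ (1+H)^ℓ e^{-εH} with the last two factors jointly bounded, one R^ℓ can be
moved to each side of `A`. Damped vectors therefore define functionals that are smooth to every
order. -/
theorem energyBound_vectorFunctional {ε ℓ : ℝ} (hε : 0 < ε) (hℓ : 0 < ℓ) (χ ξ : H) {C : ℝ}
    (hC : ∀ e, 0 ≤ e → ‖dampedPower ε ℓ e‖ ≤ C) :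
    N.EnergyBound ℓ (vectorFunctional (N.expH (-(ε : ℂ)) χ) (N.expH (-(ε : ℂ)) ξ))
      (C ^ 2 * ‖χ‖ * ‖ξ‖) := by
  refine ⟨by positivity, fun A => ?_⟩
  have hC0 : 0 ≤ C := (norm_nonneg _).trans (hC 0 le_rfl)
  have hS := N.norm_energyFunction_le (boundedOnSpectrum_dampedPower hε ℓ) hC
  have hD : ∀ x, N.expH (-(ε : ℂ)) x = N.R ℓ (N.energyFunction (dampedPower ε ℓ) x) := fun x => by
    rw [← N.R_mul_dampedPower hε hℓ.le]
    rfl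
  have hR : ∀ x y : H, ⟪N.R ℓ x, y⟫_ℂ = ⟪x, N.R ℓ y⟫_ℂ := fun x y => by
    rw [← ContinuousLinearMap.adjoint_inner_right, ← ContinuousLinearMap.star_eq_adjoint, N.star_R]
  rw [vectorFunctional_apply, hD, hD, hR]
  calc ‖⟪N.energyFunction (dampedPower ε ℓ) χ,
        (N.R ℓ * A * N.R ℓ) (N.energyFunction (dampedPower ε ℓ) ξ)⟫_ℂ‖
      ≤ ‖N.energyFunction (dampedPower ε ℓ) χ‖ *
        (‖N.R ℓ * A * N.R ℓ‖ * ‖N.energyFunction (dampedPower ε ℓ) ξ‖) :=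
        (norm_inner_le_norm _ _).trans (by gcongr; exact ContinuousLinearMap.le_opNorm _ _)
    _ ≤ (C * ‖χ‖) * (‖N.R ℓ * A * N.R ℓ‖ * (C * ‖ξ‖)) := by
        gcongr <;> exact (ContinuousLinearMap.le_opNorm _ _).trans (by gcongr)
    _ = _ := by ring

/-- The functional `A ↦ ⟨e^{-εH} χ, A e^{-εH} ξ⟩` in `𝒞^∞(Σ)`. -/
def dampedFunctional (ε : ℝ) (hε : 0 < ε) (χ ξ : H) : N.Smooth :=
  ⟨vectorFunctional (N.expH (-(ε : ℂ)) χ) (N.expH (-(ε : ℂ)) ξ),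
    isNormalFunctional_vectorFunctional _ _, fun ℓ hℓ => by
      obtain ⟨C, hC⟩ := (boundedOnSpectrum_dampedPower hε ℓ).2
      exact ⟨_, N.energyBound_vectorFunctional hε hℓ χ ξ hC⟩⟩

theorem dampedFunctional_apply (ε : ℝ) (hε : 0 < ε) (χ ξ : H) (A : H →L[ℂ] H) :
    (N.dampedFunctional ε hε χ ξ).1 A = ⟪N.expH (-(ε : ℂ)) χ, A (N.expH (-(ε : ℂ)) ξ)⟫_ℂ := rfl

variable {N} in
theorem Smooth.ext {σ τ : N.Smooth} (h : ∀ A, σ.1 A = τ.1 A) : σ = τ :=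
  Subtype.ext (ContinuousLinearMap.ext h)

theorem Smooth.add_apply (σ τ : N.Smooth) (A : H →L[ℂ] H) : (σ + τ).1 A = σ.1 A + τ.1 A := rfl

theorem Smooth.sub_apply (σ τ : N.Smooth) (A : H →L[ℂ] H) : (σ - τ).1 A = σ.1 A - τ.1 A := rfl

theorem Smooth.smul_apply (c : ℂ) (σ : N.Smooth) (A : H →L[ℂ] H) : (c • σ).1 A = c * σ.1 A := rfl

theorem energyNorm_dampedFunctional_le {ε : ℝ} (hε : 0 < ε) {n : ℕ} (hn : 0 < n) (χ ξ : H) :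
    N.energyNorm n (N.dampedFunctional ε hε χ ξ)
      ≤ (n.factorial * Real.exp ε / ε ^ n) ^ 2 * ‖χ‖ * ‖ξ‖ :=
  N.energyNorm_le (N.energyBound_vectorFunctional hε (Nat.cast_pos.mpr hn) χ ξ
    fun _ he => norm_dampedPower_le hε n le_rfl he)

/-! ### Damped fields -/

/-- The sesquilinear form of `e^{-εH} φ e^{-εH}`. -/
def dampedForm (ε : ℝ) (hε : 0 < ε) (φ : N.SmoothDual) : H →ₗ⋆[ℂ] H →ₗ[ℂ] ℂ :=
  LinearMap.mk₂'ₛₗ (starRingEnd ℂ) (RingHom.id ℂ)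
    (fun χ ξ => φ (N.dampedFunctional ε hε χ ξ))
    (fun x x' y => by
      rw [← map_add]
      congr 1
      exact Smooth.ext fun A => by
        simp [dampedFunctional_apply, Smooth.add_apply])
    (fun c x y => by
      rw [← map_smul]
      congr 1
      exact Smooth.ext fun A => by
        simp [dampedFunctional_apply, Smooth.smul_apply, mul_comm])
    (fun x y y' => by
      rw [← map_add]
      congr 1
      exact Smooth.ext fun A => by
        simp [dampedFunctional_apply, Smooth.add_apply])
    (fun c x y => by
      rw [RingHom.id_apply, ← map_smul]
      congr 1
      exact Smooth.ext fun A => by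
        simp [dampedFunctional_apply, Smooth.smul_apply])

theorem norm_dual_dampedFunctional_le {φ : N.SmoothDual} {n : ℕ} (hn : 0 < n) {C : ℝ}
    (hC0 : 0 ≤ C) (hC : ∀ σ : N.Smooth, ‖φ σ‖ ≤ C * N.energyNorm n σ) {ε : ℝ} (hε : 0 < ε)
    (χ ξ : H) : ‖φ (N.dampedFunctional ε hε χ ξ)‖
      ≤ C * (n.factorial * Real.exp ε / ε ^ n) ^ 2 * ‖χ‖ * ‖ξ‖ := by
  refine (hC _).trans ((mul_le_mul_of_nonneg_left
    (N.energyNorm_dampedFunctional_le hε hn χ ξ) hC0).trans_eq ?_)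
  ring

theorem exp_neg_ofReal_eq_expFn (ε : ℝ) :
    (fun e : ℝ => Complex.exp (-((ε * e : ℝ) : ℂ))) = expFn (-(ε : ℂ)) := by
  funext e
  rw [expFn]
  push_cast
  rw [neg_mul]

theorem isDamped_iff {ε : ℝ} (hε : 0 < ε) {φ : N.SmoothDual} {B : H →L[ℂ] H} :
    N.IsDamped ε φ B ↔ ∀ χ ξ, ⟪χ, B ξ⟫_ℂ = φ (N.dampedFunctional ε hε χ ξ) := by
  unfold IsDamped
  rw [exp_neg_ofReal_eq_expFn]
  refine ⟨fun h χ ξ => h χ ξ _ fun A => rfl, fun h χ ξ σ hσ => ?_⟩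
  rw [h]
  congr 1
  exact (Smooth.ext hσ).symm

/-- Finite order of φ bounds the sesquilinear form, so the operator exists and the default value 0
of `damped` is not taken. -/
theorem inner_damped {ε : ℝ} (hε : 0 < ε) (φ : N.SmoothDual) (χ ξ : H) :
    ⟪χ, N.damped ε φ ξ⟫_ℂ = φ (N.dampedFunctional ε hε χ ξ) := by
  have hex : ∃ B, N.IsDamped ε φ B := by
    obtain ⟨n, hn, C, hC0, hC⟩ := N.exists_dual_bound φ
    obtain ⟨B, hB⟩ := exists_operator_of_sesquilinear (N.dampedForm ε hε φ)
      (fun χ ξ => N.norm_dual_dampedFunctional_le hn hC0 hC hε χ ξ)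
    exact ⟨B, (N.isDamped_iff hε).mpr hB⟩
  rw [damped, dif_pos hex]
  exact (N.isDamped_iff hε).mp hex.choose_spec χ ξ

theorem damped_add {ε δ : ℝ} (hε : 0 < ε) (hδ : 0 ≤ δ) (φ : N.SmoothDual) :
    N.damped (ε + δ) φ = N.expH (-(δ : ℂ)) * N.damped ε φ * N.expH (-(δ : ℂ)) := by
  refine ContinuousLinearMap.ext fun ξ => ext_inner_left ℂ fun χ => ?_
  have hre := re_neg_ofReal_nonpos hδ
  have hre' := re_neg_ofReal_nonpos hε.le
  have h1 : ⟪χ, N.expH (-(δ : ℂ)) (N.damped ε φ (N.expH (-(δ : ℂ)) ξ))⟫_ℂ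
      = ⟪N.expH (-(δ : ℂ)) χ, N.damped ε φ (N.expH (-(δ : ℂ)) ξ)⟫_ℂ := by
    rw [N.inner_expH_left hre]
    simp
  rw [N.inner_damped (by positivity)]
  refine Eq.trans ?_ h1.symm
  rw [N.inner_damped hε]
  congr 1
  refine Smooth.ext fun A => ?_
  rw [dampedFunctional_apply, dampedFunctional_apply, N.expH_apply_apply hre' hre,
    N.expH_apply_apply hre' hre]
  push_cast
  rw [neg_add]

theorem damped_starDual {ε : ℝ} (hε : 0 < ε) (φ : N.SmoothDual) :
    N.damped ε (N.starDual φ) = star (N.damped ε φ) := by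
  refine ContinuousLinearMap.ext fun ξ => ext_inner_left ℂ fun χ => ?_
  rw [N.inner_damped hε, ContinuousLinearMap.star_eq_adjoint,
    ContinuousLinearMap.adjoint_inner_right, ← inner_conj_symm, N.inner_damped hε]
  change conj (φ (N.starSmooth (N.dampedFunctional ε hε χ ξ))) = _
  congr 2
  refine Smooth.ext fun A => ?_
  change conj ((N.dampedFunctional ε hε χ ξ).1 (star A)) = _
  rw [dampedFunctional_apply, dampedFunctional_apply, inner_conj_symm,
    ContinuousLinearMap.star_eq_adjoint, ContinuousLinearMap.adjoint_inner_left]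

/-- The vector `e^{-εH} φ Ω`. -/
def fieldVector (φ : N.SmoothDual) (ε : ℝ) : H := N.damped ε φ N.Ω

theorem fieldVector_add {ε δ : ℝ} (hε : 0 < ε) (hδ : 0 ≤ δ) (φ : N.SmoothDual) :
    N.fieldVector φ (ε + δ) = N.expH (-(δ : ℂ)) (N.fieldVector φ ε) := by
  rw [fieldVector, N.damped_add hε hδ, clm_mul_app, N.expH_vacuum (re_neg_ofReal_nonpos hδ)]
  rfl

/-- `‖e^{-εH} φ Ω‖` grows at most polynomially in `1/ε`. -/
theorem exists_norm_fieldVector_le (φ : N.SmoothDual) : ∃ (n : ℕ) (C : ℝ), 0 ≤ C ∧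
    ∀ ε, 0 < ε → ε ≤ 1 → ‖N.fieldVector φ ε‖ ≤ C / ε ^ n := by
  obtain ⟨n, hn, C, hC0, hC⟩ := N.exists_dual_bound φ
  refine ⟨2 * n, C * (n.factorial * Real.exp 1) ^ 2, by positivity, fun ε hε hε1 => ?_⟩
  -- Testing with the vector itself bounds its squared norm by a constant times its norm; one factor
  -- then cancels.
  have h1 := N.norm_dual_dampedFunctional_le hn hC0 hC hε (N.fieldVector φ ε) N.Ω
  rw [← N.inner_damped hε] at h1
  change ‖⟪N.fieldVector φ ε, N.fieldVector φ ε⟫_ℂ‖ ≤ _ at h1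
  rw [inner_self_eq_norm_sq_to_K, N.norm_vacuum, mul_one] at h1
  simp only [norm_pow, Complex.coe_algebraMap, Complex.norm_real, norm_norm] at h1
  rcases (norm_nonneg (N.fieldVector φ ε)).eq_or_lt with h0 | h0
  · rw [← h0]
    positivity
  · have h2 : ‖N.fieldVector φ ε‖ ≤ C * (n.factorial * Real.exp ε / ε ^ n) ^ 2 := by
      rw [sq] at h1
      exact le_of_mul_le_mul_right h1 h0
    refine h2.trans ?_
    rw [div_pow, ← mul_div_assoc, ← pow_mul, mul_comm n 2]
    gcongr

/-! ### The two-point function in the vacuum -/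

/-- The vacuum functional `⟨Ω, · Ω⟩`. -/
def vacuum : N.Smooth := N.dampedFunctional 1 one_pos N.Ω N.Ω

theorem vacuum_apply (A : H →L[ℂ] H) : N.vacuum.1 A = ⟪N.Ω, A N.Ω⟫_ℂ := by
  rw [vacuum, dampedFunctional_apply, N.expH_vacuum (re_neg_ofReal_nonpos zero_le_one)]

theorem translate_vacuum (t : ℝ) : N.translate t N.vacuum = N.vacuum := by
  refine Smooth.ext fun A => ?_
  change conjFunctional (N.timeU t) N.vacuum.1 A = _
  have h : star (N.timeU t) N.Ω = N.Ω := by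
    have h1 : N.timeU t N.Ω = N.Ω := N.U_vacuum _ _
    nth_rewrite 1 [← h1]
    rw [← clm_mul_app, timeU_star_mul]
    rfl
  rw [conjFunctional_apply, vacuum_apply, vacuum_apply, clm_mul_app, clm_mul_app, h,
    ← ContinuousLinearMap.adjoint_inner_left, ← ContinuousLinearMap.star_eq_adjoint, h]

theorem isEnergyBounded_vacuum {E : ℝ} (hE : 0 ≤ E) : N.IsEnergyBounded E N.vacuum.1 := by
  have hb : BoundedOnSpectrum ((Set.Icc 0 E).indicator 1) := by
    refine ⟨measurable_one.indicator measurableSet_Icc, 1, fun e _ => ?_⟩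
    refine (norm_indicator_le_norm_self _ _).trans ?_
    simp
  have h0 : (0 : ℝ) ∈ Set.Icc 0 E := ⟨le_rfl, hE⟩
  have hP : N.P E N.Ω = N.Ω := by
    rw [P, N.energyFunction_vacuum hb, Set.indicator_of_mem h0]
    simp
  have hP' : star (N.P E) N.Ω = N.Ω := by
    rw [P, N.star_energyFunction hb, N.energyFunction_vacuum hb.conj, Set.indicator_of_mem h0]
    simp
  refine ⟨N.vacuum.1, N.vacuum.2.1, fun A => ?_⟩
  rw [vacuum_apply, vacuum_apply, clm_mul_app, clm_mul_app, hP,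
    ← ContinuousLinearMap.adjoint_inner_left (N.P E), ← ContinuousLinearMap.star_eq_adjoint, hP']

/-- The two-point function `⟨φ Ω, exp (-i z H) φ Ω⟩`, for `Im z < 0`. -/
def vacuumTwoPoint (φ : N.SmoothDual) (z : ℂ) : ℂ :=
  ⟪N.fieldVector φ (-z.im / 4), N.expH (-(Complex.I * z) - (z.im / 2 : ℝ))
    (N.fieldVector φ (-z.im / 4))⟫_ℂ

/-- The outer operators `W` fix Ω because their symbol is 1 at energy 0, and the damped φ* is the
adjoint of the damped φ. Only the middle exponential between two copies of the field vector remains.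
-/
theorem twoPoint_vacuum {E : ℝ} (hE : 0 ≤ E) (φ : N.SmoothDual) {z : ℂ} (hz : z.im < 0) :
    N.twoPoint E N.vacuum.1 (N.starDual φ) φ z = N.vacuumTwoPoint φ z := by
  have h0 : (0 : ℝ) ∈ Set.Icc 0 E := ⟨le_rfl, hE⟩
  have hε : 0 < -z.im / 4 := by linarith
  unfold twoPoint vacuumTwoPoint
  simp only
  set b : ℝ → ℂ := (Set.Icc 0 E).indicator fun e =>
    Complex.exp ((Complex.I * z / 2 + ((-z.im / 4 : ℝ) : ℂ)) * e) with hbdef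
  have hb : BoundedOnSpectrum b := by
    refine ⟨(Measurable.indicator (by fun_prop) measurableSet_Icc),
      Real.exp (|(Complex.I * z / 2 + ((-z.im / 4 : ℝ) : ℂ)).re| * E), fun e he => ?_⟩
    by_cases heE : e ∈ Set.Icc 0 E
    · rw [hbdef, Set.indicator_of_mem heE, Complex.norm_exp]
      refine Real.exp_le_exp.mpr ?_
      rw [Complex.re_mul_ofReal]
      exact (mul_le_mul_of_nonneg_right (le_abs_self _) he).trans
        (mul_le_mul_of_nonneg_left heE.2 (abs_nonneg _))
    · rw [hbdef, Set.indicator_of_notMem heE, norm_zero]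
      positivity
  have hb0 : b 0 = 1 := by simp [hbdef, Set.indicator_of_mem h0]
  have hW : N.energyFunction b N.Ω = N.Ω := by
    rw [N.energyFunction_vacuum hb, hb0, one_smul]
  have hW' : star (N.energyFunction b) N.Ω = N.Ω := by
    rw [N.star_energyFunction hb, N.energyFunction_vacuum hb.conj, hb0, map_one, one_smul]
  rw [vacuum_apply, N.damped_starDual hε]
  simp only [clm_mul_app]
  rw [hW, ← ContinuousLinearMap.adjoint_inner_left, ← ContinuousLinearMap.star_eq_adjoint, hW',
    ContinuousLinearMap.star_eq_adjoint, ContinuousLinearMap.adjoint_inner_right]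
  have hM : (fun e : ℝ => Complex.exp ((-(Complex.I * z) + 2 * ((-z.im / 4 : ℝ) : ℂ)) * e))
      = expFn (-(Complex.I * z) - (z.im / 2 : ℝ)) := by
    funext e
    rw [expFn]
    congr 2
    push_cast
    ring
  rw [hM]
  rfl

/-- The definition uses a damping that varies with z. Surplus damping can be moved into the middle
exponential, so one fixed ε serves a whole half plane; analyticity and the Gram form both need this.
-/
theorem vacuumTwoPoint_eq (φ : N.SmoothDual) {ε : ℝ} (hε : 0 < ε) {z : ℂ} (hz : 4 * ε ≤ -z.im) :
    N.vacuumTwoPoint φ z = ⟪N.fieldVector φ ε,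
      N.expH (-(Complex.I * z) + 2 * ε) (N.fieldVector φ ε)⟫_ℂ := by
  have hδ : 0 ≤ -z.im / 4 - ε := by linarith
  have hv : N.fieldVector φ (-z.im / 4)
      = N.expH (-((-z.im / 4 - ε : ℝ) : ℂ)) (N.fieldVector φ ε) := by
    rw [← N.fieldVector_add hε hδ]
    ring_nf
  have hre := re_neg_ofReal_nonpos hδ
  have h1 : (-(Complex.I * z) - ((z.im / 2 : ℝ) : ℂ)).re ≤ 0 := by
    simp only [Complex.sub_re, Complex.neg_re, Complex.mul_re, Complex.I_re, Complex.I_im,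
      Complex.ofReal_re]
    linarith
  rw [vacuumTwoPoint, hv, N.expH_apply_apply h1 hre, N.inner_expH_expH hre (by
    rw [Complex.add_re]; exact add_nonpos h1 hre)]
  congr 3
  simp only [map_neg, Complex.conj_ofReal]
  push_cast
  ring

theorem vacuumTwoPoint_eq_integral (φ : N.SmoothDual) {ε : ℝ} (hε : 0 < ε) {z : ℂ}
    (hz : 4 * ε ≤ -z.im) : N.vacuumTwoPoint φ z =
      ∫ e, expFn (-(Complex.I * z) + 2 * ε) e ∂N.energyMeasure (N.fieldVector φ ε) := by
  rw [N.vacuumTwoPoint_eq φ hε hz, expH, N.inner_energyFunction_self]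
  refine boundedOnSpectrum_expFn ?_
  simp
  linarith

theorem norm_vacuumTwoPoint_le (φ : N.SmoothDual) {z : ℂ} (hz : z.im < 0) :
    ‖N.vacuumTwoPoint φ z‖ ≤ ‖N.fieldVector φ (-z.im / 4)‖ ^ 2 := by
  have hε : 0 < -z.im / 4 := by linarith
  have h1 : (-(Complex.I * z) - ((z.im / 2 : ℝ) : ℂ)).re ≤ 0 := by
    simp only [Complex.sub_re, Complex.neg_re, Complex.mul_re, Complex.I_re, Complex.I_im,
      Complex.ofReal_re]
    linarith
  refine (norm_inner_le_norm _ _).trans ?_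
  rw [sq]
  gcongr
  refine (ContinuousLinearMap.le_opNorm _ _).trans ?_
  exact mul_le_of_le_one_left (norm_nonneg _) (N.norm_expH_le h1)

theorem differentiableOn_vacuumTwoPoint (φ : N.SmoothDual) :
    DifferentiableOn ℂ (N.vacuumTwoPoint φ) {z | z.im < 0} := by
  intro z hz
  have hz' : z.im < 0 := hz
  refine DifferentiableAt.differentiableWithinAt ?_
  -- Half of the largest admissible damping at z, so that it stays admissible in a neighbourhood of
  -- z. There the function is a Laplace transform of a finite measure on [0, ∞).
  set ε : ℝ := -z.im / 8 with hεdef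
  have hε : 0 < ε := by rw [hεdef]; linarith
  set μ := N.energyMeasure (N.fieldVector φ ε) with hμ
  have hev : N.vacuumTwoPoint φ =ᶠ[𝓝 z] fun z =>
      ProbabilityTheory.complexMGF id μ (-(Complex.I * z) + 2 * ε) := by
    have hopen : IsOpen {z : ℂ | z.im < -(4 * ε)} := isOpen_lt Complex.continuous_im
      continuous_const
    filter_upwards [hopen.mem_nhds (show z.im < -(4 * ε) by rw [hεdef]; linarith)] with w hw
    have hw' : w.im < -(4 * ε) := hw
    rw [N.vacuumTwoPoint_eq_integral φ hε (by linarith)]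
    rfl
  refine DifferentiableAt.congr_of_eventuallyEq ?_ hev
  have hset : Set.Iio (0 : ℝ) ⊆ interior (ProbabilityTheory.integrableExpSet id μ) := by
    refine interior_maximal (fun t ht => ?_) isOpen_Iio
    change Integrable (fun e : ℝ => Real.exp (t * e)) μ
    refine Integrable.of_bound (Measurable.aestronglyMeasurable (by fun_prop)) 1 ?_
    filter_upwards [N.energyMeasure_ae_nonneg (N.fieldVector φ ε)] with e he
    rw [Real.norm_of_nonneg (Real.exp_pos _).le, Real.exp_le_one_iff]
    exact mul_nonpos_of_nonpos_of_nonneg (le_of_lt ht) he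
  have hre : (-(Complex.I * z) + 2 * (ε : ℂ)).re = z.im + 2 * ε := by simp
  have hd := (ProbabilityTheory.hasDerivAt_complexMGF (X := id) (μ := μ)
    (z := -(Complex.I * z) + 2 * ε) (hset (by
      rw [hre, Set.mem_Iio, hεdef]; linarith))).differentiableAt
  exact hd.comp z (f := fun z : ℂ => -(Complex.I * z) + 2 * (ε : ℂ)) (by fun_prop)

/-- The vector `exp (i a H) φ Ω`, for `Im a > 0`. -/
def translatedFieldVector (φ : N.SmoothDual) (a : ℂ) : H :=
  N.expH (Complex.I * a + (a.im / 2 : ℝ)) (N.fieldVector φ (a.im / 2))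

theorem translatedFieldVector_eq (φ : N.SmoothDual) {a : ℂ} {ε : ℝ} (hε : 0 < ε)
    (ha : 2 * ε ≤ a.im) :
    N.translatedFieldVector φ a = N.expH (Complex.I * a + ε) (N.fieldVector φ ε) := by
  have hδ : 0 ≤ a.im / 2 - ε := by linarith
  have hv : N.fieldVector φ (a.im / 2)
      = N.expH (-((a.im / 2 - ε : ℝ) : ℂ)) (N.fieldVector φ ε) := by
    rw [← N.fieldVector_add hε hδ]
    ring_nf
  rw [translatedFieldVector, hv, N.expH_apply_apply (by simp; linarith) (re_neg_ofReal_nonpos hδ)]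
  congr 2
  push_cast
  ring

/-- With a damping common to both vectors, the two exponentials combine into one whose exponent
depends on a and b only through ā - b. This Gram form is the source of positive definiteness. -/
theorem vacuumTwoPoint_eq_inner (φ : N.SmoothDual) {a b : ℂ} (ha : 0 < a.im) (hb : 0 < b.im) :
    N.vacuumTwoPoint φ (conj a - b)
      = ⟪N.translatedFieldVector φ a, N.translatedFieldVector φ b⟫_ℂ := by
  set ε : ℝ := min a.im b.im / 4 with hεdef
  have hab : 0 < min a.im b.im := lt_min ha hb
  have hε : 0 < ε := by positivity
  have h1 := min_le_left a.im b.im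
  have h2 := min_le_right a.im b.im
  rw [N.translatedFieldVector_eq φ hε (by linarith), N.translatedFieldVector_eq φ hε (by linarith),
    N.inner_expH_expH (by simp; linarith) (by simp; linarith), N.vacuumTwoPoint_eq φ hε (by
      simp; linarith)]
  congr 3
  simp only [map_add, map_mul, Complex.conj_I, Complex.conj_ofReal]
  ring

theorem translatedFieldVector_I_mul (φ : N.SmoothDual) {ε : ℝ} (hε : 0 < ε) :
    N.translatedFieldVector φ (Complex.I * ε) = N.fieldVector φ ε := by
  have h1 : (Complex.I * (ε : ℂ)).im = ε := by simp
  have h2 : N.fieldVector φ ε = N.expH (-((ε / 2 : ℝ) : ℂ)) (N.fieldVector φ (ε / 2)) := by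
    rw [← N.fieldVector_add (by positivity) (by positivity), add_halves]
  rw [translatedFieldVector, h1, h2]
  congr 2
  rw [← mul_assoc, Complex.I_mul_I]
  push_cast
  ring

/-! ### Continuity of fields -/

/-- One resolvent turns a symbol that is small only relative to the energy into an operator of small
norm, as e/(1 + e) ≤ 1. -/
theorem norm_R_one_mul_energyFunction_le {b : ℝ → ℂ} (hb : BoundedOnSpectrum b) {δ : ℝ}
    (hδ : ∀ e, 0 ≤ e → ‖b e‖ ≤ δ * e) (hδ0 : 0 ≤ δ) : ‖N.R 1 * N.energyFunction b‖ ≤ δ := by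
  have hR := boundedOnSpectrum_resolvent zero_le_one
  rw [R, N.energyFunction_mul hR hb]
  refine N.norm_energyFunction_le (hR.mul hb) fun e he => ?_
  rw [norm_mul, Complex.norm_real, Real.norm_of_nonneg (by positivity), Real.rpow_neg_one,
    inv_mul_le_iff₀ (by positivity)]
  have := hδ e he
  nlinarith

/-- Passing from order n to n + 1 leaves a spare resolvent on each side to control `B` and `C`. -/
theorem norm_R_succ_mul_le {n : ℕ} (B A C : H →L[ℂ] H)
    (hC : C * N.R n = N.R n * C) (hB : B * N.R n = N.R n * B) :
    ‖N.R ((n + 1 : ℕ) : ℝ) * (B * A * C) * N.R ((n + 1 : ℕ) : ℝ)‖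
      ≤ ‖N.R 1 * B‖ * ‖N.R n * A * N.R n‖ * ‖C * N.R 1‖ := by
  have e1 : N.R ((n + 1 : ℕ) : ℝ) = N.R 1 * N.R n := by
    rw [N.R_mul zero_le_one (Nat.cast_nonneg n)]
    push_cast
    ring_nf
  have e2 : N.R ((n + 1 : ℕ) : ℝ) = N.R n * N.R 1 := by
    rw [N.R_mul (Nat.cast_nonneg n) zero_le_one]
    push_cast
    ring_nf
  have e3 : N.R ((n + 1 : ℕ) : ℝ) * (B * A * C) * N.R ((n + 1 : ℕ) : ℝ)
      = (N.R 1 * B) * (N.R n * A * N.R n) * (C * N.R 1) := by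
    nth_rewrite 1 [e1]
    nth_rewrite 1 [e2]
    calc N.R 1 * N.R n * (B * A * C) * (N.R n * N.R 1)
        = N.R 1 * (N.R n * B) * A * (C * N.R n) * N.R 1 := by simp only [mul_assoc]
      _ = _ := by rw [← hB, hC]; simp only [mul_assoc]
  rw [e3]
  refine (norm_mul_le _ _).trans ?_
  gcongr
  exact norm_mul_le _ _

theorem energyFunction_commute_R {b : ℝ → ℂ} (hb : BoundedOnSpectrum b) (n : ℕ) :
    N.energyFunction b * N.R n = N.R n * N.energyFunction b := by
  have hR := boundedOnSpectrum_resolvent (Nat.cast_nonneg (α := ℝ) n)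
  rw [R, N.energyFunction_mul hR hb, N.energyFunction_mul hb hR]
  simp only [mul_comm]

/-- Replacing χ by e^{-εH}χ changes σ by O(ε) in the norm of order n, at the price of its norm of
order n + 1. On the damped functional φ takes the value ⟨χ, e^{-εH}φΩ⟩ = 0. -/
theorem eq_zero_of_forall_fieldVector_eq_zero {φ : N.SmoothDual}
    (h : ∀ ε, 0 < ε → N.fieldVector φ ε = 0) (χ : H) (σ : N.Smooth)
    (hσ : ∀ A : H →L[ℂ] H, σ A = ⟪χ, A N.Ω⟫_ℂ) : φ σ = 0 := by
  obtain ⟨n, hn, C, hC0, hC⟩ := N.exists_dual_bound φ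
  have hσ' : ∀ A : H →L[ℂ] H, σ.1 A = ⟪χ, A N.Ω⟫_ℂ := hσ
  have hn1 : (0 : ℝ) < ((n + 1 : ℕ) : ℝ) := by positivity
  have hbound : ∀ ε, 0 < ε → ‖φ σ‖ ≤ C * N.energyNorm ((n + 1 : ℕ) : ℝ) σ * ε := by
    intro ε hε
    have hre := re_neg_ofReal_nonpos hε.le
    set τ := N.dampedFunctional ε hε χ N.Ω with hτ
    have h0 : φ τ = 0 := by
      rw [hτ, ← N.inner_damped hε]
      change ⟪χ, N.fieldVector φ ε⟫_ℂ = 0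
      rw [h ε hε, inner_zero_right]
    have hφ : φ σ = φ (σ - τ) := by rw [map_sub, h0, sub_zero]
    rw [hφ, mul_assoc]
    refine (hC _).trans (mul_le_mul_of_nonneg_left (N.energyNorm_le ⟨?_, fun A => ?_⟩) hC0)
    · exact mul_nonneg (N.energyNorm_nonneg hn1 σ) hε.le
    set b : ℝ → ℂ := fun e => 1 - expFn (-(ε : ℂ)) e with hbdef
    have hb : BoundedOnSpectrum b := (boundedOnSpectrum_const 1).sub (boundedOnSpectrum_expFn hre)
    have hbB : N.energyFunction b = 1 - N.expH (-(ε : ℂ)) := by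
      rw [hbdef, N.energyFunction_sub (boundedOnSpectrum_const 1) (boundedOnSpectrum_expFn hre),
        energyFunction_one, expH]
    have hval : (σ - τ).1 A = σ.1 (N.energyFunction b * A * 1) := by
      rw [Smooth.sub_apply, hτ, dampedFunctional_apply, N.expH_vacuum hre, mul_one, hbB, sub_mul,
        one_mul, map_sub]
      congr 1
      rw [hσ', clm_mul_app, N.inner_expH_left hre]
      simp
    have hbδ : ∀ e, 0 ≤ e → ‖b e‖ ≤ ε * e := by
      intro e he
      have h1 : b e = ((1 - Real.exp (-(ε * e)) : ℝ) : ℂ) := by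
        rw [hbdef]
        simp [expFn]
      have h2 := Real.add_one_le_exp (-(ε * e))
      have h3 : Real.exp (-(ε * e)) ≤ 1 := Real.exp_le_one_iff.mpr (by nlinarith)
      rw [h1, Complex.norm_real, Real.norm_of_nonneg (by linarith)]
      linarith
    rw [hval]
    refine ((N.energyBound_energyNorm hn1 σ).2 _).trans ?_
    rw [mul_assoc (N.energyNorm _ σ)]
    refine mul_le_mul_of_nonneg_left ?_ (N.energyNorm_nonneg hn1 σ)
    refine (N.norm_R_succ_mul_le _ A 1 (by simp) (N.energyFunction_commute_R hb n)).trans ?_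
    rw [one_mul]
    calc ‖N.R 1 * N.energyFunction b‖ * ‖N.R n * A * N.R n‖ * ‖N.R 1‖
        ≤ ε * ‖N.R n * A * N.R n‖ * 1 := by
          gcongr
          · exact N.norm_R_one_mul_energyFunction_le hb hbδ hε.le
          · exact N.norm_R_le zero_le_one
      _ = _ := by ring
  have hlim : Filter.Tendsto (fun ε : ℝ => C * N.energyNorm ((n + 1 : ℕ) : ℝ) σ * ε) (𝓝[>] 0)
      (𝓝 (C * N.energyNorm ((n + 1 : ℕ) : ℝ) σ * 0)) :=
    (Filter.tendsto_id.mono_left nhdsWithin_le_nhds).const_mul _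
  rw [mul_zero] at hlim
  exact norm_le_zero_iff.mp (ge_of_tendsto hlim (by
    filter_upwards [self_mem_nhdsWithin] with ε hε using hbound ε hε))

/-- The map is even Lipschitz: R(U(t) - U(t')) has norm at most |t - t'|, so a φ of order n needs
one more power of the energy from σ. -/
theorem continuous_translate (φ : N.SmoothDual) (σ : N.Smooth) :
    Continuous fun t => φ (N.translate t σ) := by
  obtain ⟨n, hn, C, hC0, hC⟩ := N.exists_dual_bound φ
  have hn1 : (0 : ℝ) < ((n + 1 : ℕ) : ℝ) := by positivity
  set M := N.energyNorm ((n + 1 : ℕ) : ℝ) σ with hM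
  have hM0 : 0 ≤ M := N.energyNorm_nonneg hn1 σ
  suffices h : ∀ t t', ‖φ (N.translate t σ) - φ (N.translate t' σ)‖ ≤ C * M * 2 * |t - t'| by
    refine (LipschitzWith.of_dist_le_mul (K := ⟨C * M * 2, by positivity⟩) fun t t' => ?_).continuous
    rw [dist_eq_norm, Real.dist_eq]
    exact h t t'
  intro t t'
  rw [← map_sub]
  refine (hC _).trans ?_
  rw [mul_assoc, mul_assoc]
  refine mul_le_mul_of_nonneg_left (N.energyNorm_le ⟨by positivity, fun A => ?_⟩) hC0
  have hbs : ∀ {p q r : ℝ}, BoundedOnSpectrum fun e => wave p e - wave q e := fun {p q r} =>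
    (boundedOnSpectrum_wave p).sub (boundedOnSpectrum_wave q)
  have hd : ∀ p q : ℝ, ∀ e, 0 ≤ e → ‖wave p e - wave q e‖ ≤ |p - q| * e := by
    intro p q e he
    have h1 : wave p e - wave q e = wave q e * (wave (p - q) e - 1) := by
      rw [mul_sub, wave_mul, add_sub_cancel, mul_one]
    rw [h1, norm_mul, norm_wave, one_mul, wave]
    refine (Real.norm_exp_I_mul_ofReal_sub_one_le).trans ?_
    rw [Real.norm_eq_abs, abs_mul, abs_of_nonneg he]
  have hU : ∀ p q : ℝ, N.timeU p - N.timeU q = N.energyFunction fun e => wave p e - wave q e := by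
    intro p q
    rw [N.energyFunction_sub (boundedOnSpectrum_wave p) (boundedOnSpectrum_wave q),
      energyFunction_wave, energyFunction_wave]
  have hstar : ∀ p, star (N.timeU p) = N.timeU (-p) := by
    intro p
    calc star (N.timeU p) = star (N.timeU p) * (N.timeU p * N.timeU (-p)) := by
          rw [timeU_mul, add_neg_cancel, timeU_zero, mul_one]
      _ = _ := by rw [← mul_assoc, timeU_star_mul, one_mul]
  have hR : ∀ p q : ℝ, ‖N.R 1 * (N.timeU p - N.timeU q)‖ ≤ |p - q| := fun p q => by
    rw [hU]
    exact N.norm_R_one_mul_energyFunction_le (hbs (r := 0)) (hd p q) (abs_nonneg _)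
  have hcomm : ∀ p : ℝ, ∀ n : ℕ, N.timeU p * N.R n = N.R n * N.timeU p := fun p n =>
    N.timeU_commute_energyFunction p _
  have hcomm1 : ∀ p : ℝ, N.timeU p * N.R 1 = N.R 1 * N.timeU p := fun p =>
    N.timeU_commute_energyFunction p _
  have hRU : ∀ p, ‖N.R 1 * N.timeU p‖ ≤ 1 := fun p => by
    have hp : N.timeU p ∈ unitary (H →L[ℂ] H) := (N.U _ _).2
    rw [CStarRing.norm_mul_mem_unitary _ hp]
    exact N.norm_R_le zero_le_one
  have hval : (N.translate t σ - N.translate t' σ).1 A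
      = σ.1 ((N.timeU t - N.timeU t') * A * N.timeU (-t))
        + σ.1 (N.timeU t' * A * (N.timeU (-t) - N.timeU (-t'))) := by
    rw [Smooth.sub_apply, ← map_add]
    change conjFunctional (N.timeU t) σ.1 A - conjFunctional (N.timeU t') σ.1 A = _
    rw [conjFunctional_apply, conjFunctional_apply, hstar, hstar, ← map_sub]
    congr 1
    noncomm_ring
  have hσ := (N.energyBound_energyNorm hn1 σ).2
  rw [hval]
  have hcs : ∀ p q : ℝ, (N.timeU p - N.timeU q) * N.R n = N.R n * (N.timeU p - N.timeU q) :=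
    fun p q => by rw [sub_mul, mul_sub, hcomm, hcomm]
  have hcs1 : ∀ p q : ℝ, (N.timeU p - N.timeU q) * N.R 1 = N.R 1 * (N.timeU p - N.timeU q) :=
    fun p q => by rw [sub_mul, mul_sub, hcomm1, hcomm1]
  have h1 : ‖σ.1 ((N.timeU t - N.timeU t') * A * N.timeU (-t))‖
      ≤ M * (|t - t'| * ‖N.R n * A * N.R n‖ * 1) := by
    refine (hσ _).trans (mul_le_mul_of_nonneg_left ?_ hM0)
    refine (N.norm_R_succ_mul_le _ A _ (hcomm _ n) (hcs _ _)).trans ?_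
    rw [hcomm1]
    gcongr
    · exact hR t t'
    · exact hRU _
  have h2 : ‖σ.1 (N.timeU t' * A * (N.timeU (-t) - N.timeU (-t')))‖
      ≤ M * (1 * ‖N.R n * A * N.R n‖ * |t - t'|) := by
    refine (hσ _).trans (mul_le_mul_of_nonneg_left ?_ hM0)
    refine (N.norm_R_succ_mul_le _ A _ (hcs _ _) (hcomm _ n)).trans ?_
    rw [hcs1]
    gcongr
    · exact hRU _
    · refine (hR _ _).trans_eq ?_
      rw [abs_sub_comm]
      ring_nf
  refine (norm_add_le _ _).trans ((add_le_add h1 h2).trans_eq ?_)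
  ring

/-- If the vacuum is separating for the smeared fields, a field with `e^{-εH} φ Ω = 0` for all
`ε > 0` vanishes. -/
theorem field_eq_zero_of_fieldVector_eq_zero (hsep : N.VacuumSeparating) {φ : N.SmoothDual}
    (hφ : φ ∈ N.Fields) (h : ∀ ε, 0 < ε → N.fieldVector φ ε = 0) : φ = 0 := by
  have hsmear : ∀ (f : Test) (σ : N.Smooth), N.smear φ f σ = 0 := by
    intro f
    refine hsep φ hφ f fun χ σ hσ => ?_
    have hσ' : ∀ A : H →L[ℂ] H, σ.1 A = ⟪χ, A N.Ω⟫_ℂ := hσ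
    -- Since U(t)*Ω = Ω, the translated functional is ⟨U(t)*χ, · Ω⟩, again of the form to which the
    -- vanishing lemma applies.
    have hzero : ∀ t, φ (N.translate t σ) = 0 := by
      intro t
      refine N.eq_zero_of_forall_fieldVector_eq_zero h (star (N.timeU t) χ) _ fun A => ?_
      change conjFunctional (N.timeU t) σ.1 A = _
      have hΩ : star (N.timeU t) N.Ω = N.Ω := by
        have h1 : N.timeU t N.Ω = N.Ω := N.U_vacuum _ _
        nth_rewrite 1 [← h1]
        rw [← clm_mul_app, timeU_star_mul]
        rfl
      rw [conjFunctional_apply, hσ', clm_mul_app, clm_mul_app, hΩ,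
        ContinuousLinearMap.star_eq_adjoint, ContinuousLinearMap.adjoint_inner_left]
    simp [smear, hzero]
  refine DFunLike.ext _ _ fun σ => ?_
  have hcont := N.continuous_translate φ σ
  -- A continuous function orthogonal to all test functions vanishes; its value at t = 0 is φ(σ).
  have hae : ∀ᵐ t : ℝ, φ (N.translate t σ) = 0 := by
    refine ae_eq_zero_of_integral_contDiff_smul_eq_zero hcont.locallyIntegrable fun g hg hgc => ?_
    let f : Test := ⟨fun x => (g x : ℂ), Complex.ofRealCLM.contDiff.comp hg,
      hgc.comp_left (g := fun x : ℝ => (x : ℂ)) Complex.ofReal_zero, by simp⟩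
    have : ∫ t : ℝ, (g t : ℂ) * φ (N.translate t σ) = 0 := hsmear f σ
    simpa using this
  have hall := Continuous.ae_eq_iff_eq (μ := volume) hcont continuous_const |>.mp hae
  have h0 := congrFun hall 0
  have htr : N.translate 0 σ = σ := Smooth.ext fun A => by
    change conjFunctional (N.timeU 0) σ.1 A = _
    rw [conjFunctional_apply, timeU_zero]
    simp
  rw [htr] at h0
  exact h0

end LocalNet

/-! ### Gaussians as Schwartz functions -/

/-- The Gaussian `x ↦ exp (-b (x - a)²)` with complex centre `a`. -/
def gaussian (b : ℝ) (a : ℂ) (x : ℝ) : ℂ := Complex.exp (-(b : ℂ) * ((x : ℂ) - a) ^ 2)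

theorem norm_gaussian (b : ℝ) (a : ℂ) (x : ℝ) :
    ‖gaussian b a x‖ = Real.exp (b * a.im ^ 2) * Real.exp (-b * (x - a.re) ^ 2) := by
  rw [gaussian, Complex.norm_exp, ← Real.exp_add]
  congr 1
  simp [sq, Complex.mul_re]
  ring

theorem contDiff_gaussian (b : ℝ) (a : ℂ) {n : WithTop ℕ∞} : ContDiff ℝ n (gaussian b a) := by
  unfold gaussian
  have : ContDiff ℝ n fun x : ℝ => (x : ℂ) := Complex.ofRealCLM.contDiff
  fun_prop

theorem hasDerivAt_gaussian (b : ℝ) (a : ℂ) (x : ℝ) :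
    HasDerivAt (gaussian b a) (-2 * b * ((x : ℂ) - a) * gaussian b a x) x := by
  have h1 : HasDerivAt (fun y : ℝ => (y : ℂ)) 1 x := Complex.ofRealCLM.hasDerivAt
  have h2 := (((h1.sub_const a).pow 2).const_mul (-(b : ℂ))).cexp
  have h3 : HasDerivAt (gaussian b a) _ x := h2
  refine h3.congr_deriv ?_
  simp [gaussian]
  ring

theorem exists_iteratedDeriv_gaussian (b : ℝ) (a : ℂ) (n : ℕ) : ∃ p : Polynomial ℂ,
    iteratedDeriv n (gaussian b a) = fun x : ℝ => p.eval (x : ℂ) * gaussian b a x := by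
  induction n with
  | zero => exact ⟨1, by simp [iteratedDeriv_zero]⟩
  | succ n ih =>
    obtain ⟨p, hp⟩ := ih
    refine ⟨p.derivative + p * (Polynomial.C (-2 * (b : ℂ)) * (Polynomial.X - Polynomial.C a)), ?_⟩
    rw [iteratedDeriv_succ, hp]
    funext x
    have h1 : HasDerivAt (fun y : ℝ => p.eval (y : ℂ)) (p.derivative.eval (x : ℂ)) x :=
      (p.hasDerivAt (x : ℂ)).comp_ofReal
    rw [(h1.fun_mul (hasDerivAt_gaussian b a x)).deriv]
    simp
    ring

/-- The constant combines |x|ᵏ ≤ k! e^{|x|} with u - bu² ≤ 1/(4b) for u = |x - Re a|. -/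
theorem exists_pow_mul_gaussian_le {b : ℝ} (hb : 0 < b) (a : ℂ) (k : ℕ) :
    ∃ C : ℝ, ∀ x : ℝ, |x| ^ k * ‖gaussian b a x‖ ≤ C := by
  refine ⟨Real.exp (b * a.im ^ 2) * (k.factorial * Real.exp (|a.re| + 1 / (4 * b))), fun x => ?_⟩
  have h1 := Real.pow_div_factorial_le_exp |x| (abs_nonneg x) k
  rw [div_le_iff₀ (by positivity)] at h1
  have h2 : |x| + -b * (x - a.re) ^ 2 ≤ |a.re| + 1 / (4 * b) := by
    have h3 : |x| ≤ |x - a.re| + |a.re| := by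
      simpa using abs_add_le (x - a.re) a.re
    have h4 : |x - a.re| - b * |x - a.re| ^ 2 ≤ 1 / (4 * b) := by
      rw [le_div_iff₀ (by positivity)]
      nlinarith [sq_nonneg (2 * b * |x - a.re| - 1)]
    rw [sq_abs] at h4
    linarith
  rw [norm_gaussian]
  calc |x| ^ k * (Real.exp (b * a.im ^ 2) * Real.exp (-b * (x - a.re) ^ 2))
      = Real.exp (b * a.im ^ 2) * (|x| ^ k * Real.exp (-b * (x - a.re) ^ 2)) := by ring
    _ ≤ Real.exp (b * a.im ^ 2) *
        ((Real.exp |x| * k.factorial) * Real.exp (-b * (x - a.re) ^ 2)) := by gcongr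
    _ = Real.exp (b * a.im ^ 2) * (k.factorial * Real.exp (|x| + -b * (x - a.re) ^ 2)) := by
        rw [Real.exp_add]; ring
    _ ≤ _ := by gcongr

/-- The Gaussian `x ↦ exp (-b (x - a)²)` as a Schwartz function. -/
def gaussianSchwartz (b : ℝ) (hb : 0 < b) (a : ℂ) : 𝓢(ℝ, ℂ) where
  toFun := gaussian b a
  smooth' := contDiff_gaussian b a
  decay' := by
    intro k n
    obtain ⟨p, hp⟩ := exists_iteratedDeriv_gaussian b a n
    choose C hC using fun k => exists_pow_mul_gaussian_le hb a k
    refine ⟨∑ i ∈ Finset.range (p.natDegree + 1), ‖p.coeff i‖ * C (k + i), fun x => ?_⟩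
    rw [norm_iteratedFDeriv_eq_norm_iteratedDeriv, hp, norm_mul, Polynomial.eval_eq_sum_range,
      Real.norm_eq_abs]
    calc |x| ^ k * (‖∑ i ∈ Finset.range (p.natDegree + 1), p.coeff i * (x : ℂ) ^ i‖ *
          ‖gaussian b a x‖)
        ≤ |x| ^ k * ((∑ i ∈ Finset.range (p.natDegree + 1), ‖p.coeff i‖ * |x| ^ i) *
          ‖gaussian b a x‖) := by
          gcongr
          refine (norm_sum_le _ _).trans_eq (Finset.sum_congr rfl fun i _ => ?_)
          rw [norm_mul, norm_pow, Complex.norm_real, Real.norm_eq_abs]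
      _ = ∑ i ∈ Finset.range (p.natDegree + 1),
          ‖p.coeff i‖ * (|x| ^ (k + i) * ‖gaussian b a x‖) := by
          rw [Finset.sum_mul, Finset.mul_sum]
          refine Finset.sum_congr rfl fun i _ => ?_
          rw [pow_add]
          ring
      _ ≤ _ := by
          gcongr with i _
          exact hC _ x

theorem integrable_gaussian {b : ℝ} (hb : 0 < b) (a : ℂ) : Integrable (gaussian b a) :=
  (gaussianSchwartz b hb a).integrable

/-- The correlation of two Gaussians is a Gaussian. -/
theorem conj_gaussian_mul_gaussian (b : ℝ) (a a' : ℂ) (x t : ℝ) :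
    conj (gaussian b a (t + x / 2)) * gaussian b a' (t - x / 2)
      = gaussian (b / 2) (conj a - a') x * gaussian (2 * b) ((conj a + a') / 2) t := by
  simp only [gaussian, ← Complex.exp_conj, ← Complex.exp_add]
  congr 1
  simp only [map_mul, map_neg, map_pow, map_sub, Complex.conj_ofReal]
  push_cast
  ring

theorem integral_gaussian' {b : ℝ} (hb : 0 < b) (a : ℂ) :
    ∫ x, gaussian b a x = ((Real.sqrt (Real.pi / b) : ℝ) : ℂ) := by
  have h := integral_cexp_quadratic (b := -(b : ℂ)) (by simpa using hb) (2 * b * a) (-b * a ^ 2)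
  have h1 : (fun x : ℝ => Complex.exp (-(b : ℂ) * (x : ℂ) ^ 2 + 2 * b * a * x + -b * a ^ 2))
      = gaussian b a := by
    funext x
    rw [gaussian]
    congr 1
    ring
  have hb' : (b : ℂ) ≠ 0 := Complex.ofReal_ne_zero.mpr hb.ne'
  rw [h1] at h
  rw [h]
  have h2 : -(b : ℂ) * a ^ 2 - (2 * b * a) ^ 2 / (4 * -(b : ℂ)) = 0 := by
    field_simp
    ring
  rw [h2, Complex.exp_zero, mul_one, neg_neg, ← Complex.ofReal_div, Real.sqrt_eq_rpow,
    Complex.ofReal_cpow (by positivity)]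
  push_cast
  rfl

theorem integrable_conj_gaussian_mul_gaussian {b : ℝ} (hb : 0 < b) (a a' : ℂ) (x : ℝ) :
    Integrable fun t : ℝ => conj (gaussian b a (t + x / 2)) * gaussian b a' (t - x / 2) := by
  simp only [conj_gaussian_mul_gaussian]
  exact (integrable_gaussian (by positivity) _).const_mul _

theorem integral_conj_gaussian_mul_gaussian {b : ℝ} (hb : 0 < b) (a a' : ℂ) (x : ℝ) :
    ∫ t : ℝ, conj (gaussian b a (t + x / 2)) * gaussian b a' (t - x / 2)
      = ((Real.sqrt (Real.pi / (2 * b)) : ℝ) : ℂ) * gaussian (b / 2) (conj a - a') x := by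
  simp only [conj_gaussian_mul_gaussian]
  rw [integral_const_mul, integral_gaussian' (by positivity), mul_comm]

/-! ### Contour shifts -/

/-- Shift of the line of integration in the lower half plane, for an analytic function with
Gaussian decay. -/
theorem integral_shift_eq {F : ℂ → ℂ} (hF : DifferentiableOn ℂ F {z | z.im < 0}) {y η : ℝ}
    (hy : 0 < y) (hη : y ≤ η) {M b r : ℝ} (hb : 0 < b)
    (hbound : ∀ x t : ℝ, t ∈ Set.Icc y η →
      ‖F (x - t * Complex.I)‖ ≤ M * Real.exp (-b * (x - r) ^ 2)) :
    ∫ x : ℝ, F (x - y * Complex.I) = ∫ x : ℝ, F (x - η * Complex.I) := by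
  have hint : ∀ t ∈ Set.Icc y η, Integrable fun x : ℝ => F (x - t * Complex.I) := by
    intro t ht
    have ht0 : 0 < t := hy.trans_le ht.1
    have hcont : Continuous fun x : ℝ => F (x - t * Complex.I) :=
      hF.continuousOn.comp_continuous (by fun_prop) fun x => by simpa using ht0
    refine Integrable.mono' (((integrable_exp_neg_mul_sq hb).comp_sub_right r).const_mul M)
      hcont.aestronglyMeasurable (Filter.Eventually.of_forall fun x => hbound x t ht)
  have hrect : ∀ T : ℝ, (∫ x in (-T)..T, F (x - η * Complex.I))
      - (∫ x in (-T)..T, F (x - y * Complex.I))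
      + Complex.I • (∫ t in (-η)..(-y), F (T + t * Complex.I))
      - Complex.I • (∫ t in (-η)..(-y), F (-T + t * Complex.I)) = 0 := by
    intro T
    have h := Complex.integral_boundary_rect_eq_zero_of_differentiableOn F
      (⟨-T, -η⟩ : ℂ) (⟨T, -y⟩ : ℂ) (hF.mono fun w hw => by
        have h1 := hw.2
        simp only [Set.mem_preimage] at h1
        rw [Set.uIcc_of_le (by linarith)] at h1
        exact h1.2.trans_lt (by linarith))
    simp only [Complex.ofReal_neg, neg_mul, ← sub_eq_add_neg] at h
    exact h
  -- Both vertical sides of the rectangle are treated at once; the Gaussian bound makes their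
  -- contribution vanish as T → ∞.
  have hvert : ∀ u : ℝ → ℝ, (∀ T, u T = T ∨ u T = -T) →
      Filter.Tendsto (fun T : ℝ => ∫ t in (-η)..(-y), F (u T + t * Complex.I)) Filter.atTop
        (𝓝 0) := by
    intro u hu
    have hle : ∀ T : ℝ, ‖∫ t in (-η)..(-y), F (u T + t * Complex.I)‖
        ≤ M * Real.exp (-b * (u T - r) ^ 2) * |-y - -η| := by
      intro T
      refine intervalIntegral.norm_integral_le_of_norm_le_const fun t ht => ?_
      rw [Set.uIoc_of_le (by linarith)] at ht
      have := hbound (u T) (-t) ⟨by linarith [ht.2], by linarith [ht.1]⟩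
      simpa using this
    refine squeeze_zero_norm hle ?_
    have h1 : Filter.Tendsto (fun T : ℝ => (u T - r) ^ 2) Filter.atTop Filter.atTop := by
      refine Filter.tendsto_atTop_mono' _ (f₁ := fun T : ℝ => T - |r|) ?_
        (Filter.tendsto_atTop_add_const_right _ _ Filter.tendsto_id)
      filter_upwards [Filter.eventually_ge_atTop (1 + |r|)] with T hT
      have hr1 := le_abs_self r
      have hr2 := neg_abs_le r
      have h0 : 1 ≤ T - |r| := by linarith
      rcases hu T with h | h <;> rw [h] <;> nlinarith
    have h2 : Filter.Tendsto (fun T : ℝ => Real.exp (-b * (u T - r) ^ 2)) Filter.atTop (𝓝 0) :=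
      Real.tendsto_exp_atBot.comp (h1.const_mul_atTop_of_neg (by linarith))
    have h3 := (h2.const_mul M).mul_const |-y - -η|
    rw [mul_zero, zero_mul] at h3
    exact h3
  have hlim : ∀ t ∈ Set.Icc y η, Filter.Tendsto
      (fun T : ℝ => ∫ x in (-T)..T, F (x - t * Complex.I)) Filter.atTop
      (𝓝 (∫ x : ℝ, F (x - t * Complex.I))) := fun t ht =>
    intervalIntegral_tendsto_integral (hint t ht) Filter.tendsto_neg_atTop_atBot Filter.tendsto_id
  have htot := (((hlim η ⟨hη, le_rfl⟩).sub (hlim y ⟨le_rfl, hη⟩)).add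
    ((hvert (fun T => T) fun T => Or.inl rfl).const_smul Complex.I)).sub
    ((hvert (fun T => -T) fun T => Or.inr rfl).const_smul Complex.I)
  simp only [Complex.ofReal_neg, hrect, smul_zero, add_zero, sub_zero] at htot
  exact (sub_eq_zero.mp (tendsto_nhds_unique htot tendsto_const_nhds)).symm

theorem RegularAtBoundary.exists_bound {F : ℂ → ℂ} (hF : RegularAtBoundary F) {y : ℝ}
    (hy : 0 < y) : ∃ B : ℝ, 0 ≤ B ∧ ∀ z : ℂ, -1 ≤ z.im → z.im ≤ -y → ‖F z‖ ≤ B := by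
  obtain ⟨-, -, ℓ, hℓ, C, hC⟩ := hF
  refine ⟨max C 0 / y ^ ℓ, by positivity, fun z h1 h2 => ?_⟩
  rw [le_div_iff₀ (by positivity)]
  refine le_trans ?_ ((hC z h1 (by linarith)).trans (le_max_left _ _))
  gcongr
  rw [abs_of_neg (by linarith)]
  linarith

/-- The boundary value of `F` evaluated at a Gaussian whose centre has imaginary part `-η` is an
integral along the line `Im z = -η`. -/
theorem hasBoundaryValue_gaussian {F : ℂ → ℂ} (hF : RegularAtBoundary F) {b : ℝ} (hb : 0 < b)
    {τ : ℂ} (hτ : τ.im < 0) (hτ1 : -1 < τ.im) :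
    HasBoundaryValue F (gaussian b τ) (∫ x : ℝ, gaussian b τ.re x * F (x + τ.im * Complex.I)) := by
  set η : ℝ := -τ.im with hη
  have hη0 : 0 < η := by rw [hη]; linarith
  have hτe : τ = (τ.re : ℂ) - η * Complex.I := by
    rw [hη]
    push_cast
    rw [neg_mul, sub_neg_eq_add, Complex.re_add_im]
  have hτi : ((τ.im : ℝ) : ℂ) = -(η : ℂ) := by rw [hη]; push_cast; ring
  have hbnd : ∀ (x v : ℝ), |v| ≤ 1 → ‖Complex.exp (-(b : ℂ) * ((x : ℂ) - τ.re + v * Complex.I) ^ 2)‖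
      ≤ Real.exp b * Real.exp (-b * (x - τ.re) ^ 2) := by
    intro x v hv
    have h1 := norm_gaussian b (τ.re - v * Complex.I) x
    rw [gaussian] at h1
    have h2 : (x : ℂ) - (τ.re - v * Complex.I) = (x : ℂ) - τ.re + v * Complex.I := by ring
    rw [h2] at h1
    rw [h1]
    simp only [Complex.sub_im, Complex.ofReal_im, Complex.mul_im, Complex.ofReal_re, Complex.I_im,
      mul_one, Complex.I_re, mul_zero, add_zero, zero_sub, Complex.sub_re, Complex.mul_re, sub_zero]
    gcongr
    have : (-v) ^ 2 ≤ 1 := by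
      rw [neg_sq, ← sq_abs]
      exact pow_le_one₀ (abs_nonneg v) hv
    nlinarith
  -- With w = x - iy the Gaussian becomes an entire function of w. Moving the contour down to Im w =
  -- -η takes `F` to a fixed line away from the boundary, where the limit y → 0 concerns the
  -- Gaussian alone.
  have hshift : ∀ y : ℝ, 0 < y → y ≤ η → ∫ x : ℝ, gaussian b τ x * F (x - y * Complex.I)
      = ∫ x : ℝ, Complex.exp (-(b : ℂ) * ((x : ℂ) - τ.re + y * Complex.I) ^ 2) *
        F (x - η * Complex.I) := by
    intro y hy hyη
    obtain ⟨B, hB0, hB⟩ := hF.exists_bound hy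
    have h := integral_shift_eq
      (F := fun w => Complex.exp (-(b : ℂ) * (w + y * Complex.I - τ) ^ 2) * F w)
      ((by fun_prop : DifferentiableOn ℂ
        (fun w => Complex.exp (-(b : ℂ) * (w + y * Complex.I - τ) ^ 2)) _).mul hF.1)
      hy hyη hb (M := Real.exp b * B) (r := τ.re) fun x t ht => by
        rw [norm_mul]
        have h1 : (x : ℂ) - t * Complex.I + y * Complex.I - τ
            = (x : ℂ) - τ.re + ((y + η - t : ℝ) : ℂ) * Complex.I := by
          nth_rewrite 1 [hτe]
          push_cast
          ring
        rw [h1]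
        have h2 := hbnd x (y + η - t) (by
          rw [abs_le]
          constructor <;> linarith [ht.1, ht.2])
        have h3 := hB (x - t * Complex.I) (by simp; linarith [ht.2]) (by simpa using ht.1)
        calc _ ≤ (Real.exp b * Real.exp (-b * (x - τ.re) ^ 2)) * B := by gcongr
          _ = _ := by ring
    have e1 : ∀ x : ℝ, (x : ℂ) - y * Complex.I + y * Complex.I - τ = (x : ℂ) - τ := fun x => by ring
    have e2 : ∀ x : ℝ, (x : ℂ) - η * Complex.I + y * Complex.I - τ
        = (x : ℂ) - τ.re + y * Complex.I := fun x => by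
      nth_rewrite 1 [hτe]
      ring
    simp only [e1, e2] at h
    exact h
  obtain ⟨B, hB0, hB⟩ := hF.exists_bound hη0
  have hlim : Filter.Tendsto (fun y : ℝ => ∫ x : ℝ,
      Complex.exp (-(b : ℂ) * ((x : ℂ) - τ.re + y * Complex.I) ^ 2) * F (x - η * Complex.I))
      (𝓝[>] 0) (𝓝 (∫ x : ℝ, gaussian b τ.re x * F (x + τ.im * Complex.I))) := by
    have hFc : Continuous fun x : ℝ => F (x - η * Complex.I) :=
      hF.1.continuousOn.comp_continuous (by fun_prop) fun x => by simpa using hη0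
    refine tendsto_integral_filter_of_dominated_convergence
      (fun x => Real.exp b * Real.exp (-b * (x - τ.re) ^ 2) * B) ?_ ?_ ?_ ?_
    · exact Filter.Eventually.of_forall fun y =>
        (Continuous.mul (by fun_prop) hFc).aestronglyMeasurable
    · filter_upwards [Ioo_mem_nhdsGT (zero_lt_one (α := ℝ))] with y hy
      refine Filter.Eventually.of_forall fun x => ?_
      rw [norm_mul]
      gcongr
      · exact hbnd x y (by rw [abs_of_pos hy.1]; exact hy.2.le)
      · exact hB _ (by simp; linarith) (by simp)
    · exact (((integrable_exp_neg_mul_sq hb).comp_sub_right τ.re).const_mul _).mul_const _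
    · refine Filter.Eventually.of_forall fun x => ?_
      have hc : Continuous fun y : ℝ =>
          Complex.exp (-(b : ℂ) * ((x : ℂ) - τ.re + y * Complex.I) ^ 2) * F (x - η * Complex.I) := by
        fun_prop
      have := (hc.tendsto 0).mono_left (nhdsWithin_le_nhds (s := Set.Ioi 0))
      rw [hτi, neg_mul, ← sub_eq_add_neg]
      simpa [gaussian] using this
  refine hlim.congr' ?_
  filter_upwards [Ioo_mem_nhdsGT hη0] with y hy
  exact (hshift y hy.1 hy.2.le).symm

/-! ### Positive definite kernels from distributions of positive type -/

/-- The strip `0 < Im a < 1/2`. -/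
abbrev Strip : Type := {a : ℂ // 0 < a.im ∧ a.im < 1 / 2}

/-- The height 1/2 of the strip keeps this in (-1, 0), where the growth bounds at the boundary are
available. -/
theorem Strip.im_sub (a b : Strip) : (conj a.1 - b.1).im = -(a.1.im + b.1.im) := by
  simp
  ring

/-- The kernel `(a, b) ↦ F (conj a - b)` on the strip. -/
def stripKernel (F : ℂ → ℂ) : Matrix Strip Strip ℂ := Matrix.of fun a b => F (conj a.1 - b.1)

open scoped ComplexOrder

/-- Nonnegativity in ℂ includes reality. Reality of the form on pairs with weights (1, 1) and (1, i)
already gives hermiticity. -/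
theorem posSemidef_of_sum_nonneg {X : Type*} (k : Matrix X X ℂ)
    (h : ∀ (S : Finset X) (c : X → ℂ), 0 ≤ ∑ a ∈ S, ∑ b ∈ S, conj (c a) * c b * k a b) :
    k.PosSemidef := by
  classical
  refine ⟨?_, fun x => ?_⟩
  · refine Matrix.IsHermitian.ext fun a b => ?_
    have hd : ∀ a, (k a a).im = 0 := fun a => by
      have := (Complex.nonneg_iff.mp (h {a} fun _ => 1)).2
      simpa using this.symm
    rcases eq_or_ne a b with rfl | hab
    · exact Complex.conj_eq_iff_im.mpr (hd a)
    have h1 := (Complex.nonneg_iff.mp (h {a, b} fun _ => 1)).2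
    have h2 := (Complex.nonneg_iff.mp (h {a, b} fun x => if x = a then 1 else Complex.I)).2
    simp only [Finset.sum_pair hab, map_one, one_mul, Complex.add_im, hd] at h1
    simp only [Finset.sum_pair hab, if_true, if_neg hab.symm, map_one, one_mul,
      Complex.conj_I, Complex.add_im, hd, Complex.mul_im, Complex.mul_re, Complex.neg_re,
      Complex.neg_im, Complex.I_re, Complex.I_im, Complex.one_re, Complex.one_im] at h2
    refine Complex.ext ?_ ?_
    · simp
      linarith
    · simp
      linarith
  · have := h x.support x
    refine this.trans_eq ?_
    rw [Finsupp.sum]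
    refine Finset.sum_congr rfl fun a _ => ?_
    rw [Finsupp.sum]
    refine Finset.sum_congr rfl fun b _ => ?_
    rw [← starRingEnd_apply]
    ring

/-- After the substitution x = r + u/(n + 1) the Gaussian no longer depends on n. The factor √π is
its integral. -/
theorem tendsto_integral_gaussian_mul {f : ℝ → ℂ} (hf : Continuous f) {B : ℝ}
    (hB : ∀ x, ‖f x‖ ≤ B) (r : ℝ) : Filter.Tendsto
      (fun n : ℕ => ((n + 1 : ℝ) : ℂ) * ∫ x : ℝ, gaussian ((n + 1) ^ 2) r x * f x) Filter.atTop
      (𝓝 (((Real.sqrt Real.pi : ℝ) : ℂ) * f r)) := by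
  have hsub : ∀ n : ℕ, ((n + 1 : ℝ) : ℂ) * ∫ x : ℝ, gaussian ((n + 1) ^ 2) r x * f x
      = ∫ u : ℝ, gaussian 1 0 u * f (r + u / (n + 1)) := by
    intro n
    have hn : (0 : ℝ) < n + 1 := by positivity
    have h1 := integral_add_left_eq_self (μ := (volume : Measure ℝ))
      (fun x : ℝ => gaussian ((n + 1) ^ 2) r x * f x) r
    rw [← h1]
    have h2 := Measure.integral_comp_div
      (fun u : ℝ => gaussian ((n + 1) ^ 2) r (r + u) * f (r + u)) (n + 1 : ℝ)
    rw [abs_of_pos hn, Complex.real_smul] at h2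
    rw [← h2]
    congr 1
    funext u
    congr 1
    have hn' : ((n : ℂ) + 1) ≠ 0 := by exact_mod_cast hn.ne'
    simp only [gaussian]
    congr 1
    push_cast
    field_simp
    ring
  simp only [hsub]
  have hg := integral_gaussian' (zero_lt_one (α := ℝ)) 0
  rw [div_one] at hg
  rw [← hg, ← integral_mul_const]
  refine tendsto_integral_of_dominated_convergence (fun u => ‖gaussian 1 0 u‖ * B) ?_ ?_ ?_ ?_
  · intro n
    exact ((contDiff_gaussian 1 0 (n := 0)).continuous.mul
      (hf.comp (by fun_prop))).aestronglyMeasurable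
  · exact (integrable_gaussian one_pos 0).norm.mul_const B
  · intro n
    refine Filter.Eventually.of_forall fun u => ?_
    rw [norm_mul]
    gcongr
    exact hB _
  · refine Filter.Eventually.of_forall fun u => ?_
    refine Filter.Tendsto.const_mul _ ?_
    have h1 : Filter.Tendsto (fun n : ℕ => r + u / ((n : ℝ) + 1)) Filter.atTop (𝓝 (r + 0)) :=
      tendsto_const_nhds.add (tendsto_const_nhds.div_atTop
        (Filter.tendsto_atTop_add_const_right _ _ tendsto_natCast_atTop_atTop))
    rw [add_zero] at h1
    exact (hf.tendsto r).comp h1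

/-- Positive type is tested on a combination of Gaussians centred at the points of the strip. Their
correlations are Gaussians centred at ā - a' in the lower half plane, so the boundary pairing
becomes an integral along the line through that point. This smeared kernel is localized by letting b
→ ∞. -/
theorem IsPositiveType.sum_nonneg {K : Kernel} (hK : IsPositiveType K) (S : Finset Strip)
    (c : Strip → ℂ) {b : ℝ} (hb : 0 < b) :
    0 ≤ ∑ a ∈ S, ∑ a' ∈ S, conj (c a) * c a' * ∫ x : ℝ,
      gaussian (b / 2) (conj a.1 - a'.1).re x * K.1 (x + (conj a.1 - a'.1).im * Complex.I) := by
  obtain ⟨c0, hc0, hbv⟩ := hK (∑ a ∈ S, c a • gaussianSchwartz b hb a.1)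
  set κ : ℝ := Real.sqrt (Real.pi / (2 * b)) with hκ
  have hκ0 : 0 < κ := Real.sqrt_pos.mpr (by positivity)
  have hcorr : (fun s' : ℝ => ∫ s : ℝ,
      conj ((∑ a ∈ S, c a • gaussianSchwartz b hb a.1) (s + s' / 2))
        * (∑ a ∈ S, c a • gaussianSchwartz b hb a.1) (s - s' / 2))
      = fun s' => ∑ a ∈ S, ∑ a' ∈ S, conj (c a) * c a' *
        (κ * gaussian (b / 2) (conj a.1 - a'.1) s') := by
    funext x
    have h1 : ∀ t : ℝ, (∑ a ∈ S, c a • gaussianSchwartz b hb a.1) t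
        = ∑ a ∈ S, c a * gaussian b a.1 t := fun t => by
      rw [sum_apply]
      rfl
    simp only [h1, map_sum, map_mul, Finset.sum_mul_sum]
    rw [integral_finsetSum]
    · refine Finset.sum_congr rfl fun a _ => ?_
      rw [integral_finsetSum]
      · refine Finset.sum_congr rfl fun a' _ => ?_
        rw [hκ, ← integral_conj_gaussian_mul_gaussian hb, ← integral_const_mul]
        congr 1
        funext t
        ring
      · intro a' _
        refine ((integrable_conj_gaussian_mul_gaussian hb a.1 a'.1 x).const_mul
          (conj (c a) * c a')).congr (Filter.Eventually.of_forall fun t => ?_)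
        ring
    · intro a _
      refine integrable_finsetSum _ fun a' _ => ?_
      refine ((integrable_conj_gaussian_mul_gaussian hb a.1 a'.1 x).const_mul
        (conj (c a) * c a')).congr (Filter.Eventually.of_forall fun t => ?_)
      ring
  rw [hcorr] at hbv
  have him : ∀ a a' : Strip, (conj a.1 - a'.1).im < 0 ∧ -1 < (conj a.1 - a'.1).im := fun a a' => by
    rw [Strip.im_sub]
    constructor <;> linarith [a.2.1, a.2.2, a'.2.1, a'.2.2]
  have hlim : HasBoundaryValue K.1 (fun s' => ∑ a ∈ S, ∑ a' ∈ S, conj (c a) * c a' *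
        (κ * gaussian (b / 2) (conj a.1 - a'.1) s'))
      (∑ a ∈ S, ∑ a' ∈ S, conj (c a) * c a' * (κ * ∫ x : ℝ,
        gaussian (b / 2) (conj a.1 - a'.1).re x *
          K.1 (x + (conj a.1 - a'.1).im * Complex.I))) := by
    have h1 : Filter.Tendsto (fun y : ℝ => ∑ a ∈ S, ∑ a' ∈ S, conj (c a) * c a' * (κ *
        ∫ x : ℝ, gaussian (b / 2) (conj a.1 - a'.1) x * K.1 (x - y * Complex.I))) (𝓝[>] 0)
        (𝓝 (∑ a ∈ S, ∑ a' ∈ S, conj (c a) * c a' * (κ * ∫ x : ℝ,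
          gaussian (b / 2) (conj a.1 - a'.1).re x *
            K.1 (x + (conj a.1 - a'.1).im * Complex.I)))) :=
      tendsto_finsetSum _ fun a _ => tendsto_finsetSum _ fun a' _ =>
        ((hasBoundaryValue_gaussian K.2 (by positivity) (him a a').1 (him a a').2).const_mul
          _).const_mul _
    refine h1.congr' ?_
    filter_upwards [Ioo_mem_nhdsGT (zero_lt_one (α := ℝ))] with y hy
    obtain ⟨B, hB0, hB⟩ := K.2.exists_bound hy.1
    have hint : ∀ a a' : Strip, Integrable fun x : ℝ => conj (c a) * c a' *
        (κ * gaussian (b / 2) (conj a.1 - a'.1) x) * K.1 (x - y * Complex.I) := by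
      intro a a'
      have hKc : Continuous fun x : ℝ => K.1 (x - y * Complex.I) :=
        K.2.1.continuousOn.comp_continuous (by fun_prop) fun x => by simpa using hy.1
      refine (((integrable_gaussian (by positivity) _).const_mul _).const_mul _).mul_bdd
        (c := B) hKc.aestronglyMeasurable (Filter.Eventually.of_forall fun x => ?_)
      exact hB _ (by simp; linarith [hy.2]) (by simp)
    simp only [Finset.sum_mul]
    rw [integral_finsetSum _ fun a _ => integrable_finsetSum _ fun a' _ => hint a a']
    refine Finset.sum_congr rfl fun a _ => ?_
    rw [integral_finsetSum _ fun a' _ => hint a a']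
    refine Finset.sum_congr rfl fun a' _ => ?_
    rw [← integral_const_mul, ← integral_const_mul]
    congr 1
    funext x
    ring
  have heq := tendsto_nhds_unique hlim hbv
  have hfac : (κ : ℂ) * ∑ a ∈ S, ∑ a' ∈ S, conj (c a) * c a' * ∫ x : ℝ,
      gaussian (b / 2) (conj a.1 - a'.1).re x * K.1 (x + (conj a.1 - a'.1).im * Complex.I)
      = c0 := by
    rw [← heq]
    simp only [Finset.mul_sum]
    refine Finset.sum_congr rfl fun a _ => Finset.sum_congr rfl fun a' _ => ?_
    ring
  have hκ' : (κ : ℂ) ≠ 0 := Complex.ofReal_ne_zero.mpr hκ0.ne'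
  rw [← mul_right_inj' hκ'] at hfac
  have h2 : ∑ a ∈ S, ∑ a' ∈ S, conj (c a) * c a' * ∫ x : ℝ,
      gaussian (b / 2) (conj a.1 - a'.1).re x * K.1 (x + (conj a.1 - a'.1).im * Complex.I)
      = ((c0 / κ : ℝ) : ℂ) := by
    refine mul_left_cancel₀ hκ' (mul_left_cancel₀ hκ' (hfac.trans ?_))
    push_cast
    field_simp
  rw [h2, Complex.zero_le_real]
  positivity

/-- A distribution of positive type that is the boundary value of `K ∈ 𝒦` gives a positive
definite kernel in the strip. -/
theorem IsPositiveType.posSemidef {K : Kernel} (hK : IsPositiveType K) :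
    (stripKernel K.1).PosSemidef := by
  refine posSemidef_of_sum_nonneg _ fun S c => ?_
  -- The choice b = 2(n + 1)² makes the correlation Gaussians of width 1/(n + 1); with the prefactor
  -- n + 1 they tend to √π times a point mass at the real part of ā - a'.
  have hlim : Filter.Tendsto (fun n : ℕ => ((n + 1 : ℝ) : ℂ) * ∑ a ∈ S, ∑ a' ∈ S,
      conj (c a) * c a' * ∫ x : ℝ, gaussian ((2 * (n + 1 : ℝ) ^ 2) / 2) (conj a.1 - a'.1).re x *
        K.1 (x + (conj a.1 - a'.1).im * Complex.I)) Filter.atTop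
      (𝓝 (∑ a ∈ S, ∑ a' ∈ S, conj (c a) * c a' *
        (((Real.sqrt Real.pi : ℝ) : ℂ) * K.1 (conj a.1 - a'.1)))) := by
    simp only [Finset.mul_sum]
    refine tendsto_finsetSum _ fun a _ => tendsto_finsetSum _ fun a' _ => ?_
    have him := Strip.im_sub a a'
    have h1 := a.2
    have h2 := a'.2
    obtain ⟨B, hB0, hB⟩ := K.2.exists_bound (y := a.1.im + a'.1.im) (by linarith)
    have hKc : Continuous fun x : ℝ => K.1 (x + (conj a.1 - a'.1).im * Complex.I) :=
      K.2.1.continuousOn.comp_continuous (by fun_prop) fun x => by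
        simp
        linarith
    have := (tendsto_integral_gaussian_mul hKc (B := B) (fun x => hB _
      (by simp; linarith) (by simp; linarith)) (conj a.1 - a'.1).re).const_mul (conj (c a) * c a')
    rw [Complex.re_add_im] at this
    refine this.congr fun n => ?_
    rw [mul_div_cancel_left₀ _ (two_ne_zero)]
    ring
  have hnn := ge_of_tendsto' hlim fun n => mul_nonneg
    (by rw [Complex.zero_le_real]; positivity) (hK.sum_nonneg S c (b := 2 * (n + 1 : ℝ) ^ 2)
      (by positivity))
  have hpi : 0 < Real.sqrt Real.pi := Real.sqrt_pos.mpr Real.pi_pos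
  have h3 : ∑ a ∈ S, ∑ a' ∈ S, conj (c a) * c a' * stripKernel K.1 a a'
      = (((Real.sqrt Real.pi)⁻¹ : ℝ) : ℂ) * ∑ a ∈ S, ∑ a' ∈ S, conj (c a) * c a' *
        (((Real.sqrt Real.pi : ℝ) : ℂ) * K.1 (conj a.1 - a'.1)) := by
    have hpi' : ((Real.sqrt Real.pi : ℝ) : ℂ) ≠ 0 := Complex.ofReal_ne_zero.mpr hpi.ne'
    simp only [Finset.mul_sum]
    refine Finset.sum_congr rfl fun a _ => Finset.sum_congr rfl fun a' _ => ?_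
    rw [stripKernel, Matrix.of_apply]
    push_cast
    field_simp
  rw [h3]
  exact mul_nonneg (by rw [Complex.zero_le_real]; positivity) hnn

/-! ### Uniform bounds near the boundary -/

/-- `h` is analytic in the lower half plane, and of polynomial growth at the boundary. -/
structure PolynomialGrowth (h : ℂ → ℂ) : Prop where
  differentiableOn : DifferentiableOn ℂ h {z | z.im < 0}
  bound : ∃ (L : ℕ) (C : ℝ), 0 ≤ C ∧ ∀ z : ℂ, -1 ≤ z.im → z.im < 0 → ‖h z‖ ≤ C / |z.im| ^ L

theorem PolynomialGrowth.continuous_line {h : ℂ → ℂ} (hh : PolynomialGrowth h) {y : ℝ}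
    (hy : 0 < y) : Continuous fun x : ℝ => h (x - y * Complex.I) :=
  hh.differentiableOn.continuousOn.comp_continuous (by fun_prop) fun x => by simpa using hy

theorem PolynomialGrowth.mul {h k : ℂ → ℂ} (hh : PolynomialGrowth h) (hk : PolynomialGrowth k) :
    PolynomialGrowth fun z => h z * k z := by
  obtain ⟨L, C, hC0, hC⟩ := hh.bound
  obtain ⟨M, D, hD0, hD⟩ := hk.bound
  refine ⟨hh.differentiableOn.mul hk.differentiableOn, L + M, C * D, by positivity,
    fun z h1 h2 => ?_⟩
  rw [norm_mul, pow_add, mul_div_mul_comm]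
  exact mul_le_mul (hC z h1 h2) (hD z h1 h2) (norm_nonneg _) (by positivity)

theorem PolynomialGrowth.sum {ι : Type*} (S : Finset ι) {h : ι → ℂ → ℂ}
    (hh : ∀ i ∈ S, PolynomialGrowth (h i)) : PolynomialGrowth fun z => ∑ i ∈ S, h i z := by
  classical
  induction S using Finset.induction_on with
  | empty => exact ⟨by simp, 0, 0, le_rfl, by simp⟩
  | insert a S ha ih =>
    have h1 := hh a (Finset.mem_insert_self a S)
    have h2 := ih fun i hi => hh i (Finset.mem_insert_of_mem hi)
    simp only [Finset.sum_insert ha]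
    obtain ⟨L, C, hC0, hC⟩ := h1.bound
    obtain ⟨M, D, hD0, hD⟩ := h2.bound
    refine ⟨h1.differentiableOn.add h2.differentiableOn, L + M, C + D, by positivity,
      fun z hz1 hz2 => (norm_add_le _ _).trans ?_⟩
    have h0 : 0 < |z.im| := abs_pos.mpr hz2.ne
    have hle : |z.im| ≤ 1 := by rw [abs_of_neg hz2]; linarith
    rw [add_div]
    refine add_le_add ((hC z hz1 hz2).trans ?_) ((hD z hz1 hz2).trans ?_)
    · exact div_le_div_of_nonneg_left hC0 (by positivity)
        (pow_le_pow_of_le_one h0.le hle (Nat.le_add_right _ _))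
    · exact div_le_div_of_nonneg_left hD0 (by positivity)
        (pow_le_pow_of_le_one h0.le hle (Nat.le_add_left _ _))

theorem RegularAtBoundary.polynomialGrowth {F : ℂ → ℂ} (hF : RegularAtBoundary F) :
    PolynomialGrowth F := by
  obtain ⟨hd, -, ℓ, hℓ, C, hC⟩ := hF
  obtain ⟨L, hL⟩ := exists_nat_ge ℓ
  refine ⟨hd, L, max C 0, le_max_right _ _, fun z h1 h2 => ?_⟩
  have h0 : 0 < |z.im| := abs_pos.mpr h2.ne
  have hle : |z.im| ≤ 1 := by rw [abs_of_neg h2]; linarith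
  rw [le_div_iff₀ (by positivity)]
  refine le_trans ?_ ((hC z h1 h2).trans (le_max_left _ _))
  gcongr
  rw [← Real.rpow_natCast]
  exact Real.rpow_le_rpow_of_exponent_ge h0 hle hL

/-- Differentiation in the direction of the boundary can be moved onto the test function. -/
theorem PolynomialGrowth.hasDerivAt_integral {h : ℂ → ℂ} (hh : PolynomialGrowth h) {f f' : ℝ → ℂ}
    (hf : ∀ x, HasDerivAt f (f' x) x) (hf' : Continuous f') (hfc : HasCompactSupport f)
    (hfc' : HasCompactSupport f') {y : ℝ} (hy : 0 < y) :
    HasDerivAt (fun t : ℝ => ∫ x : ℝ, f x * h (x - t * Complex.I))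
      (Complex.I * ∫ x : ℝ, f' x * h (x - y * Complex.I)) y := by
  have hfcont : Continuous f := continuous_iff_continuousAt.mpr fun x => (hf x).continuousAt
  have hopen : IsOpen {z : ℂ | z.im < 0} := isOpen_lt Complex.continuous_im continuous_const
  have hderiv : ∀ z : ℂ, z.im < 0 → HasDerivAt h (deriv h z) z := fun z hz =>
    (hh.differentiableOn.differentiableAt (hopen.mem_nhds hz)).hasDerivAt
  have hdcont : ContinuousOn (deriv h) {z | z.im < 0} :=
    (hh.differentiableOn.deriv hopen).continuousOn
  set S := Metric.ball y (y / 2) with hS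
  have hpos : ∀ t ∈ Metric.closedBall y (y / 2), 0 < t := fun t ht => by
    rw [Metric.mem_closedBall, Real.dist_eq, abs_le] at ht
    linarith [ht.1]
  obtain ⟨B, hB⟩ : ∃ B, ∀ p ∈ tsupport f ×ˢ Metric.closedBall y (y / 2),
      ‖deriv h ((p.1 : ℂ) - p.2 * Complex.I)‖ ≤ B := by
    refine (hfc.isCompact.prod (isCompact_closedBall y (y / 2))).exists_bound_of_continuousOn ?_
    refine hdcont.comp (by fun_prop) fun p hp => ?_
    have := hpos p.2 hp.2
    simpa using this
  have hcont : ∀ t : ℝ, 0 < t → Continuous fun x : ℝ => deriv h (x - t * Complex.I) := fun t ht =>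
    hdcont.comp_continuous (by fun_prop) fun x => by simpa using ht
  have hmain := (hasDerivAt_integral_of_dominated_loc_of_deriv_le (μ := volume) (𝕜 := ℝ)
    (F := fun t x => f x * h (x - t * Complex.I))
    (F' := fun t x => f x * (deriv h (x - t * Complex.I) * -Complex.I))
    (bound := fun x => ‖f x‖ * B) (s := S) (x₀ := y)
    (Metric.ball_mem_nhds y (by positivity)) ?_ ?_ ?_ ?_ ?_ ?_).2
  · refine hmain.congr_deriv ?_
    have hv : ∀ x : ℝ, HasDerivAt (fun x : ℝ => h (x - y * Complex.I))
        (deriv h (x - y * Complex.I)) x := fun x => by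
      have h1 := hderiv (x - y * Complex.I) (by simpa using hy)
      have h2 : HasDerivAt (fun x : ℝ => (x : ℂ) - y * Complex.I) 1 x :=
        Complex.ofRealCLM.hasDerivAt.sub_const _
      have h3 : HasDerivAt (fun x : ℝ => h (x - y * Complex.I)) _ x := h1.scomp x h2
      exact h3.congr_deriv (by simp)
    -- By analyticity the derivative in t is -i times the derivative in x. Integration by parts
    -- contributes the other sign.
    have h3 := integral_mul_deriv_eq_deriv_mul_of_integrable (u := f) (u' := f')
      (v := fun x : ℝ => h (x - y * Complex.I)) (v' := fun x : ℝ => deriv h (x - y * Complex.I))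
      (fun x _ => hf x) (fun x _ => hv x)
      ((hfcont.mul (hcont y hy)).integrable_of_hasCompactSupport hfc.mul_right)
      ((hf'.mul (hh.continuous_line hy)).integrable_of_hasCompactSupport hfc'.mul_right)
      ((hfcont.mul (hh.continuous_line hy)).integrable_of_hasCompactSupport hfc.mul_right)
    simp only [← mul_assoc, integral_mul_const]
    rw [h3]
    ring
  · filter_upwards [lt_mem_nhds hy] with t ht
    exact (hfcont.mul (hh.continuous_line ht)).aestronglyMeasurable
  · exact (hfcont.mul (hh.continuous_line hy)).integrable_of_hasCompactSupport hfc.mul_right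
  · exact (hfcont.mul ((hcont y hy).mul continuous_const)).aestronglyMeasurable
  · refine Filter.Eventually.of_forall fun x t ht => ?_
    rw [norm_mul, norm_mul, norm_neg, Complex.norm_I, mul_one]
    by_cases hx : x ∈ tsupport f
    · exact mul_le_mul_of_nonneg_left (hB (x, t) ⟨hx, Metric.ball_subset_closedBall ht⟩)
        (norm_nonneg _)
    · rw [image_eq_zero_of_notMem_tsupport hx]
      simp
  · exact (hfcont.norm.mul continuous_const).integrable_of_hasCompactSupport hfc.norm.mul_right
  · refine Filter.Eventually.of_forall fun x t ht => ?_
    have h1 := hderiv (x - t * Complex.I) (by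
      simpa using hpos t (Metric.ball_subset_closedBall ht))
    have h2 : HasDerivAt (fun t : ℝ => (x : ℂ) - t * Complex.I) (-Complex.I) t := by
      have := ((Complex.ofRealCLM.hasDerivAt (x := t)).mul_const Complex.I).const_sub (x : ℂ)
      simpa using this
    have h3 : HasDerivAt (fun t : ℝ => h (x - t * Complex.I)) _ t := h1.scomp t h2
    exact (h3.const_mul (f x)).congr_deriv (by rw [smul_eq_mul, mul_comm (-Complex.I)])

/-- A function on `(0, 1]` all of whose derivatives are `O(t^{-L})` is bounded. -/
theorem norm_le_of_iterated_hasDerivAt {J : ℕ → ℝ → ℂ} {A : ℝ} {L : ℕ}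
    (hJ : ∀ k, ∀ t, 0 < t → HasDerivAt (J k) (J (k + 1) t) t)
    (hA : ∀ k ≤ L + 1, ∀ t, 0 < t → t ≤ 1 → ‖J k t‖ ≤ A / t ^ L) {y : ℝ} (hy : 0 < y)
    (hy1 : y ≤ 1) : ‖J 0 y‖ ≤ (L + 2) * A := by
  have hA0 : 0 ≤ A := by
    have := (norm_nonneg _).trans (hA 0 (Nat.zero_le _) 1 one_pos le_rfl)
    simpa using this
  -- The Taylor polynomial evaluated at y, as a function of its base point t. Its derivative
  -- telescopes to J_{L+1}(t)(y - t)^L/L!, and |y - t| ≤ t on [y, 1] cancels the singularity t^{-L}.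
  -- The L + 1 terms at t = 1 and the increment from y to 1 give the factor L + 2.
  let Φ : ℕ → ℝ → ℂ := fun n t =>
    ∑ k ∈ Finset.range (n + 1), J k t * (((y - t) ^ k / k.factorial : ℝ) : ℂ)
  have hΦ : ∀ n t, 0 < t →
      HasDerivAt (Φ n) (J (n + 1) t * (((y - t) ^ n / n.factorial : ℝ) : ℂ)) t := by
    intro n t ht
    induction n with
    | zero =>
      have h1 : Φ 0 = J 0 := by
        funext t
        simp [Φ]
      rw [h1]
      simpa using hJ 0 t ht
    | succ n ih =>
      have h1 : Φ (n + 1) = fun t =>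
          Φ n t + J (n + 1) t * (((y - t) ^ (n + 1) / (n + 1).factorial : ℝ) : ℂ) := by
        funext t
        simp only [Φ]
        rw [Finset.sum_range_succ]
      have h2 : HasDerivAt (fun t : ℝ => (y - t) ^ (n + 1) / ((n + 1).factorial : ℝ))
          (-((y - t) ^ n / n.factorial)) t := by
        have h3 := ((((hasDerivAt_id t).const_sub y).pow (n + 1)).div_const
          ((n + 1).factorial : ℝ))
        have h4 : HasDerivAt (fun t : ℝ => (y - t) ^ (n + 1) / ((n + 1).factorial : ℝ)) _ t := h3
        refine h4.congr_deriv ?_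
        have hf : (n.factorial : ℝ) ≠ 0 := by positivity
        rw [Nat.factorial_succ]
        simp only [Nat.add_sub_cancel, id_eq]
        push_cast
        field_simp
      rw [h1]
      refine (ih.fun_add ((hJ (n + 1) t ht).fun_mul h2.ofReal_comp)).congr_deriv ?_
      push_cast
      ring
  have hΦy : Φ L y = J 0 y := by
    simp only [Φ]
    rw [Finset.sum_eq_single 0]
    · simp
    · intro k _ hk
      simp [hk]
    · simp
  have hΦ1 : ‖Φ L 1‖ ≤ (L + 1) * A := by
    simp only [Φ]
    refine (norm_sum_le _ _).trans ?_
    calc ∑ k ∈ Finset.range (L + 1), ‖J k 1 * (((y - 1) ^ k / k.factorial : ℝ) : ℂ)‖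
        ≤ ∑ _k ∈ Finset.range (L + 1), A := by
          refine Finset.sum_le_sum fun k hk => ?_
          have h1 := hA k ((Finset.mem_range.mp hk).le) 1 one_pos le_rfl
          rw [one_pow, div_one] at h1
          rw [norm_mul, Complex.norm_real, Real.norm_eq_abs, abs_div, abs_pow, Nat.abs_cast]
          have h2 : |y - 1| ^ k / (k.factorial : ℝ) ≤ 1 := by
            refine div_le_one_of_le₀ ?_ (by positivity)
            calc |y - 1| ^ k ≤ 1 := pow_le_one₀ (abs_nonneg _) (by
                  rw [abs_le]
                  constructor <;> linarith)
              _ ≤ _ := by exact_mod_cast Nat.one_le_iff_ne_zero.mpr (Nat.factorial_ne_zero k)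
          calc _ ≤ A * 1 := mul_le_mul h1 h2 (by positivity) hA0
            _ = A := mul_one A
      _ = _ := by simp
  have hdiff := Convex.norm_image_sub_le_of_norm_hasDerivWithin_le (s := Set.Icc y 1) (C := A)
    (f := Φ L) (x := 1) (y := y)
    (fun t ht => (hΦ L t (hy.trans_le ht.1)).hasDerivWithinAt) (fun t ht => by
      have ht0 : 0 < t := hy.trans_le ht.1
      have h1 := hA (L + 1) le_rfl t ht0 ht.2
      rw [norm_mul, Complex.norm_real, Real.norm_eq_abs, abs_div, abs_pow, Nat.abs_cast]
      have h2 : |y - t| ^ L / (L.factorial : ℝ) ≤ t ^ L := by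
        rw [div_le_iff₀ (by positivity)]
        have h3 : |y - t| ^ L ≤ t ^ L := pow_le_pow_left₀ (abs_nonneg _) (by
          rw [abs_le]
          constructor <;> linarith [ht.1]) L
        have h4 : (1 : ℝ) ≤ L.factorial := by
          exact_mod_cast Nat.one_le_iff_ne_zero.mpr (Nat.factorial_ne_zero L)
        nlinarith [pow_pos ht0 L]
      calc _ ≤ A / t ^ L * t ^ L := mul_le_mul h1 h2 (by positivity) (by positivity)
        _ = A := div_mul_cancel₀ _ (by positivity))
    (convex_Icc y 1) ⟨hy1, le_rfl⟩ ⟨le_rfl, hy1⟩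
  have h5 : ‖y - 1‖ ≤ 1 := by
    rw [Real.norm_eq_abs, abs_le]
    constructor <;> linarith
  rw [← hΦy]
  calc ‖Φ L y‖ ≤ ‖Φ L y - Φ L 1‖ + ‖Φ L 1‖ := by
        simpa using norm_add_le (Φ L y - Φ L 1) (Φ L 1)
    _ ≤ A * 1 + (L + 1) * A := add_le_add (hdiff.trans (by gcongr)) hΦ1
    _ = _ := by ring

/-- Integrals of `h` along lines near the boundary, against a smooth family of test functions,
are uniformly bounded. -/
theorem PolynomialGrowth.exists_norm_integral_le {h : ℂ → ℂ} (hh : PolynomialGrowth h)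
    {F : ℝ × ℝ → ℂ} (hF : ContDiff ℝ (⊤ : ℕ∞) F) (hFc : HasCompactSupport F) :
    ∃ M : ℝ, ∀ t y : ℝ, 0 < y → y ≤ 1 → ‖∫ x : ℝ, F (t, x) * h (x - y * Complex.I)‖ ≤ M := by
  obtain ⟨L, C, hC0, hC⟩ := hh.bound
  -- Iterated partial derivatives in the second variable.
  let D : ℕ → ℝ × ℝ → ℂ := fun k => (fun G p => fderiv ℝ G p (0, 1))^[k] F
  have hDsucc : ∀ k p, D (k + 1) p = fderiv ℝ (D k) p (0, 1) := fun k p => by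
    simp only [D, Function.iterate_succ_apply']
  have hD : ∀ k, ContDiff ℝ (⊤ : ℕ∞) (D k) ∧ HasCompactSupport (D k) := by
    intro k
    induction k with
    | zero => exact ⟨hF, hFc⟩
    | succ k ih =>
      have h1 : D (k + 1) = fun p => fderiv ℝ (D k) p (0, 1) := funext (hDsucc k)
      rw [h1]
      exact ⟨(ih.1.fderiv_right (m := (⊤ : ℕ∞)) (by simp)).clm_apply contDiff_const,
        ih.2.fderiv_apply ℝ (0, 1)⟩
  have hslice : ∀ k t, HasCompactSupport fun x : ℝ => D k (t, x) := fun k t =>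
    by
    refine HasCompactSupport.intro ((hD k).2.isCompact.image continuous_snd) fun x hx => ?_
    exact image_eq_zero_of_notMem_tsupport fun hmem => hx ⟨(t, x), hmem, rfl⟩
  have hderiv : ∀ k t x, HasDerivAt (fun x : ℝ => D k (t, x)) (D (k + 1) (t, x)) x := by
    intro k t x
    rw [hDsucc]
    have h1 := (((hD k).1.differentiable (by simp)) (t, x)).hasFDerivAt
    have h2 : HasDerivAt (fun x : ℝ => (t, x)) ((0 : ℝ), (1 : ℝ)) x :=
      (hasDerivAt_const x t).prodMk (hasDerivAt_id x)
    exact h1.comp_hasDerivAt x h2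
  choose B hB using fun k => (hD k).2.exists_bound_of_continuous (hD k).1.continuous
  have hB0 : ∀ k, 0 ≤ B k := fun k => (norm_nonneg _).trans (hB k 0)
  obtain ⟨R, hR0, hR⟩ : ∃ R : ℝ, 0 ≤ R ∧ ∀ k t x, R < |x| → D k (t, x) = 0 := by
    obtain ⟨R, hR⟩ := hFc.isCompact.isBounded.exists_norm_le
    refine ⟨max R 0, le_max_right _ _, fun k t x hx => ?_⟩
    have hsub : ∀ k, tsupport (D k) ⊆ tsupport F := by
      intro k
      induction k with
      | zero => exact subset_rfl
      | succ k ih =>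
        refine (closure_minimal ?_ (isClosed_tsupport _)).trans ih
        refine fun p hp => support_fderiv_subset ℝ fun hz => hp ?_
        rw [hDsucc, hz]
        rfl
    refine image_eq_zero_of_notMem_tsupport fun hmem => ?_
    have h1 := hR _ (hsub k hmem)
    have h2 : |x| ≤ ‖((t, x) : ℝ × ℝ)‖ := norm_snd_le (t, x)
    linarith [le_max_left R 0]
  set A : ℝ := ∑ k ∈ Finset.range (L + 2), B k * C * (2 * R) with hA
  refine ⟨(L + 2) * A, fun t y hy hy1 => ?_⟩
  -- Each derivative in the height s falls on the test function, so every derivative is O(s^{-L})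
  -- with the same L, with constants uniform in t.
  let J : ℕ → ℝ → ℂ := fun k s =>
    Complex.I ^ k * ∫ x : ℝ, D k (t, x) * h (x - s * Complex.I)
  have hJ : ∀ k s, 0 < s → HasDerivAt (J k) (J (k + 1) s) s := by
    intro k s hs
    have hcont : Continuous fun x : ℝ => D (k + 1) (t, x) :=
      (hD (k + 1)).1.continuous.comp (by fun_prop)
    have h1 := (hh.hasDerivAt_integral (hderiv k t) hcont (hslice k t) (hslice (k + 1) t)
      hs).const_mul (Complex.I ^ k)
    refine h1.congr_deriv ?_
    simp only [J]
    rw [pow_succ, mul_assoc]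
  have hJA : ∀ k ≤ L + 1, ∀ s, 0 < s → s ≤ 1 → ‖J k s‖ ≤ A / s ^ L := by
    intro k hk s hs hs1
    simp only [J]
    rw [norm_mul, norm_pow, Complex.norm_I, one_pow, one_mul]
    have hset : ∫ x : ℝ, D k (t, x) * h (x - s * Complex.I)
        = ∫ x in Set.Icc (-R) R, D k (t, x) * h (x - s * Complex.I) := by
      rw [setIntegral_eq_integral_of_forall_compl_eq_zero]
      intro x hx
      rw [hR k t x (by
        by_contra hcon
        exact hx (abs_le.mp (not_lt.mp hcon))), zero_mul]
    rw [hset]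
    have h1 := norm_setIntegral_le_of_norm_le_const (μ := volume) (s := Set.Icc (-R) R)
      (C := B k * (C / s ^ L)) (f := fun x : ℝ => D k (t, x) * h (x - s * Complex.I))
      (by simp) (fun x _ => by
        rw [norm_mul]
        have h2 := hC (x - s * Complex.I) (by simp; linarith) (by simpa using hs)
        have h3 : |((x : ℂ) - s * Complex.I).im| = s := by
          simp [abs_of_pos hs]
        rw [h3] at h2
        exact mul_le_mul (hB k _) h2 (norm_nonneg _) (hB0 k))
    refine h1.trans ?_
    rw [Real.volume_real_Icc_of_le (by linarith)]
    calc B k * (C / s ^ L) * (R - -R) = B k * C * (2 * R) / s ^ L := by ring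
      _ ≤ A / s ^ L := by
        gcongr
        exact Finset.single_le_sum (f := fun k => B k * C * (2 * R))
          (fun i _ => by have := hB0 i; positivity) (Finset.mem_range.mpr (by omega))
  have := norm_le_of_iterated_hasDerivAt hJ hJA hy hy1
  simpa [J, D] using this

/-! ### The convolution integral as a boundary value -/

theorem exists_forall_abs_lt_eq_zero (g : Test) : ∃ R : ℝ, 0 ≤ R ∧ ∀ x, R < |x| → g x = 0 := by
  obtain ⟨R, hR⟩ := g.hasCompactSupport.isCompact.isBounded.exists_norm_le
  refine ⟨max R 0, le_max_right _ _, fun x hx => image_eq_zero_of_notMem_tsupport fun hmem => ?_⟩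
  have := hR x hmem
  rw [Real.norm_eq_abs] at this
  linarith [le_max_left R 0]

theorem abs_le_of_diamond {R t x : ℝ} (h1 : |t + x / 2| ≤ R) (h2 : |t - x / 2| ≤ R) :
    |t| ≤ R ∧ |x| ≤ 2 * R := by
  have h3 := abs_le.mp h1
  have h4 := abs_le.mp h2
  refine ⟨abs_le.mpr ⟨by linarith [h3.1, h4.1], by linarith [h3.2, h4.2]⟩,
    abs_le.mpr ⟨by linarith [h3.1, h4.2], by linarith [h3.2, h4.1]⟩⟩

theorem hasCompactSupport_diamond (g : Test) :
    HasCompactSupport fun p : ℝ × ℝ => g (p.1 + p.2 / 2) * g (p.1 - p.2 / 2) := by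
  obtain ⟨R, hR0, hR⟩ := exists_forall_abs_lt_eq_zero g
  refine HasCompactSupport.intro (K := Set.Icc (-R) R ×ˢ Set.Icc (-(2 * R)) (2 * R))
    (isCompact_Icc.prod isCompact_Icc) fun p hp => ?_
  by_contra hne
  obtain ⟨h1, h2⟩ := mul_ne_zero_iff.mp hne
  have h3 := abs_le_of_diamond (not_lt.mp fun h => h1 (hR _ h)) (not_lt.mp fun h => h2 (hR _ h))
  exact hp ⟨abs_le.mp h3.1, abs_le.mp h3.2⟩

/-- Boundary values exist for each t separately. The bound uniform in t and y, together with compact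
support in t, allows dominated convergence under the outer integral. -/
theorem PolynomialGrowth.tendsto_integral_diamond {h : ℂ → ℂ} (hh : PolynomialGrowth h)
    (g : Test) {T : ℝ → ℂ} (hT : ∀ t, HasBoundaryValue h (diamond g g t) (T t)) :
    Filter.Tendsto (fun y : ℝ => ∫ t : ℝ, ∫ x : ℝ, diamond g g t x * h (x - y * Complex.I))
      (𝓝[>] 0) (𝓝 (∫ t, T t)) := by
  obtain ⟨R, hR0, hR⟩ := exists_forall_abs_lt_eq_zero g
  set F : ℝ × ℝ → ℂ := fun p => g (p.1 + p.2 / 2) * g (p.1 - p.2 / 2) with hF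
  have hFd : ContDiff ℝ (⊤ : ℕ∞) F := by
    have h1 : ContDiff ℝ (⊤ : ℕ∞) (g : ℝ → ℂ) := g.contDiff
    exact (h1.comp (by fun_prop)).mul (h1.comp (by fun_prop))
  have hFc : HasCompactSupport F := hasCompactSupport_diamond g
  obtain ⟨M, hM⟩ := hh.exists_norm_integral_le hFd hFc
  have hval : ∀ t x, diamond g g t x = F (t, x) := fun _ _ => rfl
  have hev : ∀ᶠ y : ℝ in 𝓝[>] 0, 0 < y ∧ y ≤ 1 := by
    filter_upwards [Ioo_mem_nhdsGT (zero_lt_one (α := ℝ))] with y hy using ⟨hy.1, hy.2.le⟩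
  refine tendsto_integral_filter_of_dominated_convergence
    (Set.indicator (Set.Icc (-R) R) fun _ => M) ?_ ?_ ?_ ?_
  · filter_upwards [hev] with y hy
    have hc : Continuous fun p : ℝ × ℝ => F p * h (p.2 - y * Complex.I) :=
      hFd.continuous.mul ((hh.continuous_line hy.1).comp continuous_snd)
    exact (hc.stronglyMeasurable.integral_prod_right (ν := volume)).aestronglyMeasurable
  · filter_upwards [hev] with y hy
    refine Filter.Eventually.of_forall fun t => ?_
    by_cases ht : t ∈ Set.Icc (-R) R
    · rw [Set.indicator_of_mem ht]
      exact hM t y hy.1 hy.2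
    · rw [Set.indicator_of_notMem ht]
      have hz : ∀ x, F (t, x) = 0 := by
        intro x
        by_contra hne
        obtain ⟨h1, h2⟩ := mul_ne_zero_iff.mp hne
        have h3 := abs_le_of_diamond (not_lt.mp fun h => h1 (hR _ h))
          (not_lt.mp fun h => h2 (hR _ h))
        exact ht (abs_le.mp h3.1)
      simp [hval, hz]
  · exact (integrable_indicator_iff measurableSet_Icc).mpr (by simp)
  · exact Filter.Eventually.of_forall hT

/-- The change of variables u = t + x/2, v = t - x/2 has Jacobian one. It is carried out as two
one-dimensional translations separated by exchanges of the order of integration. -/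
theorem PolynomialGrowth.integral_diamond_eq {h : ℂ → ℂ} (hh : PolynomialGrowth h) (g : Test)
    {y : ℝ} (hy : 0 < y) :
    ∫ t : ℝ, ∫ x : ℝ, diamond g g t x * h (x - y * Complex.I)
      = ∫ v : ℝ, ∫ u : ℝ, g u * g v * h (((u - v : ℝ) : ℂ) - y * Complex.I) := by
  have hg := g.continuous
  have hline := hh.continuous_line hy
  obtain ⟨R, hR0, hR⟩ := exists_forall_abs_lt_eq_zero g
  have e1 : ∫ t : ℝ, ∫ x : ℝ, diamond g g t x * h (x - y * Complex.I)
      = ∫ x : ℝ, ∫ t : ℝ, diamond g g t x * h (x - y * Complex.I) := by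
    refine integral_integral_swap_of_hasCompactSupport
      (f := fun t x => g (t + x / 2) * g (t - x / 2) * h (x - y * Complex.I)) ?_ ?_
    · exact (by fun_prop : Continuous fun p : ℝ × ℝ => g (p.1 + p.2 / 2) * g (p.1 - p.2 / 2)).mul
        (hline.comp continuous_snd)
    · exact (hasCompactSupport_diamond g).mul_right
  have e2 : ∀ x : ℝ, ∫ t : ℝ, diamond g g t x * h (x - y * Complex.I)
      = ∫ v : ℝ, g (v + x) * g v * h (x - y * Complex.I) := by
    intro x
    rw [← integral_add_right_eq_self
      (fun t : ℝ => diamond g g t x * h (x - y * Complex.I)) (x / 2)]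
    congr 1
    funext v
    change g (v + x / 2 + x / 2) * g (v + x / 2 - x / 2) * _ = _
    ring_nf
  have e3 : ∫ x : ℝ, ∫ v : ℝ, g (v + x) * g v * h (x - y * Complex.I)
      = ∫ v : ℝ, ∫ x : ℝ, g (v + x) * g v * h (x - y * Complex.I) := by
    refine integral_integral_swap_of_hasCompactSupport
      (f := fun x v => g (v + x) * g v * h (x - y * Complex.I)) ?_ ?_
    · exact (by fun_prop : Continuous fun p : ℝ × ℝ => g (p.2 + p.1) * g p.2).mul
        (hline.comp continuous_fst)
    · refine HasCompactSupport.mul_right (HasCompactSupport.intro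
        (K := Set.Icc (-(2 * R)) (2 * R) ×ˢ Set.Icc (-R) R)
        (isCompact_Icc.prod isCompact_Icc)
        (f := fun p : ℝ × ℝ => g (p.2 + p.1) * g p.2) fun p hp => ?_)
      by_contra hne
      obtain ⟨h1, h2⟩ := mul_ne_zero_iff.mp hne
      have h3 := abs_le.mp (not_lt.mp fun h => h1 (hR _ h))
      have h4 := abs_le.mp (not_lt.mp fun h => h2 (hR _ h))
      exact hp ⟨⟨by linarith [h3.1, h4.2], by linarith [h3.2, h4.1]⟩, h4⟩
  rw [e1]
  simp only [e2]
  rw [e3]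
  congr 1
  funext v
  rw [← integral_add_right_eq_self
    (fun u : ℝ => g u * g v * h (((u - v : ℝ) : ℂ) - y * Complex.I)) v]
  congr 1
  funext x
  rw [add_sub_cancel_right, add_comm v x]

/-! ### The Cauchy-Schwarz inequality -/

/-- A positive semidefinite kernel is a Gram matrix. -/
theorem exists_gram_of_posSemidef {X : Type} {k : Matrix X X ℂ} (hk : k.PosSemidef) :
    ∃ (V : Type) (_ : NormedAddCommGroup V) (_ : InnerProductSpace ℂ V) (_ : CompleteSpace V)
      (v : X → V), ∀ a b, ⟪v a, v b⟫_ℂ = k a b := by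
  -- The Hilbert space is the reproducing kernel space of `k`, viewed as an operator-valued kernel
  -- on the one-dimensional space ℂ.
  let K : Matrix X X (ℂ →L[ℂ] ℂ) := Matrix.of fun a b => k a b • (1 : ℂ →L[ℂ] ℂ)
  have hK : K.PosSemidef := by
    suffices hsuff : K.IsHermitian ∧ ∀ w : X →₀ ℂ,
        0 ≤ RCLike.re (w.sum fun x a => w.sum fun x' a' => ⟪K x' x a, a'⟫_ℂ) from
      (RKHS.posSemidef_tfae.out 0 2).mpr hsuff
    refine ⟨Matrix.IsHermitian.ext fun a b => ?_, fun w => ?_⟩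
    · change star (k b a • (1 : ℂ →L[ℂ] ℂ)) = k a b • 1
      rw [star_smul, star_one, hk.isHermitian.apply]
    · have h := (Complex.nonneg_iff.mp (hk.2 w)).1
      refine h.trans_eq ?_
      rw [← Complex.conj_re]
      change _ = Complex.re _
      congr 1
      rw [Finsupp.sum_comm]
      simp only [Finsupp.sum, map_sum]
      refine Finset.sum_congr rfl fun a _ => Finset.sum_congr rfl fun b _ => ?_
      change _ = ⟪k b a • w a, w b⟫_ℂ
      simp
      ring
  have : Fact K.PosSemidef := ⟨hK⟩
  refine ⟨RKHS.OfKernel K, inferInstance, inferInstance, inferInstance,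
    fun a => RKHS.kerFun (RKHS.OfKernel K) a 1, fun a b => ?_⟩
  rw [← RKHS.kernel_inner, RKHS.OfKernel.kernel_ofKernel]
  change ⟪k b a • (1 : ℂ), (1 : ℂ)⟫_ℂ = k a b
  rw [← hk.isHermitian.apply a b]
  simp

theorem posSemidef_of_inner {X E : Type*} [NormedAddCommGroup E] [InnerProductSpace ℂ E]
    {k : Matrix X X ℂ} {v : X → E} (hk : ∀ a b, k a b = ⟪v a, v b⟫_ℂ) : k.PosSemidef := by
  refine posSemidef_of_sum_nonneg k fun S c => ?_
  have h : ∑ a ∈ S, ∑ b ∈ S, conj (c a) * c b * k a b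
      = ((‖∑ a ∈ S, c a • v a‖ ^ 2 : ℝ) : ℂ) := by
    have h0 := inner_self_eq_norm_sq_to_K (𝕜 := ℂ) (∑ a ∈ S, c a • v a)
    rw [Complex.ofReal_pow]
    refine Eq.trans ?_ h0
    rw [sum_inner]
    simp only [inner_sum, inner_smul_left, inner_smul_right, hk]
    refine Finset.sum_congr rfl fun a _ => Finset.sum_congr rfl fun b _ => ?_
    ring
  rw [h]
  exact Complex.zero_le_real.mpr (sq_nonneg _)

theorem conj_sub_self_half_I (η : ℝ) :
    conj (Complex.I * ((η / 2 : ℝ) : ℂ)) - Complex.I * ((η / 2 : ℝ) : ℂ)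
      = -(η : ℂ) * Complex.I := by
  rw [map_mul, Complex.conj_I, Complex.conj_ofReal]
  push_cast
  ring

/-- Cauchy-Schwarz for v_{iη} and w = ∫ g(t) v_{t+iy} dt in the Gram space of the kernel. Reality of
g makes ‖w‖² the double integral with g(u)g(v), which is the form that arises from `diamond g g`. -/
theorem PolynomialGrowth.norm_integral_mul_sq_le {h : ℂ → ℂ} (hh : PolynomialGrowth h)
    (hpos : (stripKernel h).PosSemidef) {g : Test} (hg : ∀ t, conj (g t) = g t) {η y : ℝ}
    (hη : 0 < η) (hη' : η < 1 / 2) (hy : 0 < y) (hy' : y < 1 / 2) :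
    ‖∫ t : ℝ, g t * h (((-t : ℝ) : ℂ) - ((η + y : ℝ) : ℂ) * Complex.I)‖ ^ 2
      ≤ ‖h (-((2 * η : ℝ) : ℂ) * Complex.I)‖ *
        ‖∫ v : ℝ, ∫ u : ℝ, g u * g v * h (((u - v : ℝ) : ℂ) - ((2 * y : ℝ) : ℂ) * Complex.I)‖ := by
  obtain ⟨V, _, _, _, v, hv⟩ := exists_gram_of_posSemidef hpos
  have hv' : ∀ a b : Strip, ⟪v a, v b⟫_ℂ = h (conj a.1 - b.1) := hv
  let a : Strip := ⟨η * Complex.I, by simpa using hη, by simpa using hη'⟩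
  let q : ℝ → Strip := fun t => ⟨t + y * Complex.I, by simpa using hy, by simpa using hy'⟩
  have hqq : ∀ t u, ⟪v (q t), v (q u)⟫_ℂ
      = h (((t - u : ℝ) : ℂ) - ((2 * y : ℝ) : ℂ) * Complex.I) := fun t u => by
    rw [hv']
    congr 1
    simp [q]
    ring
  have haq : ∀ t, ⟪v a, v (q t)⟫_ℂ
      = h (((-t : ℝ) : ℂ) - ((η + y : ℝ) : ℂ) * Complex.I) := fun t => by
    rw [hv']
    congr 1
    simp [q, a]
    ring
  have haa : ⟪v a, v a⟫_ℂ = h (-((2 * η : ℝ) : ℂ) * Complex.I) := by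
    rw [hv']
    congr 1
    simp [a]
    ring
  have hline := hh.continuous_line (y := 2 * y) (by positivity)
  -- The abstract Gram vectors depend continuously on t because the squared norm of their
  -- differences is expressed by values of h.
  have hq : Continuous fun t => v (q t) := by
    refine continuous_iff_continuousAt.mpr fun u => ?_
    refine tendsto_iff_norm_sub_tendsto_zero.mpr ?_
    let G : ℝ → ℝ := fun t => (⟪v (q t), v (q t)⟫_ℂ - ⟪v (q t), v (q u)⟫_ℂ
      - ⟪v (q u), v (q t)⟫_ℂ + ⟪v (q u), v (q u)⟫_ℂ).re
    have hG : ∀ t, ‖v (q t) - v (q u)‖ = √(G t) := fun t => by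
      rw [← Real.sqrt_sq (norm_nonneg (v (q t) - v (q u))), ← inner_self_eq_norm_sq (𝕜 := ℂ),
        inner_sub_sub_self]
      rfl
    have hGc : Continuous fun t => √(G t) := by
      simp only [G, hqq]
      have h1 : Continuous fun t : ℝ =>
          h (((t - u : ℝ) : ℂ) - ((2 * y : ℝ) : ℂ) * Complex.I) := hline.comp (by fun_prop)
      have h2 : Continuous fun t : ℝ =>
          h (((u - t : ℝ) : ℂ) - ((2 * y : ℝ) : ℂ) * Complex.I) := hline.comp (by fun_prop)
      simp only [sub_self]
      exact Real.continuous_sqrt.comp (Complex.continuous_re.comp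
        (((continuous_const.sub h1).sub h2).add continuous_const))
    have h0 : √(G u) = 0 := by simp [G]
    simp only [hG]
    have := hGc.tendsto u
    rwa [h0] at this
  have hint : Integrable fun t => g t • v (q t) :=
    (g.continuous.smul hq).integrable_of_hasCompactSupport g.hasCompactSupport.smul_right
  set w : V := ∫ t, g t • v (q t) with hw
  have hinner : ∀ x : V, ⟪x, w⟫_ℂ = ∫ t, g t * ⟪x, v (q t)⟫_ℂ := fun x => by
    rw [hw, ← integral_inner hint]
    simp only [inner_smul_right]
  have h1 : ∫ t : ℝ, g t * h (((-t : ℝ) : ℂ) - ((η + y : ℝ) : ℂ) * Complex.I) = ⟪v a, w⟫_ℂ := by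
    rw [hinner]
    simp only [haq]
  have h2 : ∫ v : ℝ, ∫ u : ℝ, g u * g v * h (((u - v : ℝ) : ℂ) - ((2 * y : ℝ) : ℂ) * Complex.I)
      = ⟪w, w⟫_ℂ := by
    rw [hinner]
    congr 1
    funext r
    rw [← inner_conj_symm, hinner, ← integral_conj, ← integral_const_mul]
    congr 1
    funext u
    rw [map_mul, inner_conj_symm, hg, hqq]
    ring
  rw [h1, h2, ← haa, inner_self_eq_norm_sq_to_K, inner_self_eq_norm_sq_to_K, norm_pow, norm_pow,
    RCLike.norm_ofReal, RCLike.norm_ofReal, abs_norm, abs_norm, ← mul_pow]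
  exact pow_le_pow_left₀ (norm_nonneg _) (norm_inner_le_norm _ _) 2

theorem PolynomialGrowth.continuousAt {h : ℂ → ℂ} (hh : PolynomialGrowth h) {z : ℂ}
    (hz : z.im < 0) : ContinuousAt h z :=
  hh.differentiableOn.continuousOn.continuousAt
    ((isOpen_lt Complex.continuous_im continuous_const).mem_nhds hz)

/-- The Cauchy-Schwarz inequality between a vector in the strip and a vector smeared on the
boundary. -/
theorem PolynomialGrowth.norm_integral_sq_le {h : ℂ → ℂ} (hh : PolynomialGrowth h)
    (hpos : (stripKernel h).PosSemidef) {g : Test} (hg : ∀ t, conj (g t) = g t) {T : ℝ → ℂ}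
    (hT : ∀ t, HasBoundaryValue h (diamond g g t) (T t)) {η : ℝ} (hη : 0 < η) (hη' : η < 1 / 2) :
    ‖∫ t : ℝ, g t * h (((-t : ℝ) : ℂ) - (η : ℂ) * Complex.I)‖ ^ 2
      ≤ ‖h (-((2 * η : ℝ) : ℂ) * Complex.I)‖ * ‖∫ t, T t‖ := by
  obtain ⟨L, C, hC0, hC⟩ := hh.bound
  have hev : ∀ᶠ y : ℝ in 𝓝[>] 0, 0 < y ∧ y < 1 / 2 := by
    filter_upwards [Ioo_mem_nhdsGT (by norm_num : (0 : ℝ) < 1 / 2)] with y hy using hy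
  have hl : Filter.Tendsto
      (fun y : ℝ => ∫ t : ℝ, g t * h (((-t : ℝ) : ℂ) - ((η + y : ℝ) : ℂ) * Complex.I))
      (𝓝[>] 0) (𝓝 (∫ t : ℝ, g t * h (((-t : ℝ) : ℂ) - (η : ℂ) * Complex.I))) := by
    refine tendsto_integral_filter_of_dominated_convergence (fun t => ‖g t‖ * (C / η ^ L))
      ?_ ?_ ?_ ?_
    · filter_upwards [hev] with y hy
      exact (g.continuous.mul ((hh.continuous_line (add_pos hη hy.1)).comp
        continuous_neg)).aestronglyMeasurable
    · filter_upwards [hev] with y hy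
      refine Filter.Eventually.of_forall fun t => ?_
      rw [norm_mul]
      have him : (((-t : ℝ) : ℂ) - ((η + y : ℝ) : ℂ) * Complex.I).im = -(η + y) := by simp
      refine mul_le_mul_of_nonneg_left ((hC _ ?_ ?_).trans ?_) (norm_nonneg _)
      · rw [him]
        linarith [hy.2]
      · rw [him]
        linarith [hy.1]
      · rw [him, abs_neg, abs_of_pos (add_pos hη hy.1)]
        gcongr
        linarith [hy.1]
    · exact (g.continuous.norm.integrable_of_hasCompactSupport
        g.hasCompactSupport.norm).mul_const _
    · refine Filter.Eventually.of_forall fun t => Filter.Tendsto.const_mul _ ?_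
      have h1 := hh.continuousAt (z := ((-t : ℝ) : ℂ) - (η : ℂ) * Complex.I) (by simpa using hη)
      have h2 : Filter.Tendsto (fun y : ℝ => ((-t : ℝ) : ℂ) - ((η + y : ℝ) : ℂ) * Complex.I)
          (𝓝[>] 0) (𝓝 (((-t : ℝ) : ℂ) - (η : ℂ) * Complex.I)) := by
        refine tendsto_nhdsWithin_of_tendsto_nhds ?_
        have : Continuous fun y : ℝ => ((-t : ℝ) : ℂ) - ((η + y : ℝ) : ℂ) * Complex.I := by
          fun_prop
        simpa using this.tendsto 0
      exact h1.tendsto.comp h2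
  -- Both vectors in ⟨w, w⟩ lie at height y, so the double integral runs along the line Im z = -2y.
  have h2y : Filter.Tendsto (fun y : ℝ => 2 * y) (𝓝[>] 0) (𝓝[>] 0) := by
    refine tendsto_nhdsWithin_iff.mpr ⟨tendsto_nhdsWithin_of_tendsto_nhds ?_, ?_⟩
    · simpa using (continuous_const_mul (2 : ℝ)).tendsto 0
    · filter_upwards [hev] with y hy
      have := hy.1
      simp only [Set.mem_Ioi]
      positivity
  refine le_of_tendsto_of_tendsto (hl.norm.pow 2)
    (((hh.tendsto_integral_diamond g hT).comp h2y).norm.const_mul _) ?_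
  filter_upwards [hev] with y hy
  have h1 := hh.norm_integral_mul_sq_le hpos hg hη hη' hy.1 hy.2
  rwa [← hh.integral_diamond_eq g (by linarith [hy.1] : 0 < 2 * y)] at h1

/-! ### Scaling of test functions -/

/-- The test function `t ↦ d⁻¹ g(t / d)`. -/
def rescale (g : Test) {d : ℝ} (hd : 0 < d) : Test where
  toFun t := (d⁻¹ : ℂ) * g (d⁻¹ * t)
  contDiff' := contDiff_const.mul (g.contDiff.comp (by fun_prop : ContDiff ℝ _ fun t => d⁻¹ * t))
  hasCompactSupport' := HasCompactSupport.mul_left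
    (g.hasCompactSupport.comp_homeomorph (Homeomorph.mulLeft₀ d⁻¹ (by positivity)))
  tsupport_subset' := by simp

theorem rescale_apply (g : Test) {d : ℝ} (hd : 0 < d) (t : ℝ) :
    rescale g hd t = (d⁻¹ : ℂ) * g (d⁻¹ * t) := rfl

theorem supportedIn_rescale {g : Test} (hg : SupportedIn 1 g) {d : ℝ} (hd : 0 < d) :
    SupportedIn d (rescale g hd) := by
  intro t ht
  have h1 : t ∈ tsupport ((g : ℝ → ℂ) ∘ fun t => d⁻¹ * t) :=
    tsupport_mul_subset_right (f := fun _ => (d⁻¹ : ℂ)) ht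
  have h2 := hg (tsupport_comp_subset_preimage (g : ℝ → ℂ)
    (continuous_const_mul d⁻¹) h1)
  change -1 < d⁻¹ * t ∧ d⁻¹ * t < 1 at h2
  rw [← div_eq_inv_mul, lt_div_iff₀ hd, div_lt_iff₀ hd] at h2
  exact ⟨by linarith [h2.1], by linarith [h2.2]⟩

/-- The weight dⁿ cancels the factor d⁻ⁿ of the n-th derivative, and the prefactor d⁻¹ preserves L¹
norms. Bumps of all widths thus have the same norm. -/
theorem sobNorm_rescale (g : Test) {d : ℝ} (hd : 0 < d) (m : ℕ) :
    sobNorm d m (rescale g hd) = sobNorm 1 m g := by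
  unfold sobNorm
  congr 1
  funext n
  have h1 : ∀ x, ‖iteratedDeriv n (rescale g hd : ℝ → ℂ) x‖
      = d⁻¹ * (d⁻¹ ^ n * ‖iteratedDeriv n (g : ℝ → ℂ) (d⁻¹ * x)‖) := fun x => by
    have hfun : (rescale g hd : ℝ → ℂ) = fun t => (d⁻¹ : ℂ) * g (d⁻¹ * t) := rfl
    have hg : ContDiff ℝ n (g : ℝ → ℂ) := g.contDiff.of_le (by exact_mod_cast le_top)
    rw [hfun, iteratedDeriv_const_mul_field, iteratedDeriv_comp_const_smul hg, norm_mul, norm_smul,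
      norm_pow, ← Complex.ofReal_inv, Complex.norm_real, Real.norm_of_nonneg (by positivity)]
  simp only [h1, integral_const_mul]
  rw [Measure.integral_comp_mul_left (fun x => ‖iteratedDeriv n (g : ℝ → ℂ) x‖), inv_inv,
    abs_of_pos hd, smul_eq_mul, one_pow, one_mul, inv_pow]
  field_simp

theorem exists_normalized_test : ∃ g : Test, SupportedIn 1 g ∧ (∀ t, conj (g t) = g t) ∧
    ∫ t, g t = 1 := by
  let f : ContDiffBump (0 : ℝ) := ⟨1 / 4, 1 / 2, by norm_num, by norm_num⟩
  have hsupp : tsupport (fun t => ((f.normed volume t : ℝ) : ℂ)) ⊆ Metric.closedBall 0 (1 / 2) := by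
    rw [← f.tsupport_normed_eq (μ := volume)]
    refine closure_mono fun t ht hz => ht ?_
    simp only [hz, Complex.ofReal_zero]
  refine ⟨⟨fun t => ((f.normed volume t : ℝ) : ℂ),
    Complex.ofRealCLM.contDiff.comp f.contDiff_normed,
    (isCompact_closedBall (0 : ℝ) (1 / 2)).of_isClosed_subset (isClosed_tsupport _) hsupp,
    by simp⟩, fun t ht => ?_, fun t => Complex.conj_ofReal _, ?_⟩
  · have h1 := hsupp ht
    rw [Metric.mem_closedBall, dist_zero_right, Real.norm_eq_abs, abs_le] at h1
    exact ⟨by linarith [h1.1], by linarith [h1.2]⟩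
  · change ∫ t, ((f.normed volume t : ℝ) : ℂ) = 1
    rw [integral_complex_ofReal, f.integral_normed, Complex.ofReal_one]

/-! ### Vanishing on the imaginary axis -/

/-- If the boundary value of a positive kernel, smeared with test functions of small support,
is bounded by a null function, the kernel vanishes on the imaginary axis. -/
theorem PolynomialGrowth.eq_zero_of_boundaryValue {h : ℂ → ℂ} (hh : PolynomialGrowth h)
    (hpos : (stripKernel h).PosSemidef) {T : Test → ℂ} (hT : ∀ f : Test, HasBoundaryValue h f (T f))
    {ε : ℝ → ℝ} (hε : Filter.Tendsto ε (𝓝[>] 0) (𝓝 0)) {m : ℕ} {C : ℝ}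
    (hbound : ∀ d, 0 < d → ∀ g : Test, SupportedIn d g →
      ‖∫ t, T (diamond g g t)‖ ≤ ε d * sobNorm d m g * sobNorm d m g * C)
    {η : ℝ} (hη : 0 < η) (hη' : η < 1 / 2) : h (-(η : ℂ) * Complex.I) = 0 := by
  obtain ⟨g, hg1, hgr, hgi⟩ := exists_normalized_test
  obtain ⟨L, D, hD0, hD⟩ := hh.bound
  -- The pairing of h with the bump of width d after rescaling the variable; it tends to h(-iη)
  -- since the bump has integral one.
  let F : ℝ → ℂ := fun d => ∫ t : ℝ, g t * h (((-(d * t) : ℝ) : ℂ) - (η : ℂ) * Complex.I)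
  have hF : Filter.Tendsto F (𝓝[>] 0) (𝓝 (h (-(η : ℂ) * Complex.I))) := by
    have h0 : h (-(η : ℂ) * Complex.I) = ∫ t, g t * h (-(η : ℂ) * Complex.I) := by
      rw [integral_mul_const, hgi, one_mul]
    rw [h0]
    refine tendsto_integral_filter_of_dominated_convergence (fun t => ‖g t‖ * (D / η ^ L))
      ?_ ?_ ?_ ?_
    · refine Filter.Eventually.of_forall fun d => ?_
      exact (g.continuous.mul ((hh.continuous_line hη).comp
        (by fun_prop : Continuous fun t : ℝ => -(d * t)))).aestronglyMeasurable
    · refine Filter.Eventually.of_forall fun d => Filter.Eventually.of_forall fun t => ?_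
      rw [norm_mul]
      have him : (((-(d * t) : ℝ) : ℂ) - (η : ℂ) * Complex.I).im = -η := by simp
      refine mul_le_mul_of_nonneg_left ((hD _ ?_ ?_).trans_eq ?_) (norm_nonneg _)
      · rw [him]
        linarith
      · rw [him]
        linarith
      · rw [him, abs_neg, abs_of_pos hη]
    · exact (g.continuous.norm.integrable_of_hasCompactSupport
        g.hasCompactSupport.norm).mul_const _
    · refine Filter.Eventually.of_forall fun t => Filter.Tendsto.const_mul _ ?_
      have h1 := hh.continuousAt (z := -(η : ℂ) * Complex.I) (by simpa using hη)
      have h2 : Filter.Tendsto (fun d : ℝ => ((-(d * t) : ℝ) : ℂ) - (η : ℂ) * Complex.I)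
          (𝓝[>] 0) (𝓝 (-(η : ℂ) * Complex.I)) := by
        refine tendsto_nhdsWithin_of_tendsto_nhds ?_
        have : Continuous fun d : ℝ => ((-(d * t) : ℝ) : ℂ) - (η : ℂ) * Complex.I := by
          fun_prop
        simpa using this.tendsto 0
      exact h1.tendsto.comp h2
  have hFd : ∀ d, 0 < d → ‖F d‖ ^ 2 ≤
      ‖h (-((2 * η : ℝ) : ℂ) * Complex.I)‖ * (ε d * sobNorm 1 m g * sobNorm 1 m g * C) := by
    intro d hd
    have h1 := hh.norm_integral_sq_le hpos (g := rescale g hd) (fun t => by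
      rw [rescale_apply, map_mul, hgr, ← Complex.ofReal_inv, Complex.conj_ofReal])
      (fun t => hT _) hη hη'
    have h2 : ∫ t : ℝ, rescale g hd t * h (((-t : ℝ) : ℂ) - (η : ℂ) * Complex.I) = F d := by
      have h3 := Measure.integral_comp_mul_left
        (fun t : ℝ => g t * h (((-(d * t) : ℝ) : ℂ) - (η : ℂ) * Complex.I)) d⁻¹
      rw [inv_inv, abs_of_pos hd] at h3
      have h4 : ∀ t : ℝ, rescale g hd t * h (((-t : ℝ) : ℂ) - (η : ℂ) * Complex.I)
          = (d⁻¹ : ℂ) * (g (d⁻¹ * t)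
            * h (((-(d * (d⁻¹ * t)) : ℝ) : ℂ) - (η : ℂ) * Complex.I)) := fun t => by
        rw [rescale_apply, mul_inv_cancel_left₀ hd.ne', mul_assoc]
      simp only [h4]
      rw [integral_const_mul, h3, Complex.real_smul, inv_mul_cancel_left₀]
      exact_mod_cast hd.ne'
    rw [h2] at h1
    refine h1.trans (mul_le_mul_of_nonneg_left ?_ (norm_nonneg _))
    have h5 := hbound d hd _ (supportedIn_rescale hg1 hd)
    rwa [sobNorm_rescale] at h5
  have hlim : Filter.Tendsto (fun d => ‖h (-((2 * η : ℝ) : ℂ) * Complex.I)‖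
      * (ε d * sobNorm 1 m g * sobNorm 1 m g * C)) (𝓝[>] 0) (𝓝 0) := by
    simpa using ((((hε.mul_const (sobNorm 1 m g)).mul_const (sobNorm 1 m g)).mul_const C).const_mul
      ‖h (-((2 * η : ℝ) : ℂ) * Complex.I)‖)
  have hle := le_of_tendsto_of_tendsto (hF.norm.pow 2) hlim (by
    filter_upwards [self_mem_nhdsWithin] with d hd using hFd d hd)
  exact norm_eq_zero.mp (pow_eq_zero_iff two_ne_zero |>.mp (le_antisymm hle (by positivity)))

/-- Otherwise K would vanish on a segment of the imaginary axis, hence on the lower half plane by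
the identity theorem. Elsewhere K is zero by convention. -/
theorem exists_kernel_ne_zero {K : Kernel} (hK : K ≠ 0) {δ : ℝ} (hδ : 0 < δ) :
    ∃ η, 0 < η ∧ η < δ ∧ K.1 (-(η : ℂ) * Complex.I) ≠ 0 := by
  by_contra! hcon
  obtain ⟨hd, h0, -⟩ := K.2
  have hopen : IsOpen {z : ℂ | z.im < 0} := isOpen_lt Complex.continuous_im continuous_const
  have hconv : Convex ℝ {z : ℂ | z.im < 0} := convex_halfSpace_im_lt 0
  have htend : Filter.Tendsto (fun η : ℝ => -(η : ℂ) * Complex.I) (𝓝[≠] (δ / 2))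
      (𝓝[≠] (-((δ / 2 : ℝ) : ℂ) * Complex.I)) := by
    refine tendsto_nhdsWithin_iff.mpr ⟨tendsto_nhdsWithin_of_tendsto_nhds ?_, ?_⟩
    · have : Continuous fun η : ℝ => -(η : ℂ) * Complex.I := by fun_prop
      exact this.tendsto _
    · filter_upwards [self_mem_nhdsWithin] with η hη heq
      refine hη ?_
      have h1 := congrArg Complex.im heq
      simpa using h1
  have hev : ∀ᶠ η : ℝ in 𝓝[≠] (δ / 2), K.1 (-(η : ℂ) * Complex.I) = 0 := by
    filter_upwards [nhdsWithin_le_nhds (Ioo_mem_nhds (by linarith : 0 < δ / 2)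
      (by linarith : δ / 2 < δ))] with η hη using hcon η hη.1 hη.2
  have hzero := (hd.analyticOnNhd hopen).eqOn_zero_of_preconnected_of_frequently_eq_zero
    hconv.isPreconnected (z₀ := -((δ / 2 : ℝ) : ℂ) * Complex.I) (by simpa using hδ)
    (htend.frequently hev.frequently)
  refine hK (Subtype.ext (funext fun z => ?_))
  rcases lt_or_ge z.im 0 with hz | hz
  · exact hzero hz
  · exact h0 z hz

/-! ### The zero projector is not approximating -/

namespace LocalNet

variable {s : ℕ} {H : Type*} [NormedAddCommGroup H] [InnerProductSpace ℂ H] [CompleteSpace H]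
variable (N : LocalNet s H)

theorem polynomialGrowth_vacuumTwoPoint (φ : N.SmoothDual) :
    PolynomialGrowth (N.vacuumTwoPoint φ) := by
  obtain ⟨n, C, hC0, hC⟩ := N.exists_norm_fieldVector_le φ
  refine ⟨N.differentiableOn_vacuumTwoPoint φ, n * 2, (C * 4 ^ n) ^ 2, by positivity,
    fun z h1 h2 => (N.norm_vacuumTwoPoint_le φ h2).trans ?_⟩
  rw [pow_mul, ← div_pow, abs_of_neg h2]
  refine pow_le_pow_left₀ (norm_nonneg _) ((hC _ (by linarith) (by linarith)).trans_eq ?_) 2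
  rw [div_pow]
  field_simp

theorem posSemidef_stripKernel_vacuumTwoPoint (φ : N.SmoothDual) :
    (stripKernel (N.vacuumTwoPoint φ)).PosSemidef :=
  posSemidef_of_inner (v := fun a : Strip => N.translatedFieldVector φ a.1) fun a b =>
    N.vacuumTwoPoint_eq_inner φ a.2.1 b.2.1

theorem vacuumTwoPoint_neg_I (φ : N.SmoothDual) {η : ℝ} (hη : 0 < η) :
    N.vacuumTwoPoint φ (-(η : ℂ) * Complex.I) = (‖N.fieldVector φ (η / 2)‖ : ℂ) ^ 2 := by
  have h1 : (0 : ℝ) < (Complex.I * ((η / 2 : ℝ) : ℂ)).im := by simpa using hη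
  have h2 := N.vacuumTwoPoint_eq_inner φ h1 h1
  rw [N.translatedFieldVector_I_mul φ (half_pos hη), inner_self_eq_norm_sq_to_K,
    conj_sub_self_half_I] at h2
  exact h2

theorem fieldVector_eq_zero_of_le {φ : N.SmoothDual} {δ ε : ℝ} (hδ : 0 < δ) (hle : δ ≤ ε)
    (h0 : N.fieldVector φ δ = 0) : N.fieldVector φ ε = 0 := by
  have h1 := N.fieldVector_add hδ (sub_nonneg.mpr hle) φ
  rwa [add_sub_cancel, h0, map_zero] at h1

theorem not_isApproximating_zero (hsep : N.VacuumSeparating) {α : ℝ} (hα : 0 ≤ α)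
    {Q : N.Products} (hQ : Q ∈ N.PositiveProducts) (hQ0 : Q ≠ 0) :
    ¬ N.IsApproximating α Q 0 := by
  rintro ⟨-, T, ⟨-, hT⟩, ℓ, hℓ, m, ε, hε, hbound⟩
  obtain ⟨n, K, φ, hK, hφ, rfl⟩ := hQ
  let w : Fin n → ℂ → ℂ := fun j z => (K j).1 z * N.vacuumTwoPoint (φ j) z
  let h : ℂ → ℂ := fun z => ∑ j, w j z
  have hh : PolynomialGrowth h := PolynomialGrowth.sum _ fun j _ =>
    (RegularAtBoundary.polynomialGrowth (K j).2).mul (N.polynomialGrowth_vacuumTwoPoint (φ j))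
  -- Schur product theorem: entrywise products of positive semidefinite kernels are positive
  -- semidefinite.
  have hw : ∀ j, (stripKernel (w j)).PosSemidef := fun j =>
    (hK j).posSemidef.hadamard (N.posSemidef_stripKernel_vacuumTwoPoint (φ j))
  have hpos : (stripKernel h).PosSemidef := by
    have h1 : stripKernel h = ∑ j, stripKernel (w j) := by
      ext a b
      rw [Matrix.sum_apply]
      rfl
    rw [h1]
    exact Matrix.posSemidef_sum _ fun j _ => hw j
  have hbv : ∀ f : Test, HasBoundaryValue h f (T f N.vacuum) := fun f => by
    refine (hT n K (fun j => N.starDual (φ j)) φ rfl 1 N.vacuum one_pos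
      (N.isEnergyBounded_vacuum zero_le_one) f).congr' ?_
    filter_upwards [self_mem_nhdsWithin] with y hy
    congr 1
    funext x
    have him : ((x : ℂ) - y * Complex.I).im < 0 := by simpa using hy
    simp only [N.twoPoint_vacuum zero_le_one _ him]
    rfl
  -- Here α ≥ 0 enters: d^α stays bounded as d → 0, so o(d^α) implies convergence to zero.
  have hε0 : Filter.Tendsto ε (𝓝[>] 0) (𝓝 0) := by
    have h1 : (fun d : ℝ => d ^ α) =O[𝓝[>] 0] fun _ => (1 : ℝ) := by
      refine Asymptotics.IsBigO.of_bound 1 ?_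
      filter_upwards [Ioo_mem_nhdsGT (zero_lt_one (α := ℝ))] with d hd
      rw [norm_one, mul_one, Real.norm_of_nonneg (Real.rpow_nonneg hd.1.le _)]
      exact Real.rpow_le_one hd.1.le hd.2.le hα
    exact (Asymptotics.isLittleO_one_iff ℝ).mp (hε.trans_isBigO h1)
  have hzero : ∀ η : ℝ, 0 < η → η < 1 / 2 → h (-(η : ℂ) * Complex.I) = 0 := fun η hη hη' => by
    refine hh.eq_zero_of_boundaryValue hpos hbv hε0 (m := m) (C := N.energyNorm ℓ N.vacuum)
      (fun d hd g hg => ?_) hη hη'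
    have h1 := hbound d hd g g hg hg N.vacuum
    simpa [convolutionIntegral, N.translate_vacuum] using h1
  have hterm : ∀ η : ℝ, 0 < η → η < 1 / 2 → ∀ j, w j (-(η : ℂ) * Complex.I) = 0 := by
    intro η hη hη' j
    -- For a = iη/2 one has ā - a = -iη, so the summands of h(-iη) are diagonal entries of positive
    -- semidefinite kernels; a vanishing sum of these has vanishing terms.
    let a : Strip := ⟨Complex.I * ((η / 2 : ℝ) : ℂ), by simpa using hη, by
      have : ((η / 2 : ℝ)) < 1 / 2 := by linarith
      simpa using this⟩
    have ha : conj a.1 - a.1 = -(η : ℂ) * Complex.I := conj_sub_self_half_I η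
    have h1 : ∀ i, 0 ≤ w i (-(η : ℂ) * Complex.I) := fun i => by
      have h2 : 0 ≤ w i (conj a.1 - a.1) := (hw i).diag_nonneg (i := a)
      rwa [ha] at h2
    exact (Finset.sum_eq_zero_iff_of_nonneg fun i _ => h1 i).mp (hzero η hη hη') j
      (Finset.mem_univ j)
  refine hQ0 (Finset.sum_eq_zero fun j _ => ?_)
  by_cases hK0 : K j = 0
  · rw [hK0, TensorProduct.zero_tmul]
  · have hφ0 : φ j = 0 := by
      refine N.field_eq_zero_of_fieldVector_eq_zero hsep (hφ j) fun δ hδ => ?_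
      -- The bound 1/2 keeps η in the range where h is known to vanish. The bound 2δ makes the
      -- damping η/2 weaker than δ, and vanishing at a weaker damping implies vanishing at δ.
      obtain ⟨η, hη, hηlt, hne⟩ := exists_kernel_ne_zero hK0
        (lt_min (by norm_num : (0 : ℝ) < 1 / 2) (by positivity : 0 < 2 * δ))
      obtain ⟨h1, h2⟩ := lt_min_iff.mp hηlt
      refine N.fieldVector_eq_zero_of_le (half_pos hη) (by linarith) ?_
      have h3 := (mul_eq_zero.mp (hterm η hη h1 j)).resolve_left hne
      rw [N.vacuumTwoPoint_neg_I _ hη] at h3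
      simpa using h3
    rw [hφ0, TensorProduct.tmul_zero, TensorProduct.tmul_zero]

end LocalNet

end

end PointlikeQFT

theorem mainTheorem5 {s : ℕ} (hs : 2 ≤ s) {H : Type*} [NormedAddCommGroup H]
    [InnerProductSpace ℂ H] [CompleteSpace H] (N : PointlikeQFT.LocalNet s H)
    (hphase : N.MicroscopicPhaseSpaceCondition) (hsep : N.VacuumSeparating)
    (α : ℝ) (hα : 0 ≤ α) (Q : N.Products) (hQ : Q ∈ N.PositiveProducts) (hQ0 : Q ≠ 0)
    (p : N.SmoothDual →L[ℂ] N.SmoothDual) (hp : N.IsApproximating α Q p) :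
    p ≠ 0 := by
  rintro rfl
  exact N.not_isApproximating_zero hsep hα hQ hQ0 hp
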